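/- Conventions. All Hilbert spaces are complex and separable; $\mathfrak S(\mathcal H)$ is the set of states (positive operators of unit trace) on $\mathcal H$, with the trace-norm topology; $\mathcal H_{AB}=\mathcal H_A\otimes\mathcal H_B$; $\omega_A=\mathrm{Tr}_{\mathcal H_B}\omega$, $\omega_B=\mathrm{Tr}_{\mathcal H_A}\omega$ are the marginals of $\omega\in\mathfrak S(\mathcal H_{AB})$. A state is separable if it lies in the trace-norm closure of the convex hull of the product states $\rho\otimes\sigma$. A function $F$ on states with values in $[0,+\infty]$ is extended to positive trace class operators by $F(T)=[\mathrm{Tr}\,T]\,F(T/\mathrm{Tr}\,T)$, $F(0)=0$. An entanglement monotone is a function on bipartite states with values in $[0,+\infty]$ such that (EM1) $E(\omega)=0$ if and only if $\omega$ is separable; (EM2) $\sum_k E(\Lambda_k(\omega))\le E(\omega)$ for every countable collection of completely positive linear maps $\Lambda_k$ on trace class operators, all of the form $\Phi_k\otimes\mathrm{id}_B$ or all of the form $\mathrm{id}_A\otimes\Phi_k$ with completely positive $\Phi_k$, such that $\sum_k\Lambda_k$ is trace preserving; (EM3) $E(\lambda\rho+(1-\lambda)\sigma)\le\lambda E(\rho)+(1-\lambda)E(\sigma)$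 for $\lambda\in[0,1]$. For a monotone on the states of all bipartite systems of a given class (all finite-dimensional ones, or all separable ones) the maps in (EM2) may change the system on which they act, within the class; for a monotone on one set $\mathfrak S(\mathcal H_{AB})$ they map this system to itself. Further properties ($H$ is the von Neumann entropy): (EM4) $E(\omega)=H(\omega_A)=H(\omega_B)$ for every pure state $\omega$ of $AB$; (EM5) $E(\omega_{AB}\otimes\omega_{A'B'})=E(\omega_{AB})+E(\omega_{A'B'})$, with respect to the decomposition $(AA')(BB')$; (EM6) $E(\omega_{AB}\otimes\omega_{A'B'})\le E(\omega_{AB})+E(\omega_{A'B'})$, with respect to $(AA')(BB')$; (EM7) $E(\omega_{(AA')(BB')})\ge E(\omega_{AB})+E(\omega_{A'B'})$; (EM8) $E(\omega_{A(BC)})\ge E(\omega_{AB})+E(\omega_{AC})$. Proposition. Let $E$ be an entanglement monotone on the states of all finite-dimensional bipartite systems, continuous on the set of states of each such system. For separable Hilbert spaces $\mathcal H_A,\mathcal H_B$ and $\omega\in\mathfrak S(\mathcal H_{AB})$ put $$\widehat E(\omega)=\sup_{P_A,P_B}E\big((P_A\otimes P_B)\,\omega\,(P_A\otimes P_B)\big)\in[0,+\infty],$$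 where the supremum is over all finite rank orthogonal projectors $P_A$ on $\mathcal H_A$ and $P_B$ on $\mathcal H_B$, and $(P_A\otimes P_B)\omega(P_A\otimes P_B)$ is regarded as an operator on the tensor product of the ranges of $P_A$ and $P_B$. Then: A) $\widehat E$ is an entanglement monotone on the states of all separable bipartite systems; for all separable $\mathcal H_A,\mathcal H_B$ it is lower semicontinuous on $\mathfrak S(\mathcal H_{AB})$ and satisfies $\widehat E(\omega)=E(\omega)$ for every state $\omega$ with finite rank marginals $\omega_A,\omega_B$ (regarded as a state on the tensor product of the ranges of $\omega_A$ and $\omega_B$), and it is the only lower semicontinuous entanglement monotone on $\mathfrak S(\mathcal H_{AB})$ with this property. B) $\widehat E(\omega)=\lim_{n\to\infty}E\big((P_A^n\otimes P_B^n)\,\omega\,(P_A^n\otimes P_B^n)\big)$ for every $\omega\in\mathfrak S(\mathcal H_{AB})$ and arbitrary sequences $\{P_A^n\}$, $\{P_B^n\}$ of finite rank orthogonal projectors converging strongly to the identity operators of $\mathcal H_A$ and $\mathcal H_B$. C) For each $j\in\{4,5,6,7,8\}$: if $E$ has property (EM$j$) for all finite-dimensional systems, then $\widehat E$ has property (EM$j$)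 for all separable systems. -/

import Mathlib

open scoped TensorProduct ENNReal InnerProductSpace ComplexOrder

universe u

noncomputable section

namespace Entanglement

/-! ### Hilbert spaces and their tensor products -/

/-- A complex Hilbert space, bundled. -/
structure Hilb : Type (u + 1) where
  carrier : Type u
  [toNACG : NormedAddCommGroup carrier]
  [toIPS : InnerProductSpace ℂ carrier]
  [toComplete : CompleteSpace carrier]

attribute [instance] Hilb.toNACG Hilb.toIPS Hilb.toComplete

instance : CoeSort Hilb.{u} (Type u) := ⟨Hilb.carrier⟩

/-- Bounded operators on a Hilbert space. -/
abbrev Op (H : Hilb.{u}) : Type u := H →L[ℂ] H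

/-- The class of finite-dimensional Hilbert spaces. -/
def FinDim (H : Hilb.{u}) : Prop := FiniteDimensional ℂ H

/-- The class of separable Hilbert spaces (of finite or infinite dimension). -/
def Sep (H : Hilb.{u}) : Prop := TopologicalSpace.SeparableSpace H

/-- The Hilbert-space tensor product: the completion of the algebraic tensor product with
respect to the inner product `⟪a ⊗ b, a' ⊗ b'⟫ = ⟪a, a'⟫ * ⟪b, b'⟫`. -/
abbrev Hilb.tensor (A B : Hilb.{u}) : Hilb.{u} :=
  ⟨UniformSpace.Completion (A ⊗[ℂ] B)⟩

infixr:70 " ⊠ " => Hilb.tensor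

/-- The elementary tensor `a ⊗ b`. -/
def tmk {A B : Hilb.{u}} (a : A) (b : B) : A ⊠ B :=
  ((a ⊗ₜ[ℂ] b : A ⊗[ℂ] B) : UniformSpace.Completion (A ⊗[ℂ] B))

/-- The tensor product `T ⊗ S` of two bounded operators. -/
def tmap {A B A' B' : Hilb.{u}} (T : A →L[ℂ] A') (S : B →L[ℂ] B') : (A ⊠ B) →L[ℂ] (A' ⊠ B') :=
  ((UniformSpace.Completion.toComplL (𝕜 := ℂ) (E := A' ⊗[ℂ] B')).comp
    (TensorProduct.mapL T S)).extend (UniformSpace.Completion.toComplL (𝕜 := ℂ) (E := A ⊗[ℂ] B))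

theorem tmap_tmk {A B A' B' : Hilb.{u}} (T : A →L[ℂ] A') (S : B →L[ℂ] B') (a : A) (b : B) :
    tmap T S (tmk a b) = tmk (T a) (S b) := by
  have h := ContinuousLinearMap.extend_eq
    ((UniformSpace.Completion.toComplL (𝕜 := ℂ) (E := A' ⊗[ℂ] B')).comp
      (TensorProduct.mapL T S))
    (e := (UniformSpace.Completion.toComplL (𝕜 := ℂ) (E := A ⊗[ℂ] B)))
    UniformSpace.Completion.denseRange_coe
    (UniformSpace.Completion.isUniformInducing_coe _) (a ⊗ₜ[ℂ] b)
  exact h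

/-- The map `a ↦ a ⊗ b`. -/
def inR (A : Hilb.{u}) {B : Hilb.{u}} (b : B) : A →L[ℂ] (A ⊠ B) :=
  (UniformSpace.Completion.toComplL (𝕜 := ℂ) (E := A ⊗[ℂ] B)).comp
    ((TensorProduct.mkL ℂ A B).flip b)

/-- The map `b ↦ a ⊗ b`. -/
def inL {A : Hilb.{u}} (a : A) (B : Hilb.{u}) : B →L[ℂ] (A ⊠ B) :=
  (UniformSpace.Completion.toComplL (𝕜 := ℂ) (E := A ⊗[ℂ] B)).comp
    (TensorProduct.mkL ℂ A B a)

theorem inR_apply {A B : Hilb.{u}} (a : A) (b : B) : inR A b a = tmk a b := rfl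

theorem inL_apply {A B : Hilb.{u}} (a : A) (b : B) : inL a B b = tmk a b := rfl

/-- The index set of a fixed orthonormal basis of `H`. -/
def OnbIdx (H : Hilb.{u}) : Set H := (exists_hilbertBasis ℂ H).choose

/-- A fixed orthonormal basis of `H`. -/
def onb (H : Hilb.{u}) : HilbertBasis (OnbIdx H) ℂ H := (exists_hilbertBasis ℂ H).choose_spec.choose

/-! ### Trace class operators, states, entropy -/

/-- The trace norm `‖T‖₁`, as the supremum of `∑ |⟪e i, T (f i)⟫|` over all pairs of finite
orthonormal systems. -/
def traceNorm {H : Hilb.{u}} (T : Op H) : ℝ≥0∞ :=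
  ⨆ (n : ℕ) (e : Fin n → H) (f : Fin n → H) (_ : Orthonormal ℂ e) (_ : Orthonormal ℂ f),
    ∑ i, ENNReal.ofReal ‖⟪e i, T (f i)⟫_ℂ‖

theorem traceNorm_le_iff {H : Hilb.{u}} (T : Op H) (c : ℝ≥0∞) :
    traceNorm T ≤ c ↔ ∀ (n : ℕ) (e f : Fin n → H), Orthonormal ℂ e → Orthonormal ℂ f →
      ∑ i, ENNReal.ofReal ‖⟪e i, T (f i)⟫_ℂ‖ ≤ c := by
  simp only [traceNorm, iSup_le_iff]

theorem le_traceNorm {H : Hilb.{u}} (T : Op H) {n : ℕ} {e f : Fin n → H}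
    (he : Orthonormal ℂ e) (hf : Orthonormal ℂ f) :
    ∑ i, ENNReal.ofReal ‖⟪e i, T (f i)⟫_ℂ‖ ≤ traceNorm T :=
  (traceNorm_le_iff T _).1 le_rfl n e f he hf

theorem traceNorm_add_le {H : Hilb.{u}} (T S : Op H) :
    traceNorm (T + S) ≤ traceNorm T + traceNorm S := by
  rw [traceNorm_le_iff]
  intro n e f he hf
  refine le_trans ?_ (add_le_add (le_traceNorm T he hf) (le_traceNorm S he hf))
  rw [← Finset.sum_add_distrib]
  refine Finset.sum_le_sum fun i _ => ?_
  rw [← ENNReal.ofReal_add (norm_nonneg _) (norm_nonneg _)]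
  refine ENNReal.ofReal_le_ofReal ?_
  rw [_root_.add_apply, inner_add_right]
  exact norm_add_le _ _

theorem traceNorm_smul_le {H : Hilb.{u}} (c : ℂ) (T : Op H) :
    traceNorm (c • T) ≤ ENNReal.ofReal ‖c‖ * traceNorm T := by
  rw [traceNorm_le_iff]
  intro n e f he hf
  refine le_trans ?_ (mul_le_mul_right (le_traceNorm T he hf) _)
  rw [Finset.mul_sum]
  refine Finset.sum_le_sum fun i _ => ?_
  rw [← ENNReal.ofReal_mul (norm_nonneg _), _root_.smul_apply, inner_smul_right,
    norm_mul]

/-- The space `𝔗(H)` of trace class operators. -/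
def TC (H : Hilb.{u}) : Submodule ℂ (Op H) where
  carrier := {T | traceNorm T < ⊤}
  add_mem' {T S} hT hS := lt_of_le_of_lt (traceNorm_add_le T S) (ENNReal.add_lt_top.2 ⟨hT, hS⟩)
  zero_mem' := by
    have : traceNorm (0 : Op H) ≤ 0 := by
      rw [traceNorm_le_iff]
      intro n e f _ _
      simp
    exact lt_of_le_of_lt this ENNReal.zero_lt_top
  smul_mem' c T hT :=
    lt_of_le_of_lt (traceNorm_smul_le c T) (ENNReal.mul_lt_top ENNReal.ofReal_lt_top hT)

/-- The trace of a positive operator, in `[0, ∞]`. -/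
def etr {H : Hilb.{u}} (T : Op H) : ℝ≥0∞ :=
  ∑' i, ENNReal.ofReal (⟪onb H i, T (onb H i)⟫_ℂ).re

/-- The set `𝔖(H)` of states: positive operators of unit trace. -/
def states (H : Hilb.{u}) : Set (Op H) := {ρ | ρ.IsPositive ∧ etr ρ = 1}

/-- Pure states: the extreme points of the set of states. -/
def pureStates (H : Hilb.{u}) : Set (Op H) := Set.extremePoints ℝ (states H)

/-- The von Neumann entropy `Tr η(ρ)`, `η(x) = -x log x`, in `[0, ∞]`. -/
def entropy {H : Hilb.{u}} (ρ : Op H) : ℝ≥0∞ := etr (cfc Real.negMulLog ρ)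

/-- `∑ i, (V i)† ω (V i)`. -/
def ptrace {ι : Type*} {K H : Hilb.{u}} (V : ι → (K →L[ℂ] H)) (ω : Op H) : Op K :=
  ∑' i, (ContinuousLinearMap.adjoint (V i)).comp (ω.comp (V i))

/-- The marginal `ω_A = Tr_B ω`. -/
def margA {A B : Hilb.{u}} (ω : Op (A ⊠ B)) : Op A :=
  ptrace (fun j => inR A (onb B j)) ω

/-- The marginal `ω_B = Tr_A ω`. -/
def margB {A B : Hilb.{u}} (ω : Op (A ⊠ B)) : Op B :=
  ptrace (fun i => inL (onb A i) B) ω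

/-- A state is separable if it lies in the trace-norm closure of the convex hull of the set of
product states. -/
def IsSeparable {A B : Hilb.{u}} (ω : Op (A ⊠ B)) : Prop :=
  ω ∈ states (A ⊠ B) ∧ ∀ ε : ℝ≥0∞, 0 < ε →
    ∃ χ ∈ convexHull ℝ {τ : Op (A ⊠ B) | ∃ ρ ∈ states A, ∃ σ ∈ states B, τ = tmap ρ σ},
      traceNorm (ω - χ) < ε

/-- Convergence in trace norm. -/
def TendstoTr {H : Hilb.{u}} (ω : ℕ → Op H) (ω₀ : Op H) : Prop :=
  Filter.Tendsto (fun n => traceNorm (ω n - ω₀)) Filter.atTop (nhds 0)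

/-! ### Completely positive maps -/

/-- Positivity of the block operator `[T i j]` on `H ⊕ ⋯ ⊕ H`. -/
def BlockPos {H : Hilb.{u}} {n : ℕ} (T : Fin n → Fin n → Op H) : Prop :=
  ∀ x : Fin n → H, 0 ≤ ∑ i, ∑ j, ⟪x i, T i j (x j)⟫_ℂ

/-- Complete positivity of a linear map `𝔗(H) → 𝔗(K)`. -/
def IsCP {H K : Hilb.{u}} (Φ : TC H →ₗ[ℂ] TC K) : Prop :=
  ∀ (n : ℕ) (T : Fin n → Fin n → TC H),
    BlockPos (fun i j => (T i j : Op H)) → BlockPos (fun i j => (Φ (T i j) : Op K))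

/-- `Λ` is a completely positive map of the form `Φ ⊗ id_B`, with `Φ` completely positive. -/
def IsLocalA {A A' B : Hilb.{u}} (Λ : TC (A ⊠ B) →ₗ[ℂ] TC (A' ⊠ B)) : Prop :=
  IsCP Λ ∧ ∃ Φ : TC A →ₗ[ℂ] TC A', IsCP Φ ∧
    ∀ (ρ : TC A) (σ : TC B) (τ : TC (A ⊠ B)),
      (τ : Op (A ⊠ B)) = tmap (ρ : Op A) (σ : Op B) →
        (Λ τ : Op (A' ⊠ B)) = tmap (Φ ρ : Op A') (σ : Op B)

/-- `Λ` is a completely positive map of the form `id_A ⊗ Φ`, with `Φ` completely positive. -/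
def IsLocalB {A B B' : Hilb.{u}} (Λ : TC (A ⊠ B) →ₗ[ℂ] TC (A ⊠ B')) : Prop :=
  IsCP Λ ∧ ∃ Φ : TC B →ₗ[ℂ] TC B', IsCP Φ ∧
    ∀ (ρ : TC A) (σ : TC B) (τ : TC (A ⊠ B)),
      (τ : Op (A ⊠ B)) = tmap (ρ : Op A) (σ : Op B) →
        (Λ τ : Op (A ⊠ B')) = tmap (ρ : Op A) (Φ σ : Op B')

/-- For completely positive maps `Λ k`, this says that `∑ k, Λ k` is a channel, i.e. that it is
trace preserving. (For a positive trace class operator `T` it implies that `∑ k, Λ k T` converges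
in the trace norm.) -/
def SumIsChannel {H K : Hilb.{u}} (Λ : ℕ → TC H →ₗ[ℂ] TC K) : Prop :=
  ∀ T : TC H, (T : Op H).IsPositive → ∑' k, etr (Λ k T : Op K) = etr (T : Op H)

/-! ### Entanglement monotones -/

/-- The homogeneous extension `F(T) = Tr T * F(T / Tr T)` (equal to `0` at `T = 0`) of a function
on states to positive trace class operators. -/
def homExt {H : Hilb.{u}} (F : Op H → ℝ≥0∞) (T : Op H) : ℝ≥0∞ :=
  etr T * F (((etr T).toReal)⁻¹ • T)

/-- EM1: `F` vanishes exactly at the separable states. -/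
def EM1 {A B : Hilb.{u}} (F : Op (A ⊠ B) → ℝ≥0∞) : Prop :=
  ∀ ω ∈ states (A ⊠ B), F ω = 0 ↔ IsSeparable ω

/-- EM2 for operations on `A`: `∑ k, π k * F' (Λ k ω / π k) ≤ F ω`, `π k = Tr Λ k ω`. -/
def EM2A {A A' B : Hilb.{u}} (F : Op (A ⊠ B) → ℝ≥0∞) (F' : Op (A' ⊠ B) → ℝ≥0∞) : Prop :=
  ∀ Λ : ℕ → TC (A ⊠ B) →ₗ[ℂ] TC (A' ⊠ B), (∀ k, IsLocalA (Λ k)) → SumIsChannel Λ →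
    ∀ ω : TC (A ⊠ B), (ω : Op (A ⊠ B)) ∈ states (A ⊠ B) →
      ∑' k, homExt F' (Λ k ω : Op (A' ⊠ B)) ≤ F (ω : Op (A ⊠ B))

/-- EM2 for operations on `B`. -/
def EM2B {A B B' : Hilb.{u}} (F : Op (A ⊠ B) → ℝ≥0∞) (F' : Op (A ⊠ B') → ℝ≥0∞) : Prop :=
  ∀ Λ : ℕ → TC (A ⊠ B) →ₗ[ℂ] TC (A ⊠ B'), (∀ k, IsLocalB (Λ k)) → SumIsChannel Λ →
    ∀ ω : TC (A ⊠ B), (ω : Op (A ⊠ B)) ∈ states (A ⊠ B) →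
      ∑' k, homExt F' (Λ k ω : Op (A ⊠ B')) ≤ F (ω : Op (A ⊠ B))

/-- EM3: convexity. -/
def EM3 {A B : Hilb.{u}} (F : Op (A ⊠ B) → ℝ≥0∞) : Prop :=
  ∀ ρ ∈ states (A ⊠ B), ∀ σ ∈ states (A ⊠ B), ∀ t : ℝ, 0 ≤ t → t ≤ 1 →
    F (t • ρ + (1 - t) • σ) ≤ ENNReal.ofReal t * F ρ + ENNReal.ofReal (1 - t) * F σ

/-- An entanglement monotone on the set of states of one fixed bipartite system. -/
structure IsMonotoneOn (A B : Hilb.{u}) (F : Op (A ⊠ B) → ℝ≥0∞) : Prop where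
  em1 : EM1 F
  em2A : EM2A F F
  em2B : EM2B F F
  em3 : EM3 F

/-- A nonnegative function of a state of a bipartite system, given for every bipartite system.
Only its values at states of the systems under consideration matter. -/
abbrev EntFun : Type (u + 1) := ∀ A B : Hilb.{u}, Op (A ⊠ B) → ℝ≥0∞

/-- An entanglement monotone on the states of all bipartite systems `AB` composed of systems of a
class `𝒞`. The local operations in EM2 may change the system on which they act. -/
structure IsMonotone (𝒞 : Hilb.{u} → Prop) (E : EntFun.{u}) : Prop where
  em1 : ∀ A B, 𝒞 A → 𝒞 B → EM1 (E A B)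
  em2A : ∀ A A' B, 𝒞 A → 𝒞 A' → 𝒞 B → EM2A (E A B) (E A' B)
  em2B : ∀ A B B', 𝒞 A → 𝒞 B → 𝒞 B' → EM2B (E A B) (E A B')
  em3 : ∀ A B, 𝒞 A → 𝒞 B → EM3 (E A B)

/-- EM4: on pure states `E` is the entropy of either marginal. -/
def EM4 (𝒞 : Hilb.{u} → Prop) (E : EntFun.{u}) : Prop :=
  ∀ A B, 𝒞 A → 𝒞 B → ∀ ω ∈ pureStates (A ⊠ B),
    E A B ω = entropy (margA ω) ∧ E A B ω = entropy (margB ω)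

/-- `τ` is the operator `ω ⊗ ω'` regrouped according to the decomposition `(AA')(BB')`. It is
determined by its matrix elements between elementary tensors. -/
def IsRegroupedTensor {A A' B B' : Hilb.{u}} (τ : Op ((A ⊠ A') ⊠ (B ⊠ B')))
    (ω : Op (A ⊠ B)) (ω' : Op (A' ⊠ B')) : Prop :=
  ∀ (a₁ a₂ : A) (a₁' a₂' : A') (b₁ b₂ : B) (b₁' b₂' : B'),
    ⟪tmk (tmk a₁ a₁') (tmk b₁ b₁'), τ (tmk (tmk a₂ a₂') (tmk b₂ b₂'))⟫_ℂ =
      ⟪tmk a₁ b₁, ω (tmk a₂ b₂)⟫_ℂ * ⟪tmk a₁' b₁', ω' (tmk a₂' b₂')⟫_ℂ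

/-- EM5: additivity for product states. -/
def EM5 (𝒞 : Hilb.{u} → Prop) (E : EntFun.{u}) : Prop :=
  ∀ A A' B B', 𝒞 A → 𝒞 A' → 𝒞 B → 𝒞 B' →
    ∀ ω ∈ states (A ⊠ B), ∀ ω' ∈ states (A' ⊠ B'), ∀ τ : Op ((A ⊠ A') ⊠ (B ⊠ B')),
      IsRegroupedTensor τ ω ω' → E (A ⊠ A') (B ⊠ B') τ = E A B ω + E A' B' ω'

/-- EM6: subadditivity for product states. -/
def EM6 (𝒞 : Hilb.{u} → Prop) (E : EntFun.{u}) : Prop :=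
  ∀ A A' B B', 𝒞 A → 𝒞 A' → 𝒞 B → 𝒞 B' →
    ∀ ω ∈ states (A ⊠ B), ∀ ω' ∈ states (A' ⊠ B'), ∀ τ : Op ((A ⊠ A') ⊠ (B ⊠ B')),
      IsRegroupedTensor τ ω ω' → E (A ⊠ A') (B ⊠ B') τ ≤ E A B ω + E A' B' ω'

/-- The marginal `ω_AB` of a state of `(AA')(BB')`. -/
def margAB {A A' B B' : Hilb.{u}} (ω : Op ((A ⊠ A') ⊠ (B ⊠ B'))) : Op (A ⊠ B) :=
  ptrace (fun k : OnbIdx A' × OnbIdx B' => tmap (inR A (onb A' k.1)) (inR B (onb B' k.2))) ω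

/-- The marginal `ω_A'B'` of a state of `(AA')(BB')`. -/
def margA'B' {A A' B B' : Hilb.{u}} (ω : Op ((A ⊠ A') ⊠ (B ⊠ B'))) : Op (A' ⊠ B') :=
  ptrace (fun k : OnbIdx A × OnbIdx B => tmap (inL (onb A k.1) A') (inL (onb B k.2) B')) ω

/-- EM7: strong superadditivity. -/
def EM7 (𝒞 : Hilb.{u} → Prop) (E : EntFun.{u}) : Prop :=
  ∀ A A' B B', 𝒞 A → 𝒞 A' → 𝒞 B → 𝒞 B' →
    ∀ ω ∈ states ((A ⊠ A') ⊠ (B ⊠ B')),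
      E A B (margAB ω) + E A' B' (margA'B' ω) ≤ E (A ⊠ A') (B ⊠ B') ω

/-- The marginal `ω_AB` of a state of `A(BC)`. -/
def traceOutC {A B C : Hilb.{u}} (ω : Op (A ⊠ (B ⊠ C))) : Op (A ⊠ B) :=
  ptrace (fun k => tmap (ContinuousLinearMap.id ℂ A) (inR B (onb C k))) ω

/-- The marginal `ω_AC` of a state of `A(BC)`. -/
def traceOutB {A B C : Hilb.{u}} (ω : Op (A ⊠ (B ⊠ C))) : Op (A ⊠ C) :=
  ptrace (fun k => tmap (ContinuousLinearMap.id ℂ A) (inL (onb B k) C)) ω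

/-- EM8: monogamy. -/
def EM8 (𝒞 : Hilb.{u} → Prop) (E : EntFun.{u}) : Prop :=
  ∀ A B C, 𝒞 A → 𝒞 B → 𝒞 C → ∀ ω ∈ states (A ⊠ (B ⊠ C)),
    E A B (traceOutC ω) + E A C (traceOutB ω) ≤ E A (B ⊠ C) ω

/-! ### Continuity, finite rank projectors, and the universal extension -/

/-- Continuity on the set of states, in the trace norm. -/
def ContOnStates {H : Hilb.{u}} (F : Op H → ℝ≥0∞) : Prop :=
  ∀ (ω : ℕ → Op H) (ω₀ : Op H), (∀ n, ω n ∈ states H) → ω₀ ∈ states H → TendstoTr ω ω₀ →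
    Filter.Tendsto (fun n => F (ω n)) Filter.atTop (nhds (F ω₀))

/-- Lower semicontinuity on the set of states, in the trace norm. -/
def LscOnStates {H : Hilb.{u}} (F : Op H → ℝ≥0∞) : Prop :=
  ∀ (ω : ℕ → Op H) (ω₀ : Op H), (∀ n, ω n ∈ states H) → ω₀ ∈ states H → TendstoTr ω ω₀ →
    F ω₀ ≤ Filter.liminf (fun n => F (ω n)) Filter.atTop

/-- Finite rank orthogonal projectors of `H`, represented by their ranges, the
finite-dimensional subspaces. -/
abbrev FinProj (H : Hilb.{u}) : Type u := {S : Submodule ℂ H // FiniteDimensional ℂ S}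

instance {H : Hilb.{u}} (P : FinProj H) : FiniteDimensional ℂ P.1 := P.2

/-- The projector as an operator. -/
def FinProj.op {H : Hilb.{u}} (P : FinProj H) : Op H := P.1.starProjection

/-- The range of the projector as a Hilbert space. -/
abbrev FinProj.space {H : Hilb.{u}} (P : FinProj H) : Hilb.{u} :=
  haveI : CompleteSpace P.1 := FiniteDimensional.complete ℂ P.1
  ⟨P.1⟩

/-- The operator `(P_A ⊗ P_B) ω (P_A ⊗ P_B)`, regarded as an operator on the tensor product of
the ranges of `P_A` and `P_B`. -/
def compress {A B : Hilb.{u}} (P : FinProj A) (Q : FinProj B) (ω : Op (A ⊠ B)) :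
    Op (P.space ⊠ Q.space) :=
  let W : (P.space ⊠ Q.space) →L[ℂ] (A ⊠ B) :=
    tmap (A := P.space) (B := Q.space) P.1.subtypeL Q.1.subtypeL
  (ContinuousLinearMap.adjoint W).comp (ω.comp W)

/-- The value `E((P_A ⊗ P_B) ω (P_A ⊗ P_B))` of the (homogeneously extended) function `E` of
states of finite-dimensional systems. -/
def truncVal (E : EntFun.{u}) {A B : Hilb.{u}} (P : FinProj A) (Q : FinProj B)
    (ω : Op (A ⊠ B)) : ℝ≥0∞ :=
  homExt (E P.space Q.space) (compress P Q ω)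

/-- The universal extension of `E`. -/
def univExt (E : EntFun.{u}) : EntFun.{u} := fun A B ω =>
  ⨆ (P : FinProj A) (Q : FinProj B), truncVal E P Q ω

/-- `F(ω) = E(ω)` for every state `ω` with finite rank marginals; such a state is regarded as a
state of the finite-dimensional system formed by the ranges of `ω_A` and `ω_B`. -/
def AgreesOnFiniteRank (E : EntFun.{u}) {A B : Hilb.{u}} (F : Op (A ⊠ B) → ℝ≥0∞) : Prop :=
  ∀ ω ∈ states (A ⊠ B),
    ∀ (hA : FiniteDimensional ℂ (LinearMap.range (margA ω : A →ₗ[ℂ] A)))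
      (hB : FiniteDimensional ℂ (LinearMap.range (margB ω : B →ₗ[ℂ] B))),
      F ω = E (FinProj.space ⟨_, hA⟩) (FinProj.space ⟨_, hB⟩) (compress ⟨_, hA⟩ ⟨_, hB⟩ ω)

/-- Strong convergence of projectors to the identity operator. -/
def TendstoId {H : Hilb.{u}} (P : ℕ → FinProj H) : Prop :=
  ∀ x : H, Filter.Tendsto (fun n => (P n).op x) Filter.atTop (nhds x)

end Entanglement

end

noncomputable section

namespace Entanglement

open ContinuousLinearMap Filter Topology

local postfix:max "†" => ContinuousLinearMap.adjoint

/-! ### Positive operators, traces and the trace norm -/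

/-! One finite-dimensional inequality carries the proof. For contractions `V`, `W` between
finite-dimensional spaces, the homogeneous extension of `E` does not grow under `T ↦ (V ⊗ W) T (V ⊗
W)†`. Indeed `V` is one member of a countable Kraus family with `∑ V_k† V_k = 1`, whose other
members are rank one operators built from the square root of `1 - V† V`. EM2 bounds the sum over the
whole family, hence each of its terms (`IsMonotone.homExt_cj_le`). So the supremum dominates the
value of `E` at every compression by contractions (`IsMonotone.homExt_cj_le_univExt`) and reproduces
`E` on isometrically embedded operators (`IsMonotone.univExt_cj_eq`).

In finite dimension weak and trace norm convergence agree, so every truncated value is lower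
semicontinuous even for weak convergence, and so is the supremum (`univExt_le_liminf`).
Semicontinuity bounds the lower limit of the truncated values from below, monotonicity bounds each
of them from above: this is B (`IsMonotone.tendsto_univExt`). It is proved for arbitrary
contractions `V_n`, `W_n` with `V_n† V_n → 1`, `W_n† W_n → 1` strongly, so that it also covers
products of projectors.

EM1 and EM3 pass through truncations, since separability survives compression, isometric embedding
and trace norm limits. For EM2 a local channel is cut down to finite-dimensional systems. It
preserves the support on the passive side, so trace is lost only on the active side, where a Kraus
family restores it. The limit is justified by continuity of positive trace-nonincreasing maps along
truncations (`IsPosContr.tendsto_trunc`). Uniqueness compares a competitor with the extension on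
truncated states: its semicontinuity gives one inequality, its monotonicity under the measurements
`{P, 1 - P}` the other.

EM5 and EM6 hold at each product truncation and survive the limit. For EM7 and EM8 the marginals of
truncated states converge weakly enough for semicontinuity on the left, while monotonicity controls
the right. For EM4 the projectors are adapted to the pure state: spectral projectors of one
marginal, and on the other side subspaces large enough that truncation commutes with taking that
marginal. The entropies are then read off from partial sums over eigenvalues. -/

theorem ofReal_norm_sq {E : Type*} [NormedAddCommGroup E] (x : E) :
    ENNReal.ofReal (‖x‖ ^ 2) = ‖x‖ₑ ^ 2 := by
  rw [ENNReal.ofReal_pow (norm_nonneg _), ofReal_norm]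

theorem parseval {H : Type*} [NormedAddCommGroup H] [InnerProductSpace ℂ H] {ι : Type*}
    (b : HilbertBasis ι ℂ H) (x : H) : ∑' i, ‖⟪b i, x⟫_ℂ‖ₑ ^ 2 = ‖x‖ₑ ^ 2 := by
  have h := b.hasSum_inner_mul_inner x x
  have h2 : HasSum (fun i => ‖⟪b i, x⟫_ℂ‖ ^ 2) (‖x‖ ^ 2) := by
    have := Complex.hasSum_re h
    rw [inner_self_eq_norm_sq_to_K] at this
    convert this using 1
    · ext i
      rw [← inner_conj_symm x (b i), ← Complex.normSq_eq_conj_mul_self, Complex.ofReal_re,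
        Complex.normSq_eq_norm_sq]
    · norm_cast
  rw [← ofReal_norm_sq, ← h2.tsum_eq, ENNReal.ofReal_tsum_of_nonneg (fun _ => sq_nonneg _)
    h2.summable]
  simp only [ofReal_norm_sq]

/-- Basis independence of the Hilbert-Schmidt norm. -/
theorem tsum_enorm_sq_adjoint {H K : Type*} [NormedAddCommGroup H] [InnerProductSpace ℂ H]
    [CompleteSpace H] [NormedAddCommGroup K] [InnerProductSpace ℂ K] [CompleteSpace K]
    {ι κ : Type*} (b : HilbertBasis ι ℂ H) (c : HilbertBasis κ ℂ K) (S : H →L[ℂ] K) :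
    ∑' i, ‖S (b i)‖ₑ ^ 2 = ∑' j, ‖S† (c j)‖ₑ ^ 2 := by
  have h1 : ∀ i, ‖S (b i)‖ₑ ^ 2 = ∑' j, ‖⟪c j, S (b i)⟫_ℂ‖ₑ ^ 2 := fun i => (parseval c _).symm
  have h2 : ∀ j, ‖S† (c j)‖ₑ ^ 2 = ∑' i, ‖⟪b i, S† (c j)⟫_ℂ‖ₑ ^ 2 :=
    fun j => (parseval b _).symm
  simp only [h1, h2]
  rw [ENNReal.tsum_comm]
  refine tsum_congr fun j => tsum_congr fun i => ?_
  rw [adjoint_inner_right, ← inner_conj_symm, ← ofReal_norm, RCLike.norm_conj,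
    ofReal_norm]

/-- Bessel's inequality in `[0, ∞]`. -/
theorem bessel {H : Type*} [NormedAddCommGroup H] [InnerProductSpace ℂ H] {n : ℕ} {e : Fin n → H}
    (he : Orthonormal ℂ e) (x : H) : ∑ i, ‖⟪e i, x⟫_ℂ‖ₑ ^ 2 ≤ ‖x‖ₑ ^ 2 := by
  have := he.sum_inner_products_le x (s := Finset.univ)
  rw [← ofReal_norm_sq]
  refine le_trans (le_of_eq ?_) (ENNReal.ofReal_le_ofReal this)
  rw [ENNReal.ofReal_sum_of_nonneg (fun _ _ => sq_nonneg _)]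
  simp only [ofReal_norm_sq]

theorem sum_enorm_sq_le {H K : Type*} [NormedAddCommGroup H] [InnerProductSpace ℂ H]
    [CompleteSpace H] [NormedAddCommGroup K] [InnerProductSpace ℂ K] [CompleteSpace K]
    {κ : Type*} (c : HilbertBasis κ ℂ K) (S : H →L[ℂ] K)
    {n : ℕ} {e : Fin n → H} (he : Orthonormal ℂ e) :
    ∑ i, ‖S (e i)‖ₑ ^ 2 ≤ ∑' j, ‖S† (c j)‖ₑ ^ 2 := by
  have h1 : ∀ i, ‖S (e i)‖ₑ ^ 2 = ∑' j, ‖⟪c j, S (e i)⟫_ℂ‖ₑ ^ 2 := fun i => (parseval c _).symm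
  simp only [h1]
  rw [← Summable.tsum_finsetSum (fun _ _ => ENNReal.summable)]
  refine ENNReal.tsum_le_tsum fun j => le_trans (le_of_eq ?_) (bessel he _)
  refine Finset.sum_congr rfl fun i _ => ?_
  rw [adjoint_inner_right, ← inner_conj_symm, ← ofReal_norm, RCLike.norm_conj,
    ofReal_norm]

/-- The square root `S` turns every trace into a Hilbert-Schmidt sum: the trace of `V T V†` becomes
`∑ ‖V S e_i‖²`. All later trace identities are then Tonelli, termwise comparison or dominated
convergence for such sums. -/
theorem exists_sqrt {H : Hilb.{u}} {T : Op H} (hT : T.IsPositive) :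
    ∃ S : Op H, S† = S ∧ S ∘L S = T := by
  have h0 : 0 ≤ T := (nonneg_iff_isPositive T).2 hT
  refine ⟨CFC.sqrt T, ?_, CFC.sqrt_mul_sqrt_self T h0⟩
  exact (CFC.sqrt_nonneg T).isSelfAdjoint

/-- `V T V†`. -/
def cj {H K : Hilb.{u}} (V : H →L[ℂ] K) (T : Op H) : Op K := V ∘L (T ∘L V†)

theorem cj_apply {H K : Hilb.{u}} (V : H →L[ℂ] K) (T : Op H) (x : K) :
    cj V T x = V (T (V† x)) := rfl

theorem inner_cj {H K : Hilb.{u}} (V : H →L[ℂ] K) (T : Op H) (x y : K) :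
    ⟪x, cj V T y⟫_ℂ = ⟪V† x, T (V† y)⟫_ℂ := by
  rw [cj_apply, adjoint_inner_left]

theorem cj_cj {H K L : Hilb.{u}} (V : K →L[ℂ] L) (W : H →L[ℂ] K) (T : Op H) :
    cj V (cj W T) = cj (V ∘L W) T := by
  ext x; simp [cj, adjoint_comp]

theorem cj_add {H K : Hilb.{u}} (V : H →L[ℂ] K) (T S : Op H) : cj V (T + S) = cj V T + cj V S := by
  ext x; simp [cj]

theorem cj_sub {H K : Hilb.{u}} (V : H →L[ℂ] K) (T S : Op H) : cj V (T - S) = cj V T - cj V S := by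
  ext x; simp [cj]

theorem cj_smul {H K : Hilb.{u}} (V : H →L[ℂ] K) (c : ℂ) (T : Op H) : cj V (c • T) = c • cj V T := by
  ext x; simp [cj]

theorem cj_real_smul {H K : Hilb.{u}} (V : H →L[ℂ] K) (c : ℝ) (T : Op H) :
    cj V (c • T) = c • cj V T := by
  ext x; simp [cj]

theorem cj_id {H : Hilb.{u}} (T : Op H) : cj (ContinuousLinearMap.id ℂ H) T = T := by
  rw [cj, ← one_def, ← star_eq_adjoint, star_one]; rfl

theorem cj_zero {H K : Hilb.{u}} (V : H →L[ℂ] K) : cj V (0 : Op H) = 0 := by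
  ext x; simp [cj]

theorem cj_isPositive {H K : Hilb.{u}} (V : H →L[ℂ] K) {T : Op H} (hT : T.IsPositive) :
    (cj V T).IsPositive := hT.conj_adjoint V

theorem smul_isPositive {H : Hilb.{u}} {T : Op H} (hT : T.IsPositive) {c : ℝ} (hc : 0 ≤ c) :
    (c • T).IsPositive := by
  have := hT.smul_of_nonneg (c := (c : ℂ)) (by exact_mod_cast hc)
  convert this using 1
  ext x; simp

/-! ### Traces as Hilbert-Schmidt sums -/

section Sqrt

variable {H K : Hilb.{u}} {S T : Op H}

theorem inner_of_sqrt (hS : S† = S) (hT : S ∘L S = T) (x y : H) :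
    ⟪x, T y⟫_ℂ = ⟪S x, S y⟫_ℂ := by
  rw [← hT, comp_apply, ← adjoint_inner_left, hS]

theorem re_inner_of_sqrt (hS : S† = S) (hT : S ∘L S = T) (x : H) :
    (⟪x, T x⟫_ℂ).re = ‖S x‖ ^ 2 := by
  rw [inner_of_sqrt hS hT, inner_self_eq_norm_sq_to_K]; norm_cast

theorem etr_of_sqrt (hS : S† = S) (hT : S ∘L S = T) {ι : Type*} (b : HilbertBasis ι ℂ H) :
    etr T = ∑' i, ‖S (b i)‖ₑ ^ 2 := by
  rw [etr]
  simp only [re_inner_of_sqrt hS hT, ofReal_norm_sq]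
  rw [tsum_enorm_sq_adjoint (onb H) b, hS]

theorem tsum_inner_cj_of_sqrt (hS : S† = S) (hT : S ∘L S = T) (V : H →L[ℂ] K) {ι κ : Type*}
    (b : HilbertBasis ι ℂ H) (c : HilbertBasis κ ℂ K) :
    ∑' i, ENNReal.ofReal (⟪c i, cj V T (c i)⟫_ℂ).re = ∑' i, ‖V (S (b i))‖ₑ ^ 2 := by
  have := tsum_enorm_sq_adjoint c b (S ∘L V†)
  simp only [inner_cj, re_inner_of_sqrt hS hT, ofReal_norm_sq]
  simpa [adjoint_comp, hS] using this

theorem etr_cj_of_sqrt (hS : S† = S) (hT : S ∘L S = T) (V : H →L[ℂ] K) {ι : Type*}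
    (b : HilbertBasis ι ℂ H) : etr (cj V T) = ∑' i, ‖V (S (b i))‖ₑ ^ 2 :=
  tsum_inner_cj_of_sqrt hS hT V b (onb K)

end Sqrt

/-! ### Trace and trace norm of positive operators -/

section Etr

variable {H K : Hilb.{u}}

/-- The trace of a positive operator can be computed in any Hilbert basis. -/
theorem etr_eq_tsum {T : Op H} (hT : T.IsPositive) {ι : Type*} (b : HilbertBasis ι ℂ H) :
    etr T = ∑' i, ENNReal.ofReal (⟪b i, T (b i)⟫_ℂ).re := by
  obtain ⟨S, hS, hST⟩ := exists_sqrt hT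
  simp only [re_inner_of_sqrt hS hST, ofReal_norm_sq, etr_of_sqrt hS hST b]

theorem etr_zero : etr (0 : Op H) = 0 := by simp [etr]

theorem etr_add {T S : Op H} (hT : T.IsPositive) (hS : S.IsPositive) :
    etr (T + S) = etr T + etr S := by
  rw [etr, etr, etr, ← ENNReal.tsum_add]
  refine tsum_congr fun i => ?_
  rw [_root_.add_apply, inner_add_right, Complex.add_re, ENNReal.ofReal_add]
  · exact hT.re_inner_nonneg_right _
  · exact hS.re_inner_nonneg_right _

theorem etr_smul {c : ℝ} (hc : 0 ≤ c) (T : Op H) : etr (c • T) = ENNReal.ofReal c * etr T := by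
  rw [etr, etr, ← ENNReal.tsum_mul_left]
  refine tsum_congr fun i => ?_
  rw [← ENNReal.ofReal_mul hc, _root_.smul_apply, inner_smul_right_eq_smul, Complex.smul_re,
    smul_eq_mul]

theorem etr_cj_le {T : Op H} (hT : T.IsPositive) {V : H →L[ℂ] K} (hV : ‖V‖ ≤ 1) :
    etr (cj V T) ≤ etr T := by
  obtain ⟨S, hS, hST⟩ := exists_sqrt hT
  rw [etr_cj_of_sqrt hS hST V (onb H), etr_of_sqrt hS hST (onb H)]
  refine ENNReal.tsum_le_tsum fun i => ?_
  rw [← ofReal_norm_sq, ← ofReal_norm_sq]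
  refine ENNReal.ofReal_le_ofReal ?_
  gcongr
  exact (V.le_of_opNorm_le hV _).trans (by simp)

/-- Tonelli: exchange the sum over `k` with the sum `∑ ‖V_k S e_i‖²`. The condition on `V` is `∑
V_k† V_k = 1` read as a quadratic form, so a Kraus family preserves the trace. -/
theorem tsum_etr_cj {T : Op H} (hT : T.IsPositive) {κ : Type*} (V : κ → H →L[ℂ] K)
    (hV : ∀ x, ∑' k, ‖V k x‖ₑ ^ 2 = ‖x‖ₑ ^ 2) : ∑' k, etr (cj (V k) T) = etr T := by
  obtain ⟨S, hS, hST⟩ := exists_sqrt hT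
  simp only [etr_cj_of_sqrt hS hST _ (onb H), etr_of_sqrt hS hST (onb H)]
  rw [ENNReal.tsum_comm]
  simp only [hV]

theorem etr_cj_isometry {T : Op H} (hT : T.IsPositive) {V : H →L[ℂ] K} (hV : ∀ x, ‖V x‖ = ‖x‖) :
    etr (cj V T) = etr T := by
  have := tsum_etr_cj hT (fun _ : Unit => V)
    (fun x => by rw [tsum_fintype, Fintype.sum_unique, ← ofReal_norm, hV, ofReal_norm])
  simpa using this

theorem inner_le_etr {T : Op H} (hT : T.IsPositive) {n : ℕ} {e : Fin n → H}
    (he : Orthonormal ℂ e) : ∑ i, ENNReal.ofReal (⟪e i, T (e i)⟫_ℂ).re ≤ etr T := by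
  obtain ⟨S, hS, hST⟩ := exists_sqrt hT
  simp only [re_inner_of_sqrt hS hST, ofReal_norm_sq, etr_of_sqrt hS hST (onb H)]
  refine (sum_enorm_sq_le (onb H) S he).trans (le_of_eq ?_)
  rw [hS]

theorem eq_zero_of_etr_eq_zero {T : Op H} (hT : T.IsPositive) (h : etr T = 0) : T = 0 := by
  obtain ⟨S, hS, hST⟩ := exists_sqrt hT
  rw [etr_of_sqrt hS hST (onb H), ENNReal.tsum_eq_zero] at h
  have h2 : S = 0 := by
    refine ContinuousLinearMap.ext_on
      (Submodule.dense_iff_topologicalClosure_eq_top.2 (onb H).dense_span) ?_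
    rintro _ ⟨i, rfl⟩
    simpa using h i
  rw [← hST, h2, comp_zero]

theorem traceNorm_le_etr_add {T S : Op H} (hT : T.IsPositive) (hS : S.IsPositive) :
    traceNorm (T - S) ≤ etr T + etr S := by
  have key : ∀ {T : Op H}, T.IsPositive → traceNorm T ≤ etr T := by
    intro T hT
    obtain ⟨S, hS, hST⟩ := exists_sqrt hT
    rw [traceNorm_le_iff]
    intro n e f he hf
    -- Cauchy-Schwarz for `⟪S e, S f⟫` followed by `xy ≤ (x² + y²)/2`, which is the source of the
    -- two halves.
    have h1 : ∀ i, ENNReal.ofReal ‖⟪e i, T (f i)⟫_ℂ‖ ≤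
        2⁻¹ * ENNReal.ofReal (⟪e i, T (e i)⟫_ℂ).re + 2⁻¹ * ENNReal.ofReal (⟪f i, T (f i)⟫_ℂ).re := by
      intro i
      have hre := fun x => hT.re_inner_nonneg_right x
      simp only [RCLike.re_eq_complex_re] at hre
      rw [← mul_add, ← ENNReal.ofReal_add (hre _) (hre _)]
      have : (2⁻¹ : ℝ≥0∞) = ENNReal.ofReal 2⁻¹ := by
        rw [ENNReal.ofReal_inv_of_pos (by norm_num)]; norm_num
      rw [this, ← ENNReal.ofReal_mul (by norm_num)]
      refine ENNReal.ofReal_le_ofReal ?_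
      rw [inner_of_sqrt hS hST, re_inner_of_sqrt hS hST, re_inner_of_sqrt hS hST]
      have := norm_inner_le_norm (𝕜 := ℂ) (S (e i)) (S (f i))
      nlinarith [sq_nonneg (‖S (e i)‖ - ‖S (f i)‖)]
    refine (Finset.sum_le_sum fun i _ => h1 i).trans ?_
    rw [Finset.sum_add_distrib, ← Finset.mul_sum, ← Finset.mul_sum]
    refine (add_le_add (mul_le_mul_right (inner_le_etr hT he) _)
      (mul_le_mul_right (inner_le_etr hT hf) _)).trans (le_of_eq ?_)
    rw [← add_mul, ENNReal.inv_two_add_inv_two, one_mul]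
  have := traceNorm_add_le T ((-1 : ℂ) • S)
  have h2 := traceNorm_smul_le (-1 : ℂ) S
  rw [neg_smul, one_smul, ← sub_eq_add_neg] at this
  rw [neg_smul, one_smul] at h2
  simp only [norm_neg, norm_one, ENNReal.ofReal_one, one_mul] at h2
  exact this.trans (add_le_add (key hT) (h2.trans (key hS)))

theorem traceNorm_le_etr {T : Op H} (hT : T.IsPositive) : traceNorm T ≤ etr T := by
  simpa [etr_zero] using traceNorm_le_etr_add hT isPositive_zero

theorem traceNorm_neg (T : Op H) : traceNorm (-T) = traceNorm T := by
  simp [traceNorm]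

theorem traceNorm_sub_comm (T S : Op H) : traceNorm (T - S) = traceNorm (S - T) := by
  rw [← traceNorm_neg, neg_sub]

theorem norm_inner_le_traceNorm (T : Op H) {x y : H} (hx : ‖x‖ = 1) (hy : ‖y‖ = 1) :
    ENNReal.ofReal ‖⟪x, T y⟫_ℂ‖ ≤ traceNorm T := by
  have := le_traceNorm T (n := 1) (e := fun _ => x) (f := fun _ => y)
    ⟨fun _ => hx, fun i j h => (h (Subsingleton.elim i j)).elim⟩
    ⟨fun _ => hy, fun i j h => (h (Subsingleton.elim i j)).elim⟩
  simpa using this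

theorem norm_inner_le_traceNorm_mul {T : Op H} (hT : traceNorm T ≠ ⊤) (x y : H) :
    ‖⟪x, T y⟫_ℂ‖ ≤ (traceNorm T).toReal * ‖x‖ * ‖y‖ := by
  rcases eq_or_ne x 0 with rfl | hx
  · simp
  rcases eq_or_ne y 0 with rfl | hy
  · simp
  have h := norm_inner_le_traceNorm T (x := ((‖x‖⁻¹ : ℝ) : ℂ) • x) (y := ((‖y‖⁻¹ : ℝ) : ℂ) • y)
    (by simp [norm_smul, hx]) (by simp [norm_smul, hy])
  rw [ENNReal.ofReal_le_iff_le_toReal hT] at h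
  rw [map_smul, inner_smul_left, inner_smul_right, norm_mul, norm_mul, RCLike.norm_conj,
    Complex.norm_real, Complex.norm_real, norm_inv, norm_inv, norm_norm, norm_norm] at h
  have hx' : 0 < ‖x‖ := norm_pos_iff.2 hx
  have hy' : 0 < ‖y‖ := norm_pos_iff.2 hy
  field_simp at h
  linarith

theorem norm_le_traceNorm {T : Op H} (hT : traceNorm T ≠ ⊤) : ‖T‖ ≤ (traceNorm T).toReal := by
  refine opNorm_le_bound _ ENNReal.toReal_nonneg fun x => ?_
  rcases eq_or_ne (T x) 0 with h | h
  · rw [h, norm_zero]; positivity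
  have h1 := norm_inner_le_traceNorm_mul hT (T x) x
  rw [inner_self_eq_norm_sq_to_K] at h1
  simp only [norm_pow, RCLike.norm_ofReal, abs_norm] at h1
  have : 0 < ‖T x‖ := norm_pos_iff.2 h
  nlinarith

/-- The trace is Lipschitz for the trace norm. -/
theorem etr_le_add_traceNorm (T S : Op H) : etr T ≤ etr S + traceNorm (T - S) := by
  rw [etr, ENNReal.tsum_eq_iSup_sum]
  refine iSup_le fun s => ?_
  have h1 : ∀ i, ENNReal.ofReal (⟪onb H i, T (onb H i)⟫_ℂ).re ≤
      ENNReal.ofReal (⟪onb H i, S (onb H i)⟫_ℂ).re +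
        ENNReal.ofReal ‖⟪onb H i, (T - S) (onb H i)⟫_ℂ‖ := by
    intro i
    refine le_trans (ENNReal.ofReal_le_ofReal ?_) ENNReal.ofReal_add_le
    have := Complex.re_le_norm ⟪onb H i, (T - S) (onb H i)⟫_ℂ
    rw [_root_.sub_apply, inner_sub_right, Complex.sub_re] at this
    rw [_root_.sub_apply, inner_sub_right]
    linarith
  refine (Finset.sum_le_sum fun i _ => h1 i).trans ?_
  rw [Finset.sum_add_distrib]
  refine add_le_add (ENNReal.sum_le_tsum s) ?_
  have e := s.equivFin
  have ho : Orthonormal ℂ (fun k : Fin s.card => onb H (s.equivFin.symm k)) :=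
    (onb H).orthonormal.comp _ (Subtype.val_injective.comp s.equivFin.symm.injective)
  refine le_trans (le_of_eq ?_) (le_traceNorm (T - S) ho ho)
  rw [Equiv.sum_comp s.equivFin.symm (fun i : s => ENNReal.ofReal
    ‖⟪onb H i, (T - S) (onb H i)⟫_ℂ‖)]
  exact (Finset.sum_coe_sort s (fun i => ENNReal.ofReal
    ‖⟪onb H i, (T - S) (onb H i)⟫_ℂ‖)).symm

theorem etr_le_traceNorm (T : Op H) : etr T ≤ traceNorm T := by
  simpa [etr_zero] using etr_le_add_traceNorm T 0

theorem traceNorm_eq_etr {T : Op H} (hT : T.IsPositive) : traceNorm T = etr T :=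
  le_antisymm (traceNorm_le_etr hT) (etr_le_traceNorm T)

/-- Trace norm estimate for an operator squeezed between `-D` and `D`. -/
theorem traceNorm_le_of_squeeze {X D : Op H} (h1 : (D + X).IsPositive) (h2 : (D - X).IsPositive) :
    traceNorm X ≤ 3 * etr D := by
  have hD : D.IsPositive := by
    have := smul_isPositive (h1.add h2) (c := 2⁻¹) (by norm_num)
    convert this using 1
    rw [add_add_sub_cancel, ← two_smul ℝ D, smul_smul]; norm_num
  have h3 := traceNorm_le_etr_add h1 hD
  rw [add_sub_cancel_left] at h3
  have h4 : etr (D + X) ≤ 2 * etr D := by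
    have := etr_add h1 h2
    rw [add_add_sub_cancel, etr_add hD hD] at this
    rw [two_mul, this]; exact le_self_add
  calc traceNorm X ≤ 2 * etr D + etr D := h3.trans (add_le_add_left h4 _)
    _ = 3 * etr D := by ring

theorem isPositive_of_forall {T : Op H} (h : ∀ x, 0 ≤ ⟪x, T x⟫_ℂ) : T.IsPositive := by
  rw [isPositive_iff_complex]
  intro x
  obtain ⟨h2, h3⟩ := Complex.le_def.1 (h x)
  have h4 : ⟪T x, x⟫_ℂ = ⟪x, T x⟫_ℂ := by
    rw [← inner_conj_symm, Complex.conj_eq_iff_im]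
    exact h3.symm
  rw [h4]
  exact ⟨Complex.ext (by simp) (by simpa using h3), h2⟩

theorem inner_nonneg {T : Op H} (hT : T.IsPositive) (x : H) : 0 ≤ ⟪x, T x⟫_ℂ :=
  hT.inner_nonneg_right x

theorem mem_TC {T : Op H} : T ∈ TC H ↔ traceNorm T < ⊤ := Iff.rfl

theorem mem_TC_of_etr {T : Op H} (hT : T.IsPositive) (h : etr T ≠ ⊤) : T ∈ TC H :=
  mem_TC.2 ((traceNorm_le_etr hT).trans_lt h.lt_top)

end Etr

/-! ### Convergence of truncations -/

/-- Dominated convergence in `∑ ‖V_n S e_i‖²`, with the summable majorant `C² ‖S e_i‖²`. -/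
theorem tendsto_etr_cj {H K : Hilb.{u}} {T : Op H} (hT : T.IsPositive) (htr : etr T ≠ ⊤)
    (V : ℕ → H →L[ℂ] K) (V₀ : H →L[ℂ] K) {C : ℝ} (hV : ∀ n, ‖V n‖ ≤ C)
    (h0 : ∀ x, Tendsto (fun n => V n x) atTop (𝓝 (V₀ x))) :
    Tendsto (fun n => etr (cj (V n) T)) atTop (𝓝 (etr (cj V₀ T))) := by
  obtain ⟨S, hS, hST⟩ := exists_sqrt hT
  have hle : ∀ n i, ‖V n (S (onb H i))‖ ^ 2 ≤ C ^ 2 * ‖S (onb H i)‖ ^ 2 := fun n i => by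
    rw [← mul_pow]
    gcongr
    exact (V n).le_of_opNorm_le (hV n) _
  have hle0 : ∀ i, ‖V₀ (S (onb H i))‖ ^ 2 ≤ C ^ 2 * ‖S (onb H i)‖ ^ 2 := fun i =>
    le_of_tendsto' ((h0 _).norm.pow 2) fun n => hle n i
  have hsum : Summable fun i => C ^ 2 * ‖S (onb H i)‖ ^ 2 := by
    rw [etr_of_sqrt hS hST (onb H)] at htr
    simp only [← ofReal_norm_sq] at htr
    have := ENNReal.summable_toReal htr
    refine Summable.mul_left _ ?_
    simpa [ENNReal.toReal_ofReal, sq_nonneg] using this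
  have hreal : Tendsto (fun n => ∑' i, ‖V n (S (onb H i))‖ ^ 2) atTop
      (𝓝 (∑' i, ‖V₀ (S (onb H i))‖ ^ 2)) :=
    tendsto_tsum_of_dominated_convergence hsum (fun i => (h0 _).norm.pow 2)
      (Eventually.of_forall fun n i => by
        rw [Real.norm_of_nonneg (sq_nonneg _)]; exact hle n i)
  have h2 := ENNReal.tendsto_ofReal hreal
  have h3 : ∀ W : H →L[ℂ] K, (∀ i, ‖W (S (onb H i))‖ ^ 2 ≤ C ^ 2 * ‖S (onb H i)‖ ^ 2) →
      ENNReal.ofReal (∑' i, ‖W (S (onb H i))‖ ^ 2) = etr (cj W T) := fun W hW => by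
    rw [etr_cj_of_sqrt hS hST _ (onb H), ENNReal.ofReal_tsum_of_nonneg (fun _ => sq_nonneg _)
      (Summable.of_nonneg_of_le (fun _ => sq_nonneg _) hW hsum)]
    simp only [ofReal_norm_sq]
  rw [h3 _ hle0] at h2
  exact h2.congr fun n => h3 _ (hle n)

theorem tendsto_etr_cj_zero {H K : Hilb.{u}} {T : Op H} (hT : T.IsPositive) (htr : etr T ≠ ⊤)
    (V : ℕ → H →L[ℂ] K) (hV : ∀ n, ‖V n‖ ≤ 1) (h0 : ∀ x, Tendsto (fun n => V n x) atTop (𝓝 0)) :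
    Tendsto (fun n => etr (cj (V n) T)) atTop (𝓝 0) := by
  have := tendsto_etr_cj hT htr V 0 hV h0
  rwa [cj, zero_comp, etr_zero] at this

/-- The operator controlling the difference of a positive operator and its truncation. -/
def truncBound {H : Hilb.{u}} (a : ℝ) (P T : Op H) : Op H :=
  a ^ 2 • cj P T + ((a ^ 2)⁻¹ + 1) • cj (1 - P) T

section

variable {H : Hilb.{u}} {T P : Op H} {a : ℝ}

theorem truncBound_isPositive (hT : T.IsPositive) : (truncBound a P T).IsPositive :=
  (smul_isPositive (cj_isPositive _ hT) (by positivity)).add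
    (smul_isPositive (cj_isPositive _ hT) (by positivity))

theorem etr_truncBound_le (hT : T.IsPositive) (hP : ‖P‖ ≤ 1) :
    etr (truncBound a P T) ≤ ENNReal.ofReal (a ^ 2) * etr T +
      ENNReal.ofReal ((a ^ 2)⁻¹ + 1) * etr (cj (1 - P) T) := by
  rw [truncBound, etr_add (smul_isPositive (cj_isPositive _ hT) (by positivity))
    (smul_isPositive (cj_isPositive _ hT) (by positivity)), etr_smul (by positivity),
    etr_smul (by positivity)]
  gcongr
  exact etr_cj_le hT hP

/-- Completing the square. With `Q = 1 - P` the error `T - P T P` is `P T Q + Q T P + Q T Q`; the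
weights `a` and `a⁻¹` absorb the off-diagonal terms, and the extra 1 in the coefficient of `Q T Q`
cancels the last term here. With the opposite sign it leaves a surplus `2 Q T Q`. -/
theorem truncBound_sub (hP : P† = P) (ha : a ≠ 0) :
    truncBound a P T - (T - cj P T) = cj (a • P - a⁻¹ • (1 - P)) T := by
  have h1 : (1 - P)† = 1 - P := by
    rw [map_sub, hP, ← star_eq_adjoint, star_one]
  have h2 : (a • P - a⁻¹ • (1 - P))† = a • P - a⁻¹ • (1 - P) := by
    rw [← star_eq_adjoint, star_sub, star_smul, star_smul, star_eq_adjoint, star_eq_adjoint, hP, h1]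
    simp
  ext x
  simp only [truncBound, cj, h1, h2, hP]
  simp only [_root_.sub_apply, _root_.add_apply, _root_.smul_apply, comp_apply, map_sub, one_apply_eq_self,
    map_smul_of_tower]
  have ha2 : a * a⁻¹ = 1 := mul_inv_cancel₀ ha
  have ha3 : a⁻¹ * a = 1 := inv_mul_cancel₀ ha
  match_scalars <;> (field_simp; ring)

theorem truncBound_add (hP : P† = P) (ha : a ≠ 0) :
    truncBound a P T + (T - cj P T) =
      cj (a • P + a⁻¹ • (1 - P)) T + (2 : ℝ) • cj (1 - P) T := by
  have h1 : (1 - P)† = 1 - P := by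
    rw [map_sub, hP, ← star_eq_adjoint, star_one]
  have h2 : (a • P + a⁻¹ • (1 - P))† = a • P + a⁻¹ • (1 - P) := by
    rw [← star_eq_adjoint, star_add, star_smul, star_smul, star_eq_adjoint, star_eq_adjoint, hP, h1]
    simp
  ext x
  simp only [truncBound, cj, h1, h2, hP]
  simp only [_root_.sub_apply, _root_.add_apply, _root_.smul_apply, comp_apply, map_sub, one_apply_eq_self,
    map_smul_of_tower, map_add]
  have ha2 : a * a⁻¹ = 1 := mul_inv_cancel₀ ha
  have ha3 : a⁻¹ * a = 1 := inv_mul_cancel₀ ha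
  match_scalars <;> (field_simp; ring)

end

theorem etr_ne_top_of_le {H K : Hilb.{u}} {T : Op H} {S : Op K} (h : etr T ≤ etr S)
    (hS : etr S ≠ ⊤) : etr T ≠ ⊤ := (h.trans_lt hS.lt_top).ne

/-- A positive linear map of trace class operators which does not increase the trace. -/
structure IsPosContr {H K : Hilb.{u}} (G : TC H →ₗ[ℂ] TC K) : Prop where
  pos : ∀ T : TC H, (T : Op H).IsPositive → (G T : Op K).IsPositive
  le : ∀ T : TC H, (T : Op H).IsPositive → etr (G T : Op K) ≤ etr (T : Op H)

/-- Positive maps commute with the limit of strongly convergent truncations. -/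
theorem IsPosContr.tendsto_trunc {H K : Hilb.{u}} {G : TC H →ₗ[ℂ] TC K} (hG : IsPosContr G)
    (T : TC H) (hT : (T : Op H).IsPositive) (htr : etr (T : Op H) ≠ ⊤) (P : ℕ → Op H)
    (hPs : ∀ n, (P n)† = P n) (hP : ∀ n, ‖P n‖ ≤ 1) (hQ : ∀ n, ‖1 - P n‖ ≤ 1)
    (hlim : ∀ x, Tendsto (fun n => P n x) atTop (𝓝 x))
    (T' : ℕ → TC H) (hT' : ∀ n, (T' n : Op H) = cj (P n) (T : Op H)) :
    Tendsto (fun n => traceNorm ((G (T' n) : Op K) - (G T : Op K))) atTop (𝓝 0) := by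
  -- `D ± (T - T' n)` are positive, and `G` preserves positivity, so `G T - G (T' n)` is squeezed
  -- between `± G D`. Only positivity and the trace bound of `G` enter.
  have hbound : ∀ (a : ℝ) (n : ℕ), 0 < a → traceNorm ((G (T' n) : Op K) - (G T : Op K)) ≤
      3 * (ENNReal.ofReal (a ^ 2) * etr (T : Op H) +
      ENNReal.ofReal ((a ^ 2)⁻¹ + 1) * etr (cj (1 - P n) (T : Op H))) := by
    intro a n ha
    have hD := truncBound_isPositive (a := a) (P := P n) hT
    have hDe := etr_truncBound_le (a := a) hT (hP n)
    have hDtop : etr (truncBound a (P n) (T : Op H)) ≠ ⊤ := by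
      refine (hDe.trans_lt ?_).ne
      have : etr (cj (1 - P n) (T : Op H)) ≠ ⊤ := etr_ne_top_of_le (etr_cj_le hT (hQ n)) htr
      exact ENNReal.add_lt_top.2 ⟨ENNReal.mul_lt_top ENNReal.ofReal_lt_top htr.lt_top,
        ENNReal.mul_lt_top ENNReal.ofReal_lt_top this.lt_top⟩
    set D : TC H := ⟨_, mem_TC_of_etr hD hDtop⟩ with hDdef
    have h1 : (G (D + (T - T' n)) : Op K).IsPositive := by
      refine hG.pos _ ?_
      have : ((D + (T - T' n) : TC H) : Op H) = truncBound a (P n) T + (T - cj (P n) T) := by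
        rw [← hT' n]; rfl
      rw [this, truncBound_add (hPs n) ha.ne']
      exact (cj_isPositive _ hT).add (smul_isPositive (cj_isPositive _ hT) (by norm_num))
    have h2 : (G (D - (T - T' n)) : Op K).IsPositive := by
      refine hG.pos _ ?_
      have : ((D - (T - T' n) : TC H) : Op H) = truncBound a (P n) T - (T - cj (P n) T) := by
        rw [← hT' n]; rfl
      rw [this, truncBound_sub (hPs n) ha.ne']
      exact cj_isPositive _ hT
    rw [map_add] at h1
    rw [map_sub] at h2
    have h3 := traceNorm_le_of_squeeze (X := ((G (T - T' n) : TC K) : Op K)) (D := (G D : Op K)) h1 h2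
    rw [map_sub] at h3
    rw [traceNorm_sub_comm]
    refine h3.trans ?_
    gcongr
    exact (hG.le D hD).trans hDe
  have hlim0 : Tendsto (fun n => etr (cj (1 - P n) (T : Op H))) atTop (𝓝 0) := by
    refine tendsto_etr_cj_zero hT htr _ hQ fun x => ?_
    simpa using (tendsto_const_nhds (x := x)).sub (hlim x)
  rw [ENNReal.tendsto_nhds_zero]
  intro ε hε
  -- Order of choices: `a` is fixed first, making the term `a² etr T` small; afterwards the tail,
  -- although weighted by `a⁻²`, vanishes as `n` grows.
  have ha : ∃ a : ℝ, 0 < a ∧ 3 * (ENNReal.ofReal (a ^ 2) * etr (T : Op H)) < ε := by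
    have : Tendsto (fun a : ℝ => 3 * (ENNReal.ofReal (a ^ 2) * etr (T : Op H))) (𝓝[>] 0) (𝓝 0) := by
      have h1 : Tendsto (fun a : ℝ => ENNReal.ofReal (a ^ 2)) (𝓝[>] 0) (𝓝 0) := by
        have : Tendsto (fun a : ℝ => a ^ 2) (𝓝[>] 0) (𝓝 0) := by
          have : Tendsto (fun a : ℝ => a ^ 2) (𝓝 0) (𝓝 (0 ^ 2)) := (continuous_pow 2).tendsto 0
          rw [zero_pow two_ne_zero] at this
          exact this.mono_left nhdsWithin_le_nhds
        simpa using ENNReal.tendsto_ofReal this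
      have h2 := ENNReal.Tendsto.mul_const h1 (Or.inr htr)
      have h3 := ENNReal.Tendsto.const_mul h2 (a := 3) (Or.inr (by norm_num))
      simpa using h3
    obtain ⟨a, h1, h2⟩ := ((this.eventually (gt_mem_nhds hε)).and self_mem_nhdsWithin).exists
    exact ⟨a, h2, h1⟩
  obtain ⟨a, ha, hlt⟩ := ha
  have h4 : Tendsto (fun n => 3 * (ENNReal.ofReal (a ^ 2) * etr (T : Op H) +
      ENNReal.ofReal ((a ^ 2)⁻¹ + 1) * etr (cj (1 - P n) (T : Op H)))) atTop
      (𝓝 (3 * (ENNReal.ofReal (a ^ 2) * etr (T : Op H)))) := by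
    have h2 := ENNReal.Tendsto.const_mul hlim0 (a := ENNReal.ofReal ((a ^ 2)⁻¹ + 1))
      (Or.inr (by simp))
    have h5 := (tendsto_const_nhds (x := ENNReal.ofReal (a ^ 2) * etr (T : Op H))).add h2
    have h3 := ENNReal.Tendsto.const_mul h5 (a := 3) (Or.inr (by norm_num))
    simpa using h3
  filter_upwards [h4.eventually (gt_mem_nhds hlt)] with n hn
  exact (hbound a n ha).trans hn.le

theorem isPosContr_id {H : Hilb.{u}} : IsPosContr (LinearMap.id : TC H →ₗ[ℂ] TC H) :=
  ⟨fun _ h => h, fun _ _ => le_rfl⟩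

theorem tendstoTr_trunc {H : Hilb.{u}} {T : Op H} (hT : T.IsPositive) (htr : etr T ≠ ⊤)
    (P : ℕ → Op H) (hPs : ∀ n, (P n)† = P n) (hP : ∀ n, ‖P n‖ ≤ 1) (hQ : ∀ n, ‖1 - P n‖ ≤ 1)
    (hlim : ∀ x, Tendsto (fun n => P n x) atTop (𝓝 x)) :
    TendstoTr (fun n => cj (P n) T) T :=
  isPosContr_id.tendsto_trunc ⟨T, mem_TC_of_etr hT htr⟩ hT htr P hPs hP hQ hlim
    (fun n => ⟨cj (P n) T, mem_TC_of_etr (cj_isPositive _ hT)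
      (etr_ne_top_of_le (etr_cj_le hT (hP n)) htr)⟩) (fun _ => rfl)

theorem TendstoTr.tendsto_etr {H : Hilb.{u}} {T : ℕ → Op H} {T₀ : Op H} (h : TendstoTr T T₀)
    (htr : etr T₀ ≠ ⊤) : Tendsto (fun n => etr (T n)) atTop (𝓝 (etr T₀)) := by
  refine tendsto_of_tendsto_of_tendsto_of_le_of_le
    (g := fun n => etr T₀ - traceNorm (T n - T₀))
    (h := fun n => etr T₀ + traceNorm (T n - T₀)) ?_ ?_ ?_ ?_
  · have := ENNReal.Tendsto.sub (tendsto_const_nhds (x := etr T₀)) h (Or.inl htr)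
    simpa using this
  · simpa using (tendsto_const_nhds (x := etr T₀)).add h
  · intro n
    refine tsub_le_iff_right.2 ?_
    rw [traceNorm_sub_comm]
    exact etr_le_add_traceNorm _ _
  · intro n
    exact etr_le_add_traceNorm _ _

/-- Convergence of all matrix elements. -/
def TendstoWeak {H : Hilb.{u}} (T : ℕ → Op H) (T₀ : Op H) : Prop :=
  ∀ x y : H, Tendsto (fun n => ⟪x, T n y⟫_ℂ) atTop (𝓝 ⟪x, T₀ y⟫_ℂ)

theorem TendstoTr.weak {H : Hilb.{u}} {T : ℕ → Op H} {T₀ : Op H} (h : TendstoTr T T₀) :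
    TendstoWeak T T₀ := by
  intro x y
  rw [tendsto_iff_norm_sub_tendsto_zero]
  have hfin : ∀ᶠ n in atTop, traceNorm (T n - T₀) ≠ ⊤ :=
    (h.eventually (gt_mem_nhds ENNReal.zero_lt_top)).mono fun n hn => hn.ne
  have h1 : Tendsto (fun n => (traceNorm (T n - T₀)).toReal * ‖x‖ * ‖y‖) atTop (𝓝 0) := by
    have := ((ENNReal.tendsto_toReal ENNReal.zero_ne_top).comp h).mul_const ‖x‖ |>.mul_const ‖y‖
    simpa using this
  refine squeeze_zero' (Eventually.of_forall fun _ => norm_nonneg _) ?_ h1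
  filter_upwards [hfin] with n hn
  have := norm_inner_le_traceNorm_mul hn x y
  rwa [_root_.sub_apply, inner_sub_right] at this

theorem TendstoWeak.cj {H K : Hilb.{u}} {T : ℕ → Op H} {T₀ : Op H} (h : TendstoWeak T T₀)
    (V : H →L[ℂ] K) : TendstoWeak (fun n => cj V (T n)) (Entanglement.cj V T₀) := by
  intro x y
  simpa only [inner_cj] using h (V† x) (V† y)

/-! ### Finite-dimensional spaces -/

/-- Bessel's inequality in both arguments after `xy ≤ x² + y²`. The bound is crude, but it suffices
for expansions in matrix elements. -/
theorem traceNorm_rankOne_le {H : Hilb.{u}} (x y : H) :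
    traceNorm (InnerProductSpace.rankOne ℂ x y : Op H) ≤ ENNReal.ofReal (‖x‖ ^ 2 + ‖y‖ ^ 2) := by
  rw [traceNorm_le_iff]
  intro n e f he hf
  have h1 : ∀ i, ENNReal.ofReal ‖⟪e i, (InnerProductSpace.rankOne ℂ x y : Op H) (f i)⟫_ℂ‖ ≤
      ‖⟪e i, x⟫_ℂ‖ₑ ^ 2 + ‖⟪f i, y⟫_ℂ‖ₑ ^ 2 := by
    intro i
    rw [← ofReal_norm_sq, ← ofReal_norm_sq, ← ENNReal.ofReal_add (sq_nonneg _) (sq_nonneg _)]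
    refine ENNReal.ofReal_le_ofReal ?_
    rw [InnerProductSpace.rankOne_apply, inner_smul_right, norm_mul, ← inner_conj_symm y (f i),
      RCLike.norm_conj]
    nlinarith [sq_nonneg (‖⟪e i, x⟫_ℂ‖ - ‖⟪f i, y⟫_ℂ‖), sq_nonneg (‖⟪e i, x⟫_ℂ‖),
      sq_nonneg (‖⟪f i, y⟫_ℂ‖), norm_nonneg ⟪e i, x⟫_ℂ, norm_nonneg ⟪f i, y⟫_ℂ]
  refine (Finset.sum_le_sum fun i _ => h1 i).trans ?_
  rw [Finset.sum_add_distrib, ENNReal.ofReal_add (sq_nonneg _) (sq_nonneg _), ofReal_norm_sq,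
    ofReal_norm_sq]
  exact add_le_add (bessel he x) (bessel hf y)

theorem traceNorm_sum_le {H : Hilb.{u}} {ι : Type*} (s : Finset ι) (T : ι → Op H) :
    traceNorm (∑ i ∈ s, T i) ≤ ∑ i ∈ s, traceNorm (T i) := by
  classical
  induction s using Finset.induction_on with
  | empty => simp [traceNorm]
  | insert a s ha ih =>
    rw [Finset.sum_insert ha, Finset.sum_insert ha]
    exact (traceNorm_add_le _ _).trans (add_le_add_right ih _)

section FiniteDim

variable {H K : Hilb.{u}}

theorem eq_sum_rankOne [FiniteDimensional ℂ H] (T : Op H) :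
    T = ∑ i, ∑ j, ⟪stdOrthonormalBasis ℂ H i, T (stdOrthonormalBasis ℂ H j)⟫_ℂ •
      InnerProductSpace.rankOne ℂ (stdOrthonormalBasis ℂ H i) (stdOrthonormalBasis ℂ H j) := by
  ext x
  simp only [_root_.sum_apply, _root_.smul_apply, InnerProductSpace.rankOne_apply]
  rw [Finset.sum_comm]
  conv_lhs => rw [← (stdOrthonormalBasis ℂ H).sum_repr' x, map_sum]
  refine Finset.sum_congr rfl fun j _ => ?_
  rw [map_smul]
  conv_lhs => rw [← (stdOrthonormalBasis ℂ H).sum_repr' (T _), Finset.smul_sum]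
  refine Finset.sum_congr rfl fun i _ => ?_
  rw [smul_smul, smul_smul, mul_comm]

theorem cj_rankOne (V : H →L[ℂ] K) (x y : H) :
    cj V (InnerProductSpace.rankOne ℂ x y : Op H) = InnerProductSpace.rankOne ℂ (V x) (V y) := by
  ext z
  simp [cj, adjoint_inner_right]

theorem cj_sum {ι : Type*} (V : H →L[ℂ] K) (s : Finset ι) (T : ι → Op H) :
    cj V (∑ i ∈ s, T i) = ∑ i ∈ s, cj V (T i) := by
  ext x; simp [cj, _root_.sum_apply]

/-- A bound for the trace norm on a finite-dimensional space, in terms of matrix elements. -/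
theorem traceNorm_cj_le_sum [FiniteDimensional ℂ H] (V : H →L[ℂ] K) (T : Op H) :
    traceNorm (cj V T) ≤ ∑ i, ∑ j,
      ENNReal.ofReal ‖⟪stdOrthonormalBasis ℂ H i, T (stdOrthonormalBasis ℂ H j)⟫_ℂ‖ *
        ENNReal.ofReal (‖V (stdOrthonormalBasis ℂ H i)‖ ^ 2 +
          ‖V (stdOrthonormalBasis ℂ H j)‖ ^ 2) := by
  conv_lhs => rw [eq_sum_rankOne T, cj_sum]
  refine (traceNorm_sum_le _ _).trans (Finset.sum_le_sum fun i _ => ?_)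
  rw [cj_sum]
  refine (traceNorm_sum_le _ _).trans (Finset.sum_le_sum fun j _ => ?_)
  rw [cj_smul]
  refine (traceNorm_smul_le _ _).trans ?_
  gcongr
  rw [cj_rankOne]
  exact traceNorm_rankOne_le _ _

theorem traceNorm_cj_lt_top [FiniteDimensional ℂ H] (V : H →L[ℂ] K) (T : Op H) :
    traceNorm (cj V T) < ⊤ := by
  refine (traceNorm_cj_le_sum V T).trans_lt ?_
  refine ENNReal.sum_lt_top.2 fun i _ => ENNReal.sum_lt_top.2 fun j _ => ?_
  exact ENNReal.mul_lt_top ENNReal.ofReal_lt_top ENNReal.ofReal_lt_top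

theorem traceNorm_lt_top [FiniteDimensional ℂ H] (T : Op H) : traceNorm T < ⊤ := by
  have := traceNorm_cj_lt_top (ContinuousLinearMap.id ℂ H) T
  rwa [cj_id] at this

theorem etr_ne_top [FiniteDimensional ℂ H] (T : Op H) : etr T ≠ ⊤ :=
  ((etr_le_traceNorm T).trans_lt (traceNorm_lt_top T)).ne

/-- From a finite-dimensional space, weak convergence is pushed forward to trace norm
convergence. -/
theorem TendstoWeak.cj_tr [FiniteDimensional ℂ H] {T : ℕ → Op H} {T₀ : Op H}
    (h : TendstoWeak T T₀) (V : H →L[ℂ] K) :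
    TendstoTr (fun n => Entanglement.cj V (T n)) (Entanglement.cj V T₀) := by
  have h1 : Tendsto (fun n => ∑ i, ∑ j,
      ENNReal.ofReal ‖⟪stdOrthonormalBasis ℂ H i, (T n - T₀) (stdOrthonormalBasis ℂ H j)⟫_ℂ‖ *
        ENNReal.ofReal (‖V (stdOrthonormalBasis ℂ H i)‖ ^ 2 +
          ‖V (stdOrthonormalBasis ℂ H j)‖ ^ 2)) atTop (𝓝 (∑ i : Fin (Module.finrank ℂ H),
            ∑ j : Fin (Module.finrank ℂ H), 0)) := by
    refine tendsto_finsetSum _ fun i _ => tendsto_finsetSum _ fun j _ => ?_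
    have h2 := (tendsto_iff_norm_sub_tendsto_zero.1
      (h (stdOrthonormalBasis ℂ H i) (stdOrthonormalBasis ℂ H j)))
    have h3 := ENNReal.tendsto_ofReal h2
    have h4 := ENNReal.Tendsto.mul_const h3 (b := ENNReal.ofReal
      (‖V (stdOrthonormalBasis ℂ H i)‖ ^ 2 + ‖V (stdOrthonormalBasis ℂ H j)‖ ^ 2))
      (Or.inr ENNReal.ofReal_ne_top)
    rw [ENNReal.ofReal_zero, zero_mul] at h4
    simpa only [_root_.sub_apply, inner_sub_right] using h4
  simp only [Finset.sum_const_zero] at h1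
  refine tendsto_of_tendsto_of_tendsto_of_le_of_le tendsto_const_nhds h1 (fun _ => bot_le)
    fun n => ?_
  rw [← cj_sub]
  exact traceNorm_cj_le_sum V _

theorem TendstoWeak.tr [FiniteDimensional ℂ H] {T : ℕ → Op H} {T₀ : Op H}
    (h : TendstoWeak T T₀) : TendstoTr T T₀ := by
  simpa only [cj_id] using h.cj_tr (ContinuousLinearMap.id ℂ H)

end FiniteDim

/-! ### Tensor products -/

section Tensor

variable {A B A' B' A'' B'' : Hilb.{u}}

theorem inner_tmk (a a' : A) (b b' : B) :
    ⟪tmk a b, tmk a' b'⟫_ℂ = ⟪a, a'⟫_ℂ * ⟪b, b'⟫_ℂ := by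
  simp only [tmk]
  rw [UniformSpace.Completion.inner_coe, TensorProduct.inner_tmul]

theorem tmk_add_left (a a' : A) (b : B) : tmk (a + a') b = tmk a b + tmk a' b :=
  map_add (inR A b) a a'

theorem tmk_add_right (a : A) (b b' : B) : tmk a (b + b') = tmk a b + tmk a b' :=
  map_add (inL a B) b b'

theorem tmk_smul_left (c : ℂ) (a : A) (b : B) : tmk (c • a) b = c • tmk a b :=
  map_smul (inR A b) c a

theorem tmk_smul_right (c : ℂ) (a : A) (b : B) : tmk a (c • b) = c • tmk a b :=
  map_smul (inL a B) c b

theorem dense_span_tmk :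
    Dense (Submodule.span ℂ (Set.range fun p : A × B => tmk p.1 p.2) : Set (A ⊠ B)) := by
  refine (UniformSpace.Completion.denseRange_coe (α := A ⊗[ℂ] B)).mono ?_
  rintro _ ⟨x, rfl⟩
  induction x using TensorProduct.induction_on with
  | zero => exact Submodule.zero_mem _
  | tmul a b => exact Submodule.subset_span ⟨(a, b), rfl⟩
  | add x y hx hy =>
    rw [UniformSpace.Completion.coe_add]
    exact Submodule.add_mem _ hx hy

theorem ext_tmk {F : Type*} [NormedAddCommGroup F] [NormedSpace ℂ F] {T S : (A ⊠ B) →L[ℂ] F}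
    (h : ∀ a b, T (tmk a b) = S (tmk a b)) : T = S := by
  refine ContinuousLinearMap.ext_on dense_span_tmk ?_
  rintro _ ⟨p, rfl⟩
  exact h p.1 p.2

theorem tmap_coe (T : A →L[ℂ] A') (S : B →L[ℂ] B') (x : A ⊗[ℂ] B) :
    tmap T S (x : UniformSpace.Completion (A ⊗[ℂ] B)) =
      ((TensorProduct.mapL T S x : A' ⊗[ℂ] B') : UniformSpace.Completion (A' ⊗[ℂ] B')) := by
  have h := ContinuousLinearMap.extend_eq
    ((UniformSpace.Completion.toComplL (𝕜 := ℂ) (E := A' ⊗[ℂ] B')).comp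
      (TensorProduct.mapL T S))
    (e := (UniformSpace.Completion.toComplL (𝕜 := ℂ) (E := A ⊗[ℂ] B)))
    UniformSpace.Completion.denseRange_coe
    (UniformSpace.Completion.isUniformInducing_coe _) x
  exact h

theorem norm_tmap_apply_le (T : A →L[ℂ] A') (S : B →L[ℂ] B') (x : A ⊠ B) :
    ‖tmap T S x‖ ≤ ‖T‖ * ‖S‖ * ‖x‖ := by
  induction x using UniformSpace.Completion.induction_on with
  | hp =>
    exact isClosed_le (by fun_prop) (by fun_prop)
  | ih x =>
    rw [tmap_coe]
    erw [UniformSpace.Completion.norm_coe, UniformSpace.Completion.norm_coe]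
    exact (TensorProduct.mapL T S).le_of_opNorm_le (TensorProduct.norm_mapL_le T S) x

theorem norm_tmap_le (T : A →L[ℂ] A') (S : B →L[ℂ] B') : ‖tmap T S‖ ≤ ‖T‖ * ‖S‖ :=
  opNorm_le_bound _ (by positivity) (norm_tmap_apply_le T S)

theorem norm_tmap_le_one {T : A →L[ℂ] A'} {S : B →L[ℂ] B'} (hT : ‖T‖ ≤ 1) (hS : ‖S‖ ≤ 1) :
    ‖tmap T S‖ ≤ 1 :=
  (norm_tmap_le T S).trans (mul_le_one₀ hT (norm_nonneg _) hS)

theorem tmap_comp (T' : A' →L[ℂ] A'') (S' : B' →L[ℂ] B'') (T : A →L[ℂ] A') (S : B →L[ℂ] B') :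
    tmap T' S' ∘L tmap T S = tmap (T' ∘L T) (S' ∘L S) :=
  ext_tmk fun a b => by rw [comp_apply, tmap_tmk, tmap_tmk, tmap_tmk]; rfl

theorem tmap_comp_apply (T' : A' →L[ℂ] A'') (S' : B' →L[ℂ] B'') (T : A →L[ℂ] A')
    (S : B →L[ℂ] B') (x : A ⊠ B) :
    tmap T' S' (tmap T S x) = tmap (T' ∘L T) (S' ∘L S) x := by
  rw [← tmap_comp]; rfl

theorem tmap_id : tmap (ContinuousLinearMap.id ℂ A) (ContinuousLinearMap.id ℂ B) =
    ContinuousLinearMap.id ℂ (A ⊠ B) :=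
  ext_tmk fun a b => by rw [tmap_tmk]; rfl

theorem ext_inner_tmk {x y : A ⊠ B} (h : ∀ a b, ⟪tmk a b, x⟫_ℂ = ⟪tmk a b, y⟫_ℂ) : x = y := by
  have : innerSL ℂ x = innerSL ℂ y := ext_tmk fun a b => by
    simp only [innerSL_apply_apply]
    rw [← inner_conj_symm, h, inner_conj_symm]
  refine ext_inner_right ℂ fun v => ?_
  simpa using congrArg (fun f => f v) this

theorem tmap_adjoint (T : A →L[ℂ] A') (S : B →L[ℂ] B') : (tmap T S)† = tmap T† S† := by
  refine ext_tmk fun a b => ext_inner_tmk fun a' b' => ?_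
  rw [adjoint_inner_right, tmap_tmk, tmap_tmk, inner_tmk, inner_tmk, adjoint_inner_right,
    adjoint_inner_right]

theorem tmap_add_left (T T' : A →L[ℂ] A') (S : B →L[ℂ] B') :
    tmap (T + T') S = tmap T S + tmap T' S :=
  ext_tmk fun a b => by
    rw [tmap_tmk, _root_.add_apply, _root_.add_apply, tmap_tmk, tmap_tmk, tmk_add_left]

theorem tmap_add_right (T : A →L[ℂ] A') (S S' : B →L[ℂ] B') :
    tmap T (S + S') = tmap T S + tmap T S' :=
  ext_tmk fun a b => by
    rw [tmap_tmk, _root_.add_apply, _root_.add_apply, tmap_tmk, tmap_tmk, tmk_add_right]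

theorem tmap_smul_left (c : ℂ) (T : A →L[ℂ] A') (S : B →L[ℂ] B') :
    tmap (c • T) S = c • tmap T S :=
  ext_tmk fun a b => by
    rw [tmap_tmk, _root_.smul_apply, _root_.smul_apply, tmap_tmk, tmk_smul_left]

theorem tmap_smul_right (c : ℂ) (T : A →L[ℂ] A') (S : B →L[ℂ] B') :
    tmap T (c • S) = c • tmap T S :=
  ext_tmk fun a b => by
    rw [tmap_tmk, _root_.smul_apply, _root_.smul_apply, tmap_tmk, tmk_smul_right]

theorem cj_tmap (V : A →L[ℂ] A') (W : B →L[ℂ] B') (T : Op A) (S : Op B) :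
    cj (tmap V W) (tmap T S) = tmap (cj V T) (cj W S) := by
  rw [cj, tmap_adjoint, tmap_comp, tmap_comp]; rfl

theorem tmap_isPositive {T : Op A} {S : Op B} (hT : T.IsPositive) (hS : S.IsPositive) :
    (tmap T S).IsPositive := by
  obtain ⟨X, hX, hXT⟩ := exists_sqrt hT
  obtain ⟨Y, hY, hYS⟩ := exists_sqrt hS
  have := isPositive_adjoint_comp_self (tmap X Y)
  rwa [tmap_adjoint, tmap_comp, hX, hY, hXT, hYS] at this

theorem norm_tmap_isometry {T : A →L[ℂ] A'} {S : B →L[ℂ] B'} (hT : T† ∘L T = .id ℂ A)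
    (hS : S† ∘L S = .id ℂ B) : (tmap T S)† ∘L tmap T S = .id ℂ (A ⊠ B) := by
  rw [tmap_adjoint, tmap_comp, hT, hS, tmap_id]

/-- The product Hilbert basis. -/
def prodBasis {ι κ : Type*} (b : HilbertBasis ι ℂ A) (c : HilbertBasis κ ℂ B) :
    HilbertBasis (ι × κ) ℂ (A ⊠ B) :=
  HilbertBasis.mk (v := fun p : ι × κ => tmk (b p.1) (c p.2))
    (by
      classical
      rw [orthonormal_iff_ite]
      intro p q
      rw [inner_tmk, orthonormal_iff_ite.1 b.orthonormal, orthonormal_iff_ite.1 c.orthonormal]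
      by_cases h1 : p.1 = q.1 <;> by_cases h2 : p.2 = q.2 <;> simp [h1, h2, Prod.ext_iff])
    (by
      set M := (Submodule.span ℂ (Set.range fun p : ι × κ =>
        tmk (b p.1) (c p.2))).topologicalClosure with hM
      have hcl : IsClosed (M : Set (A ⊠ B)) := Submodule.isClosed_topologicalClosure _
      -- Density is proved one factor at a time: the closed span contains `b i ⊗ y` for all `y`,
      -- then `x ⊗ y` for all `x`.
      have h1 : ∀ i y, tmk (b i) y ∈ M := by
        intro i y
        have hle : (Submodule.span ℂ (Set.range c)).topologicalClosure ≤
            M.comap (inL (b i) B : B →ₗ[ℂ] (A ⊠ B)) := by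
          refine Submodule.topologicalClosure_minimal _ (Submodule.span_le.2 ?_)
            (hcl.preimage (inL (b i) B).continuous)
          rintro _ ⟨k, rfl⟩
          exact Submodule.le_topologicalClosure _ (Submodule.subset_span ⟨(i, k), rfl⟩)
        rw [c.dense_span] at hle
        exact hle (Submodule.mem_top (x := y))
      have h2 : ∀ x y, tmk x y ∈ M := by
        intro x y
        have hle : (Submodule.span ℂ (Set.range b)).topologicalClosure ≤
            M.comap (inR A y : A →ₗ[ℂ] (A ⊠ B)) := by
          refine Submodule.topologicalClosure_minimal _ (Submodule.span_le.2 ?_)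
            (hcl.preimage (inR A y).continuous)
          rintro _ ⟨k, rfl⟩
          exact h1 k y
        rw [b.dense_span] at hle
        exact hle (Submodule.mem_top (x := x))
      have h3 : (Submodule.span ℂ (Set.range fun p : A × B => tmk p.1 p.2)).topologicalClosure ≤ M := by
        refine Submodule.topologicalClosure_minimal _ (Submodule.span_le.2 ?_) hcl
        rintro _ ⟨p, rfl⟩
        exact h2 p.1 p.2
      rwa [Submodule.dense_iff_topologicalClosure_eq_top.1 dense_span_tmk] at h3)

theorem prodBasis_apply {ι κ : Type*} (b : HilbertBasis ι ℂ A) (c : HilbertBasis κ ℂ B)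
    (p : ι × κ) : prodBasis b c p = tmk (b p.1) (c p.2) := by
  simp [prodBasis]

theorem etr_tmap {T : Op A} {S : Op B} (hT : T.IsPositive) (hS : S.IsPositive) :
    etr (tmap T S) = etr T * etr S := by
  rw [etr_eq_tsum (tmap_isPositive hT hS) (prodBasis (onb A) (onb B)), ENNReal.tsum_prod',
    etr, etr, ← ENNReal.tsum_mul_right]
  refine tsum_congr fun i => ?_
  rw [← ENNReal.tsum_mul_left]
  refine tsum_congr fun j => ?_
  rw [prodBasis_apply, tmap_tmk, inner_tmk]
  have h1 := inner_nonneg hT (onb A i)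
  have h2 := inner_nonneg hS (onb B j)
  rw [← ENNReal.ofReal_mul (Complex.le_def.1 h1).1, Complex.mul_re,
    ← (Complex.le_def.1 h1).2]
  simp

/-- `(inR A b)†` is the partial inner product with `b`. It intertwines `V ⊗ 1` with `V`, which
reduces norm identities on `A ⊠ B` to identities on `A`, one slice at a time. -/
theorem slice_tmap_left (V : A →L[ℂ] A') (b : B) (z : A ⊠ B) :
    (inR A' b)† (tmap V (.id ℂ B) z) = V ((inR A b)† z) := by
  refine ext_inner_left ℂ fun a => ?_
  rw [adjoint_inner_right, ← adjoint_inner_left, ← adjoint_inner_left V, adjoint_inner_right,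
    inR_apply, inR_apply, tmap_adjoint, tmap_tmk]
  rw [← one_def, ← star_eq_adjoint, star_one]; rfl

theorem slice_tmap_right (V : B →L[ℂ] B') (a : A) (z : A ⊠ B) :
    (inL a B')† (tmap (.id ℂ A) V z) = V ((inL a B)† z) := by
  refine ext_inner_left ℂ fun b => ?_
  rw [adjoint_inner_right, ← adjoint_inner_left, ← adjoint_inner_left V, adjoint_inner_right,
    inL_apply, inL_apply, tmap_adjoint, tmap_tmk]
  rw [← one_def, ← star_eq_adjoint, star_one]; rfl

theorem parseval_slice_left {κ : Type*} (c : HilbertBasis κ ℂ B) (z : A ⊠ B) :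
    ∑' l, ‖(inR A (c l))† z‖ₑ ^ 2 = ‖z‖ₑ ^ 2 := by
  rw [← parseval (prodBasis (onb A) c) z, ENNReal.tsum_prod', ENNReal.tsum_comm]
  refine tsum_congr fun l => ?_
  rw [← parseval (onb A)]
  refine tsum_congr fun i => ?_
  rw [adjoint_inner_right, inR_apply, prodBasis_apply]

theorem parseval_slice_right {κ : Type*} (c : HilbertBasis κ ℂ A) (z : A ⊠ B) :
    ∑' l, ‖(inL (c l) B)† z‖ₑ ^ 2 = ‖z‖ₑ ^ 2 := by
  rw [← parseval (prodBasis c (onb B)) z, ENNReal.tsum_prod']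
  refine tsum_congr fun l => ?_
  rw [← parseval (onb B)]
  refine tsum_congr fun i => ?_
  rw [adjoint_inner_right, inL_apply, prodBasis_apply]

/-- A resolution of the identity of `A` gives one of `A ⊠ B`. -/
theorem tsum_enorm_tmap_left {κ : Type*} (V : κ → A →L[ℂ] A')
    (hV : ∀ x, ∑' k, ‖V k x‖ₑ ^ 2 = ‖x‖ₑ ^ 2) (z : A ⊠ B) :
    ∑' k, ‖tmap (V k) (.id ℂ B) z‖ₑ ^ 2 = ‖z‖ₑ ^ 2 := by
  rw [← parseval_slice_left (onb B) z]
  simp only [← hV]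
  rw [ENNReal.tsum_comm]
  refine tsum_congr fun k => ?_
  rw [← parseval_slice_left (onb B)]
  exact tsum_congr fun l => by rw [slice_tmap_left]

theorem tsum_enorm_tmap_right {κ : Type*} (V : κ → B →L[ℂ] B')
    (hV : ∀ x, ∑' k, ‖V k x‖ₑ ^ 2 = ‖x‖ₑ ^ 2) (z : A ⊠ B) :
    ∑' k, ‖tmap (.id ℂ A) (V k) z‖ₑ ^ 2 = ‖z‖ₑ ^ 2 := by
  rw [← parseval_slice_right (onb A) z]
  simp only [← hV]
  rw [ENNReal.tsum_comm]
  refine tsum_congr fun k => ?_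
  rw [← parseval_slice_right (onb A)]
  exact tsum_congr fun l => by rw [slice_tmap_right]

/-- Uniformly bounded operators that converge on a total set converge strongly: approximate the
vector and split the error into three parts. -/
theorem tendsto_of_dense_span {F G : Type*} [NormedAddCommGroup F] [NormedSpace ℂ F]
    [NormedAddCommGroup G] [NormedSpace ℂ G] {s : Set F} (hs : Dense (Submodule.span ℂ s : Set F))
    (V : ℕ → F →L[ℂ] G) (V₀ : F →L[ℂ] G) {C : ℝ} (hC : ∀ n, ‖V n‖ ≤ C)
    (h : ∀ x ∈ s, Tendsto (fun n => V n x) atTop (𝓝 (V₀ x))) (x : F) :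
    Tendsto (fun n => V n x) atTop (𝓝 (V₀ x)) := by
  have hspan : ∀ x ∈ Submodule.span ℂ s, Tendsto (fun n => V n x) atTop (𝓝 (V₀ x)) := by
    intro x hx
    induction hx using Submodule.span_induction with
    | mem x hx => exact h x hx
    | zero => simp
    | add x y _ _ hx hy => simpa using hx.add hy
    | smul c x _ hx => simpa using hx.const_smul c
  have hC0 : 0 ≤ C := (norm_nonneg _).trans (hC 0)
  rw [Metric.tendsto_atTop]
  intro ε hε
  have hpos : 0 < C + ‖V₀‖ + 1 := by positivity
  -- The errors of `V n` and `V₀` at `x - y` add up to at most `(C + ‖V₀‖) ‖x - y‖ < ε / 2`; the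
  -- summand 1 keeps the denominator positive.
  obtain ⟨y, hy, hxy⟩ := hs.exists_dist_lt x (ε := ε / 2 / (C + ‖V₀‖ + 1)) (by positivity)
  obtain ⟨N, hN⟩ := Metric.tendsto_atTop.1 (hspan y hy) (ε / 2) (by positivity)
  refine ⟨N, fun n hn => ?_⟩
  have h1 := hN n hn
  rw [dist_eq_norm] at h1 hxy ⊢
  have h2 : V n x - V₀ x = V n (x - y) + (V n y - V₀ y) - V₀ (x - y) := by
    rw [map_sub, map_sub]; abel
  have h3 : ‖V n (x - y)‖ ≤ C * ‖x - y‖ := (V n).le_of_opNorm_le (hC n) _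
  have h4 : ‖V₀ (x - y)‖ ≤ ‖V₀‖ * ‖x - y‖ := V₀.le_opNorm _
  have h5 : (C + ‖V₀‖ + 1) * ‖x - y‖ < ε / 2 := by
    rwa [lt_div_iff₀ hpos, mul_comm] at hxy
  have h6 : ‖V n x - V₀ x‖ ≤ ‖V n (x - y)‖ + ‖V n y - V₀ y‖ + ‖V₀ (x - y)‖ := by
    rw [h2]
    exact (norm_sub_le _ _).trans (add_le_add_left (norm_add_le _ _) _)
  nlinarith [norm_nonneg (x - y)]

/-- Strong convergence of contractions passes to tensor products. -/
theorem tendsto_tmap (V : ℕ → A →L[ℂ] A') (V₀ : A →L[ℂ] A') (W : ℕ → B →L[ℂ] B')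
    (W₀ : B →L[ℂ] B') (hV : ∀ n, ‖V n‖ ≤ 1) (hW : ∀ n, ‖W n‖ ≤ 1)
    (hV0 : ∀ x, Tendsto (fun n => V n x) atTop (𝓝 (V₀ x)))
    (hW0 : ∀ x, Tendsto (fun n => W n x) atTop (𝓝 (W₀ x))) (z : A ⊠ B) :
    Tendsto (fun n => tmap (V n) (W n) z) atTop (𝓝 (tmap V₀ W₀ z)) := by
  refine tendsto_of_dense_span dense_span_tmk (fun n => tmap (V n) (W n)) _
    (fun n => norm_tmap_le_one (hV n) (hW n)) ?_ z
  rintro _ ⟨⟨a, b⟩, rfl⟩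
  have hc : Continuous fun p : A' × B' => tmk p.1 p.2 :=
    (UniformSpace.Completion.continuous_coe _).comp TensorProduct.continuous_tmul
  have h := (hc.tendsto _).comp ((hV0 a).prodMk_nhds (hW0 b))
  rw [tmap_tmk]
  exact h.congr fun n => (tmap_tmk _ _ _ _).symm

/-- In finite dimension the algebraic tensor product is already complete, so its image in the
completion is closed and dense. -/
theorem exists_finite_sum_tmk [FiniteDimensional ℂ A] [FiniteDimensional ℂ B] (x : A ⊠ B) :
    x ∈ Submodule.span ℂ (Set.range fun p : A × B => tmk p.1 p.2) := by
  have hr : IsClosed (Set.range ((↑) : A ⊗[ℂ] B → UniformSpace.Completion (A ⊗[ℂ] B))) :=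
    (Submodule.closed_of_finiteDimensional (LinearMap.range
      (UniformSpace.Completion.toComplL (𝕜 := ℂ) (E := A ⊗[ℂ] B) :
        (A ⊗[ℂ] B) →ₗ[ℂ] UniformSpace.Completion (A ⊗[ℂ] B))))
  have hx : x ∈ Set.range ((↑) : A ⊗[ℂ] B → UniformSpace.Completion (A ⊗[ℂ] B)) := by
    have := UniformSpace.Completion.denseRange_coe (α := A ⊗[ℂ] B) x
    rwa [hr.closure_eq] at this
  obtain ⟨y, rfl⟩ := hx
  induction y using TensorProduct.induction_on with
  | zero => exact Submodule.zero_mem _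
  | tmul a b => exact Submodule.subset_span ⟨(a, b), rfl⟩
  | add x y hx hy =>
    rw [UniformSpace.Completion.coe_add]
    exact Submodule.add_mem _ hx hy

instance finiteDimensional_tensor [FiniteDimensional ℂ A] [FiniteDimensional ℂ B] :
    FiniteDimensional ℂ (A ⊠ B) := by
  have hr : IsClosed (Set.range ((↑) : A ⊗[ℂ] B → UniformSpace.Completion (A ⊗[ℂ] B))) :=
    (Submodule.closed_of_finiteDimensional (LinearMap.range
      (UniformSpace.Completion.toComplL (𝕜 := ℂ) (E := A ⊗[ℂ] B) :
        (A ⊗[ℂ] B) →ₗ[ℂ] UniformSpace.Completion (A ⊗[ℂ] B))))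
  refine Module.Finite.of_surjective (UniformSpace.Completion.toComplL (𝕜 := ℂ) (E := A ⊗[ℂ] B) :
        (A ⊗[ℂ] B) →ₗ[ℂ] UniformSpace.Completion (A ⊗[ℂ] B)) fun x => ?_
  have := UniformSpace.Completion.denseRange_coe (α := A ⊗[ℂ] B) x
  rw [hr.closure_eq] at this
  exact this

theorem FinDim.tensor (hA : FinDim A) (hB : FinDim B) : FinDim (A ⊠ B) := by
  unfold FinDim at *; exact finiteDimensional_tensor

theorem FinDim.sep (hA : FinDim A) : Sep A := by
  unfold FinDim at hA
  unfold Sep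
  have := FiniteDimensional.proper ℂ A
  infer_instance

/-- Orthonormal bases of separable spaces are countable. -/
theorem Sep.countable (hA : Sep A) {ι : Type*} (b : HilbertBasis ι ℂ A) : Countable ι := by
  unfold Sep at hA
  -- Distinct basis vectors have distance `√2`, so the balls of radius `1/2` around them are
  -- disjoint, and a separable space holds only countably many.
  refine Pairwise.countable_of_isOpen_disjoint (s := fun i => Metric.ball (b i) (1 / 2)) ?_
    (fun i => Metric.isOpen_ball) (fun i => ⟨b i, by simp⟩)
  intro i j hij
  refine Metric.ball_disjoint_ball ?_
  have h := b.orthonormal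
  have h1 : dist (b i) (b j) ^ 2 = 2 := by
    rw [dist_eq_norm, @norm_sub_sq ℂ, h.1, h.1, h.2 hij]; norm_num
  nlinarith [dist_nonneg (x := b i) (y := b j)]

end Tensor

/-! ### Homogeneous extension -/

section HomExt

variable {H : Hilb.{u}}

theorem homExt_zero (F : Op H → ℝ≥0∞) : homExt F 0 = 0 := by simp [homExt, etr_zero]

theorem homExt_of_etr_eq_zero (F : Op H → ℝ≥0∞) {T : Op H} (h : etr T = 0) : homExt F T = 0 := by
  simp [homExt, h]

theorem homExt_smul (F : Op H → ℝ≥0∞) {c : ℝ} (hc : 0 ≤ c) (T : Op H) :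
    homExt F (c • T) = ENNReal.ofReal c * homExt F T := by
  rcases hc.eq_or_lt with rfl | hc
  · simp [homExt_zero]
  rw [homExt, homExt, etr_smul hc.le, mul_assoc]
  congr 3
  rw [ENNReal.toReal_mul, ENNReal.toReal_ofReal hc.le, smul_smul]
  congr 1
  field_simp

theorem homExt_state (F : Op H → ℝ≥0∞) {T : Op H} (h : etr T = 1) : homExt F T = F T := by
  simp [homExt, h]

theorem normalize_mem_states {T : Op H} (hT : T.IsPositive) (h0 : etr T ≠ 0) (h1 : etr T ≠ ⊤) :
    ((etr T).toReal)⁻¹ • T ∈ states H := by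
  refine ⟨smul_isPositive hT (by positivity), ?_⟩
  rw [etr_smul (by positivity), ENNReal.ofReal_inv_of_pos (ENNReal.toReal_pos h0 h1),
    ENNReal.ofReal_toReal h1, ENNReal.inv_mul_cancel h0 h1]

theorem smul_normalize {T : Op H} (h0 : etr T ≠ 0) (h1 : etr T ≠ ⊤) :
    (etr T).toReal • ((etr T).toReal)⁻¹ • T = T := by
  rw [smul_smul, mul_inv_cancel₀ (ENNReal.toReal_pos h0 h1).ne', one_smul]

end HomExt

/-! ### Maps of trace class operators -/

section Maps

variable {H K L : Hilb.{u}}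

/-- `T ↦ V T V†` as a map of trace class operators. -/
def adTC (V : H →L[ℂ] K) (hV : ∀ T ∈ TC H, cj V T ∈ TC K) : TC H →ₗ[ℂ] TC K where
  toFun T := ⟨cj V T, hV T T.2⟩
  map_add' _ _ := Subtype.ext (cj_add V _ _)
  map_smul' c _ := Subtype.ext (cj_smul V c _)

theorem adTC_apply (V : H →L[ℂ] K) (hV : ∀ T ∈ TC H, cj V T ∈ TC K) (T : TC H) :
    (adTC V hV T : Op K) = cj V (T : Op H) := rfl

theorem adTC_isCP (V : H →L[ℂ] K) (hV : ∀ T ∈ TC H, cj V T ∈ TC K) : IsCP (adTC V hV) := by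
  intro n T hT x
  simpa only [adTC_apply, inner_cj] using hT fun i => V† (x i)

theorem isCP_comp {G : TC K →ₗ[ℂ] TC L} {F : TC H →ₗ[ℂ] TC K} (hG : IsCP G) (hF : IsCP F) :
    IsCP (G ∘ₗ F) := fun n _ hT => hG n _ (hF n _ hT)

theorem isCP_zero : IsCP (0 : TC H →ₗ[ℂ] TC K) := fun _ _ _ x => by simp

theorem isCP_id : IsCP (LinearMap.id : TC H →ₗ[ℂ] TC H) := fun _ _ hT => hT

theorem IsCP.pos {G : TC H →ₗ[ℂ] TC K} (hG : IsCP G) {T : TC H} (hT : (T : Op H).IsPositive) :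
    (G T : Op K).IsPositive := by
  refine isPositive_of_forall fun x => ?_
  have := hG 1 (fun _ _ => T) (fun y => by simpa using inner_nonneg hT (y 0)) (fun _ => x)
  simpa using this

theorem mem_TC_of_finiteDimensional [FiniteDimensional ℂ H] (T : Op H) : T ∈ TC H :=
  mem_TC.2 (traceNorm_lt_top T)

/-- Conjugations are needed on the trace class only in three cases, for which membership is
elementary: finite-dimensional domain, finite-dimensional codomain, and projections. -/
theorem cj_mem_TC_of_dom [FiniteDimensional ℂ H] (V : H →L[ℂ] K) : ∀ T ∈ TC H, cj V T ∈ TC K :=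
  fun T _ => mem_TC.2 (traceNorm_cj_lt_top V T)

theorem cj_mem_TC_of_cod [FiniteDimensional ℂ K] (V : H →L[ℂ] K) : ∀ T ∈ TC H, cj V T ∈ TC K :=
  fun _ _ => mem_TC_of_finiteDimensional _

theorem traceNorm_comp_isometry_le (U W : Op H) (hU : ∀ x, ‖U x‖ = ‖x‖) (hW : ∀ x, ‖W x‖ = ‖x‖)
    (T : Op H) : traceNorm (U† ∘L (T ∘L W)) ≤ traceNorm T := by
  rw [traceNorm_le_iff]
  intro n e f he hf
  let U' : H →ₗᵢ[ℂ] H := ⟨U, hU⟩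
  let W' : H →ₗᵢ[ℂ] H := ⟨W, hW⟩
  have h1 : Orthonormal ℂ (fun i => U (e i)) := he.comp_linearIsometry U'
  have h2 : Orthonormal ℂ (fun i => W (f i)) := hf.comp_linearIsometry W'
  refine le_trans (le_of_eq ?_) (le_traceNorm T h1 h2)
  refine Finset.sum_congr rfl fun i _ => ?_
  rw [comp_apply, adjoint_inner_right]; rfl

/-- Conjugation by a projection preserves the trace class. -/
theorem cj_mem_TC_of_proj {P : Op H} (hP : P† = P) (hPP : P ∘L P = P) :
    ∀ T ∈ TC H, cj P T ∈ TC H := by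
  intro T hT
  -- `U` is a self-adjoint unitary and `P = (1 + U) / 2`, so `P T P` is the average of the four
  -- operators `X† T Y` with `X, Y ∈ {1, U}`, none of which has larger trace norm than `T`.
  -- Positivity of `T` is not needed.
  set U : Op H := (2 : ℂ) • P - 1 with hU
  have hUs : U† = U := by
    rw [hU, ← star_eq_adjoint, star_sub, star_smul, star_one, star_eq_adjoint, hP]; simp
  have hPPx : ∀ x, P (P x) = P x := fun x => congrArg (fun f => f x) hPP
  have hUU : ∀ x, U (U x) = x := by
    intro x
    simp only [hU, _root_.sub_apply, _root_.smul_apply, one_apply_eq_self, map_sub, map_smul, hPPx]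
    module
  have hUn : ∀ x, ‖U x‖ = ‖x‖ := by
    intro x
    have : ⟪U x, U x⟫_ℂ = ⟪x, x⟫_ℂ := by rw [← adjoint_inner_left, hUs, hUU]
    rw [inner_self_eq_norm_sq_to_K, inner_self_eq_norm_sq_to_K] at this
    have h2 : ‖U x‖ ^ 2 = ‖x‖ ^ 2 := by exact_mod_cast this
    exact (pow_left_inj₀ (norm_nonneg _) (norm_nonneg _) two_ne_zero).1 h2
  have h1n : ∀ x, ‖(1 : Op H) x‖ = ‖x‖ := fun x => rfl
  have hmem : ∀ U W : Op H, (∀ x, ‖U x‖ = ‖x‖) → (∀ x, ‖W x‖ = ‖x‖) → U† ∘L (T ∘L W) ∈ TC H :=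
    fun U W h1 h2 => mem_TC.2 ((traceNorm_comp_isometry_le U W h1 h2 T).trans_lt hT)
  have key : cj P T = (4⁻¹ : ℂ) • (U† ∘L (T ∘L U) + U† ∘L (T ∘L 1) + 1† ∘L (T ∘L U) +
      1† ∘L (T ∘L (1 : Op H))) := by
    have h1 : (1 : Op H)† = 1 := by rw [← star_eq_adjoint, star_one]
    rw [hUs, h1]
    ext x
    simp only [cj, hP, comp_apply, _root_.add_apply, _root_.smul_apply, one_apply_eq_self,
      hU, _root_.sub_apply, map_sub, map_smul]
    module
  rw [key]
  exact Submodule.smul_mem _ _ (Submodule.add_mem _ (Submodule.add_mem _ (Submodule.add_mem _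
    (hmem _ _ hUn hUn) (hmem _ _ hUn h1n)) (hmem _ _ h1n hUn)) (hmem _ _ h1n h1n))

theorem isPosContr_of_channel {Λ : ℕ → TC H →ₗ[ℂ] TC K} (hcp : ∀ k, IsCP (Λ k))
    (hs : SumIsChannel Λ) (k : ℕ) : IsPosContr (Λ k) :=
  ⟨fun _ hT => (hcp k).pos hT, fun T hT => by
    rw [← hs T hT]; exact ENNReal.le_tsum k⟩

end Maps

theorem norm_of_adjoint_comp {H K : Hilb.{u}} {W : H →L[ℂ] K} (hW : W† ∘L W = .id ℂ H) (x : H) :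
    ‖W x‖ = ‖x‖ :=
  (norm_map_iff_adjoint_comp_self W).2 hW x

theorem id_adjoint {H : Hilb.{u}} :
    (ContinuousLinearMap.id ℂ H)† = .id ℂ H := by
  rw [← one_def, ← star_eq_adjoint, star_one]

/-! ### Kraus families -/

/-- A contraction `V` is completed to a resolution of the identity, where `D† D = 1 - V† V`. -/
def krausFam {H K : Hilb.{u}} (V : H →L[ℂ] K) (D : Op H) (p : K) :
    Option (OnbIdx H) → H →L[ℂ] K
  | none => V
  | some i => InnerProductSpace.rankOne ℂ p (D† (onb H i))

/-- By Parseval the rank one members `x ↦ ⟪D† e_i, x⟫ p` contribute exactly `‖D x‖²`, the defect of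
`V`. EM2 speaks of trace preserving families only, and this puts any contraction into one. -/
theorem tsum_krausFam {H K : Hilb.{u}} {V : H →L[ℂ] K} {D : Op H} {p : K} (hp : ‖p‖ = 1)
    (h : ∀ x, ‖V x‖ₑ ^ 2 + ‖D x‖ₑ ^ 2 = ‖x‖ₑ ^ 2) (x : H) :
    ∑' o, ‖krausFam V D p o x‖ₑ ^ 2 = ‖x‖ₑ ^ 2 := by
  have hsplit : ∀ f : Option (OnbIdx H) → ℝ≥0∞, ∑' o, f o = f none + ∑' i, f (some i) := by
    intro f
    rw [← (Equiv.optionEquivSumPUnit.{0} (OnbIdx H)).symm.tsum_eq f,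
      Summable.tsum_sum ENNReal.summable ENNReal.summable, add_comm]
    simp
  rw [hsplit, ← h x, ← parseval (onb H) (D x)]
  congr 1
  refine tsum_congr fun i => ?_
  rw [krausFam, InnerProductSpace.rankOne_apply, adjoint_inner_left]
  simp only [← ofReal_norm_sq, norm_smul, hp, mul_one]

/-- `D` is the positive square root of `1 - V† V`. -/
theorem exists_defect {H K : Hilb.{u}} {V : H →L[ℂ] K} (hV : ‖V‖ ≤ 1) :
    ∃ D : Op H, ∀ x, ‖V x‖ₑ ^ 2 + ‖D x‖ₑ ^ 2 = ‖x‖ₑ ^ 2 := by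
  have hle : ∀ x, ‖V x‖ ≤ ‖x‖ := fun x => (V.le_of_opNorm_le hV x).trans (by simp)
  have hin : ∀ x, ⟪x, (1 - V† ∘L V) x⟫_ℂ = ((‖x‖ ^ 2 - ‖V x‖ ^ 2 : ℝ) : ℂ) := by
    intro x
    rw [_root_.sub_apply, inner_sub_right, one_apply_eq_self, comp_apply, adjoint_inner_right,
      inner_self_eq_norm_sq_to_K, inner_self_eq_norm_sq_to_K]
    norm_cast
  have hpos : (1 - V† ∘L V).IsPositive := isPositive_of_forall fun x => by
    rw [hin]
    have := pow_le_pow_left₀ (norm_nonneg _) (hle x) 2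
    exact_mod_cast sub_nonneg.2 this
  obtain ⟨D, hD, hDD⟩ := exists_sqrt hpos
  refine ⟨D, fun x => ?_⟩
  have h1 := re_inner_of_sqrt hD hDD x
  rw [hin, Complex.ofReal_re] at h1
  rw [← ofReal_norm_sq, ← ofReal_norm_sq, ← ofReal_norm_sq, ← ENNReal.ofReal_add (sq_nonneg _)
    (sq_nonneg _), ← h1]
  congr 1; ring

theorem countable_krausIdx {H : Hilb.{u}} (hH : Sep H) : Countable (Option (OnbIdx H)) := by
  have := hH.countable (onb H)
  infer_instance

/-! ### Operators on finite-dimensional tensor products -/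

theorem tmap_rankOne {A B : Hilb.{u}} (a a' : A) (b b' : B) :
    tmap (InnerProductSpace.rankOne ℂ a a') (InnerProductSpace.rankOne ℂ b b') =
      InnerProductSpace.rankOne ℂ (tmk a b) (tmk a' b') :=
  ext_tmk fun x y => by
    rw [tmap_tmk, InnerProductSpace.rankOne_apply, InnerProductSpace.rankOne_apply,
      InnerProductSpace.rankOne_apply, inner_tmk, tmk_smul_left, tmk_smul_right, smul_smul]

/-- Rank one operators between product vectors are products, and both arguments expand into product
vectors. Linear identities for local maps thus need to be checked on products only. -/
theorem mem_span_tmap {A B : Hilb.{u}} [FiniteDimensional ℂ A] [FiniteDimensional ℂ B]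
    (T : Op (A ⊠ B)) : T ∈ Submodule.span ℂ (Set.range fun p : Op A × Op B => tmap p.1 p.2) := by
  set M := Submodule.span ℂ (Set.range fun p : Op A × Op B => tmap p.1 p.2) with hM
  have h1 : ∀ (a : A) (b : B) (y : A ⊠ B), InnerProductSpace.rankOne ℂ (tmk a b) y ∈ M := by
    intro a b y
    induction exists_finite_sum_tmk y using Submodule.span_induction with
    | mem y hy =>
      obtain ⟨p, rfl⟩ := hy
      exact Submodule.subset_span ⟨(_, _), tmap_rankOne a p.1 b p.2⟩
    | zero => rw [map_zero]; exact M.zero_mem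
    | add y z _ _ hy hz => rw [map_add]; exact M.add_mem hy hz
    | smul c y _ hy => rw [map_smulₛₗ]; exact M.smul_mem _ hy
  have h2 : ∀ x y : A ⊠ B, InnerProductSpace.rankOne ℂ x y ∈ M := by
    intro x y
    induction exists_finite_sum_tmk x using Submodule.span_induction with
    | mem x hx =>
      obtain ⟨p, rfl⟩ := hx
      exact h1 p.1 p.2 y
    | zero => rw [map_zero]; exact M.zero_mem
    | add x z _ _ hx hz => rw [map_add]; exact M.add_mem hx hz
    | smul c x _ hx => rw [map_smul]; exact M.smul_mem _ hx
  rw [eq_sum_rankOne T]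
  exact M.sum_mem fun i _ => M.sum_mem fun j _ => M.smul_mem _ (h2 _ _)

theorem tmap_zero_left {A B A' B' : Hilb.{u}} (S : B →L[ℂ] B') :
    tmap (0 : A →L[ℂ] A') S = 0 := by
  simpa using tmap_smul_left 0 (0 : A →L[ℂ] A') S

theorem tmap_zero_right {A B A' B' : Hilb.{u}} (T : A →L[ℂ] A') :
    tmap T (0 : B →L[ℂ] B') = 0 := by
  simpa using tmap_smul_right 0 T (0 : B →L[ℂ] B')

theorem cj_zero_left {H K : Hilb.{u}} (T : Op H) : cj (0 : H →L[ℂ] K) T = 0 := by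
  ext x; simp [cj]

/-! ### Local operations, on either side -/

/-- EM2 freed of its conventions: an arbitrary countable index set is injected into `ℕ` and the gaps
are filled with zero maps, while homogeneity replaces states by positive operators. `Loc` stands for
locality on either side. -/
theorem sum_countable_le {H K : Hilb.{u}} {F : Op H → ℝ≥0∞} {F' : Op K → ℝ≥0∞}
    {Loc : (TC H →ₗ[ℂ] TC K) → Prop} (hzero : Loc 0)
    (h : ∀ Λ : ℕ → TC H →ₗ[ℂ] TC K, (∀ k, Loc (Λ k)) → SumIsChannel Λ →
      ∀ ω : TC H, (ω : Op H) ∈ states H → ∑' k, homExt F' (Λ k ω : Op K) ≤ F (ω : Op H))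
    {ι : Type*} [Countable ι] (Λ : ι → TC H →ₗ[ℂ] TC K) (hΛ : ∀ k, Loc (Λ k))
    (hs : ∀ T : TC H, (T : Op H).IsPositive → ∑' k, etr (Λ k T : Op K) = etr (T : Op H))
    (T : TC H) (hT : (T : Op H).IsPositive) (htr : etr (T : Op H) ≠ ⊤) :
    ∑' k, homExt F' (Λ k T : Op K) ≤ homExt F (T : Op H) := by
  obtain ⟨g, hg⟩ := exists_injective_nat ι
  by_cases h0 : etr (T : Op H) = 0
  · have : ∀ k, homExt F' (Λ k T : Op K) = 0 := fun k => homExt_of_etr_eq_zero _ (by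
      have := hs T hT
      rw [h0, ENNReal.tsum_eq_zero] at this
      exact this k)
    simp [this]
  have hext : ∀ (S : TC H) (φ : Op K → ℝ≥0∞), φ 0 = 0 →
      ∑' n, φ (Function.extend g Λ 0 n S : Op K) = ∑' k, φ (Λ k S : Op K) := by
    intro S φ hφ
    rw [← tsum_extend_zero hg]
    refine tsum_congr fun n => ?_
    by_cases hn : ∃ k, g k = n
    · obtain ⟨k, rfl⟩ := hn
      rw [hg.extend_apply, hg.extend_apply]
    · rw [Function.extend_apply' _ _ _ hn, Function.extend_apply' _ _ _ hn]
      simpa using hφ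
  set t := (etr (T : Op H)).toReal with ht
  have htpos : 0 < t := ENNReal.toReal_pos h0 htr
  set ω : TC H := ((t⁻¹ : ℝ) : ℂ) • T with hω
  have hωT : (ω : Op H) = t⁻¹ • (T : Op H) := Complex.coe_smul _ _
  have hmain := h (Function.extend g Λ 0) (fun n => by
      by_cases hn : ∃ k, g k = n
      · obtain ⟨k, rfl⟩ := hn
        rw [hg.extend_apply]; exact hΛ k
      · rw [Function.extend_apply' _ _ _ hn]; exact hzero)
    (fun S hS => by rw [hext S etr etr_zero, hs S hS]) ω
    (by rw [hωT]; exact normalize_mem_states hT h0 htr)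
  rw [hext ω (homExt F') (homExt_zero _)] at hmain
  have h2 : ∀ k, homExt F' (Λ k ω : Op K) = ENNReal.ofReal t⁻¹ * homExt F' (Λ k T : Op K) := by
    intro k
    rw [← homExt_smul _ (by positivity), hω, map_smul]
    exact congrArg (homExt F') (Complex.coe_smul _ _)
  simp only [h2, ENNReal.tsum_mul_left] at hmain
  rw [homExt, ← hωT]
  have h3 : etr (T : Op H) = ENNReal.ofReal t := (ENNReal.ofReal_toReal htr).symm
  calc ∑' k, homExt F' (Λ k T : Op K)
      = etr (T : Op H) * (ENNReal.ofReal t⁻¹ * ∑' k, homExt F' (Λ k T : Op K)) := by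
        rw [← mul_assoc, h3, ← ENNReal.ofReal_mul htpos.le, mul_inv_cancel₀ htpos.ne',
          ENNReal.ofReal_one, one_mul]
    _ ≤ etr (T : Op H) * F (ω : Op H) := by gcongr

theorem isLocalA_zero {A A' B : Hilb.{u}} :
    IsLocalA (0 : TC (A ⊠ B) →ₗ[ℂ] TC (A' ⊠ B)) :=
  ⟨isCP_zero, 0, isCP_zero, fun ρ σ τ _ => by
    change (0 : Op (A' ⊠ B)) = tmap (0 : Op A') _
    rw [tmap_zero_left]⟩

theorem isLocalB_zero {A B B' : Hilb.{u}} :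
    IsLocalB (0 : TC (A ⊠ B) →ₗ[ℂ] TC (A ⊠ B')) :=
  ⟨isCP_zero, 0, isCP_zero, fun ρ σ τ _ => by
    change (0 : Op (A ⊠ B')) = tmap _ (0 : Op B')
    rw [tmap_zero_right]⟩

theorem tmap_splitA {A' B K' L : Hilb.{u}} (V : A' →L[ℂ] K') (W : B →L[ℂ] L) :
    tmap V W = tmap V (.id ℂ L) ∘L tmap (.id ℂ A') W := by
  rw [tmap_comp]; rfl

/-! ### Cutting local operations on `A` down to finite-dimensional systems -/

section LocalA

variable {A A' B K K' L : Hilb.{u}} [FiniteDimensional ℂ K] [FiniteDimensional ℂ K']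
  [FiniteDimensional ℂ L]

/-- A local map is pre- and postcomposed with compressions to finite-dimensional systems. -/
def finLocalA (J : K →L[ℂ] A) (M : L →L[ℂ] B) (V : A' →L[ℂ] K')
    (Λ : TC (A ⊠ B) →ₗ[ℂ] TC (A' ⊠ B)) : TC (K ⊠ L) →ₗ[ℂ] TC (K' ⊠ L) :=
  adTC (tmap V M†) (cj_mem_TC_of_cod _) ∘ₗ Λ ∘ₗ adTC (tmap J M) (cj_mem_TC_of_dom _)

theorem finLocalA_isLocalA (J : K →L[ℂ] A) (M : L →L[ℂ] B) (hM : M† ∘L M = .id ℂ L)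
    (V : A' →L[ℂ] K') {Λ : TC (A ⊠ B) →ₗ[ℂ] TC (A' ⊠ B)} (hΛ : IsLocalA Λ) :
    IsLocalA (finLocalA J M V Λ) := by
  obtain ⟨hcp, Φ, hΦ, hloc⟩ := hΛ
  refine ⟨isCP_comp (adTC_isCP _ _) (isCP_comp hcp (adTC_isCP _ _)),
    adTC V (cj_mem_TC_of_cod _) ∘ₗ Φ ∘ₗ adTC J (cj_mem_TC_of_dom _),
    isCP_comp (adTC_isCP _ _) (isCP_comp hΦ (adTC_isCP _ _)), fun ρ σ τ hτ => ?_⟩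
  simp only [finLocalA, LinearMap.comp_apply, adTC_apply]
  rw [hloc (adTC J (cj_mem_TC_of_dom _) ρ) (adTC M (cj_mem_TC_of_dom _) σ), cj_tmap]
  · congr 1
    rw [adTC_apply, cj_cj, hM, cj_id]
  · rw [adTC_apply, hτ, cj_tmap]; rfl

/-- A local map preserves the support in the other system. -/
theorem local_supportA (J : K →L[ℂ] A) (M : L →L[ℂ] B) (hM : M† ∘L M = .id ℂ L)
    {Λ : TC (A ⊠ B) →ₗ[ℂ] TC (A' ⊠ B)} (hΛ : IsLocalA Λ) (T : TC (K ⊠ L)) :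
    cj (tmap (.id ℂ A') M) (cj (tmap (.id ℂ A') M†)
      (Λ (adTC (tmap J M) (cj_mem_TC_of_dom _) T) : Op (A' ⊠ B))) =
      (Λ (adTC (tmap J M) (cj_mem_TC_of_dom _) T) : Op (A' ⊠ B)) := by
  obtain ⟨hcp, Φ, hΦ, hloc⟩ := hΛ
  obtain ⟨T, hT⟩ := T
  -- Locality is a condition on product operators only, and in finite dimension they span. On a
  -- product the second factor is carried by the range of `M`, and `Φ ⊗ id` leaves it there.
  induction mem_span_tmap T using Submodule.span_induction with
  | mem x hx =>
    obtain ⟨p, rfl⟩ := hx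
    rw [hloc (adTC J (cj_mem_TC_of_dom _) ⟨p.1, mem_TC_of_finiteDimensional _⟩)
      (adTC M (cj_mem_TC_of_dom _) ⟨p.2, mem_TC_of_finiteDimensional _⟩) _
      (by rw [adTC_apply, cj_tmap]; rfl)]
    rw [cj_tmap, cj_tmap]
    rw [cj_id, cj_id, adTC_apply, cj_cj, cj_cj, comp_assoc, hM]
    rfl
  | zero =>
    have : (⟨0, hT⟩ : TC (K ⊠ L)) = 0 := rfl
    rw [this, map_zero, map_zero, Submodule.coe_zero, cj_zero, cj_zero]
  | add x y _ _ hx hy =>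
    have : (⟨x + y, hT⟩ : TC (K ⊠ L)) = ⟨x, mem_TC_of_finiteDimensional _⟩ +
      ⟨y, mem_TC_of_finiteDimensional _⟩ := rfl
    rw [this, map_add, map_add, Submodule.coe_add, cj_add, cj_add, hx, hy]
  | smul c x _ hx =>
    have : (⟨c • x, hT⟩ : TC (K ⊠ L)) = c • ⟨x, mem_TC_of_finiteDimensional _⟩ := rfl
    rw [this, map_smul, map_smul, Submodule.coe_smul, cj_smul, cj_smul, hx]

/-- Monotonicity under compressed local channels. -/
theorem tsum_homExt_finLocalA_le {F : Op (K ⊠ L) → ℝ≥0∞} {F' : Op (K' ⊠ L) → ℝ≥0∞}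
    (hF : EM2A F F') (hA' : Sep A') (J : K →L[ℂ] A) (hJ : J† ∘L J = .id ℂ K)
    (M : L →L[ℂ] B) (hM : M† ∘L M = .id ℂ L) {V : A' →L[ℂ] K'} (hV : ‖V‖ ≤ 1)
    {Λ : ℕ → TC (A ⊠ B) →ₗ[ℂ] TC (A' ⊠ B)} (hΛ : ∀ k, IsLocalA (Λ k)) (hs : SumIsChannel Λ)
    (T : TC (K ⊠ L)) (hT : (T : Op (K ⊠ L)).IsPositive) :
    ∑' k, homExt F' (finLocalA J M V (Λ k) T : Op (K' ⊠ L)) ≤ homExt F (T : Op (K ⊠ L)) := by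
  -- The Kraus family needs a unit vector `p` in the target. Without one the target is zero, `V =
  -- 0`, and every term vanishes.
  by_cases hK : ∃ p : K', ‖p‖ = 1
  swap
  · have hV0 : V = 0 := by
      ext x
      by_contra h
      exact hK ⟨((‖V x‖⁻¹ : ℝ) : ℂ) • V x, by
        have : V x ≠ 0 := by simpa using h
        simp [norm_smul, this]⟩
    have : ∀ k, homExt F' (finLocalA J M V (Λ k) T : Op (K' ⊠ L)) = 0 := by
      intro k
      simp only [finLocalA, LinearMap.comp_apply, adTC_apply, hV0, tmap_zero_left, cj_zero_left,
        homExt_zero]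
    simp [this]
  obtain ⟨p, hp⟩ := hK
  obtain ⟨D, hD⟩ := exists_defect hV
  have := countable_krausIdx hA'
  have hmain := sum_countable_le (F := F) (F' := F') isLocalA_zero hF
    (fun q : ℕ × Option (OnbIdx A') => finLocalA J M (krausFam V D p q.2) (Λ q.1))
    (fun q => finLocalA_isLocalA J M hM _ (hΛ q.1)) (fun S hS => by
      rw [ENNReal.tsum_prod']
      have hpos : (adTC (tmap J M) (cj_mem_TC_of_dom _) S : Op (A ⊠ B)).IsPositive :=
        cj_isPositive _ hS
      have h1 : ∀ k, ∑' o, etr (finLocalA J M (krausFam V D p o) (Λ k) S : Op (K' ⊠ L)) =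
          etr (Λ k (adTC (tmap J M) (cj_mem_TC_of_dom _) S) : Op (A' ⊠ B)) := by
        intro k
        have hpos2 := (hΛ k).1.pos hpos
        refine (tsum_congr fun o => congrArg etr (?_ : _ = cj (tmap (krausFam V D p o) (.id ℂ L))
          (cj (tmap (.id ℂ A') M†)
            (Λ k (adTC (tmap J M) (cj_mem_TC_of_dom _) S) : Op (A' ⊠ B))))).trans ?_
        · rw [cj_cj, ← tmap_splitA]; rfl
        rw [tsum_etr_cj (cj_isPositive _ hpos2) (fun o => tmap (krausFam V D p o) (.id ℂ L))
          (tsum_enorm_tmap_left _ (tsum_krausFam hp hD))]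
        -- Compression by `M†` on the passive side costs no trace: the output is supported there.
        -- The loss on the active side has just been recovered by summing over the Kraus index.
        conv_rhs => rw [← local_supportA J M hM (hΛ k) S]
        rw [etr_cj_isometry (cj_isPositive _ hpos2)]
        exact norm_of_adjoint_comp (norm_tmap_isometry (by rw [id_adjoint]; rfl) hM)
      simp only [h1]
      rw [hs _ hpos, adTC_apply, etr_cj_isometry hS (norm_of_adjoint_comp (norm_tmap_isometry hJ hM))])
    T hT (etr_ne_top _)
  rw [ENNReal.tsum_prod'] at hmain
  -- Of the enlarged channel only the Kraus operator `V` itself, with index `none`, is kept.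
  refine le_trans (ENNReal.tsum_le_tsum fun k => ?_) hmain
  exact ENNReal.le_tsum (f := fun o => homExt F'
    (finLocalA J M (krausFam V D p o) (Λ k) T : Op (K' ⊠ L))) none

/-- The case of the identity channel, padded with zero maps to a sequence. -/
theorem homExt_cj_leA {F : Op (K ⊠ L) → ℝ≥0∞} {F' : Op (K' ⊠ L) → ℝ≥0∞}
    (hF : EM2A F F') {V : K →L[ℂ] K'} (hV : ‖V‖ ≤ 1) {T : Op (K ⊠ L)} (hT : T.IsPositive) :
    homExt F' (cj (tmap V (.id ℂ L)) T) ≤ homExt F T := by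
  have h := tsum_homExt_finLocalA_le hF (FinDim.sep (A := K) ‹_›) (.id ℂ K) (by rw [id_adjoint]; rfl)
    (.id ℂ L) (by rw [id_adjoint]; rfl) hV
    (Λ := fun k => if k = 0 then LinearMap.id else 0) (fun k => by
      split_ifs
      · exact ⟨isCP_id, LinearMap.id, isCP_id, fun ρ σ τ h => h⟩
      · exact isLocalA_zero)
    (fun S _ => by
      rw [tsum_eq_single 0]
      · simp
      · intro k hk; simp [hk, etr_zero])
    ⟨T, mem_TC_of_finiteDimensional _⟩ hT
  refine le_trans (le_of_eq ?_) ((ENNReal.le_tsum 0).trans h)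
  rw [if_pos rfl]
  refine congrArg (homExt F') (?_ : _ = cj (tmap V (.id ℂ L)†) (cj (tmap (.id ℂ K) (.id ℂ L)) T))
  rw [id_adjoint, tmap_id, cj_id]

end LocalA

theorem tmap_splitB {A' B K' L : Hilb.{u}} (V : A' →L[ℂ] K') (W : B →L[ℂ] L) :
    tmap W V = tmap (.id ℂ L) V ∘L tmap W (.id ℂ A') := by
  rw [tmap_comp]; rfl

/-! ### The mirror image: operations on the second factor, with `B` and `L` now passive on the left
-/

section LocalB

variable {A A' B K K' L : Hilb.{u}} [FiniteDimensional ℂ K] [FiniteDimensional ℂ K']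
  [FiniteDimensional ℂ L]

/-- A local map is pre- and postcomposed with compressions to finite-dimensional systems. -/
def finLocalB (J : K →L[ℂ] A) (M : L →L[ℂ] B) (V : A' →L[ℂ] K')
    (Λ : TC (B ⊠ A) →ₗ[ℂ] TC (B ⊠ A')) : TC (L ⊠ K) →ₗ[ℂ] TC (L ⊠ K') :=
  adTC (tmap M† V) (cj_mem_TC_of_cod _) ∘ₗ Λ ∘ₗ adTC (tmap M J) (cj_mem_TC_of_dom _)

theorem finLocalB_isLocalB (J : K →L[ℂ] A) (M : L →L[ℂ] B) (hM : M† ∘L M = .id ℂ L)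
    (V : A' →L[ℂ] K') {Λ : TC (B ⊠ A) →ₗ[ℂ] TC (B ⊠ A')} (hΛ : IsLocalB Λ) :
    IsLocalB (finLocalB J M V Λ) := by
  obtain ⟨hcp, Φ, hΦ, hloc⟩ := hΛ
  refine ⟨isCP_comp (adTC_isCP _ _) (isCP_comp hcp (adTC_isCP _ _)),
    adTC V (cj_mem_TC_of_cod _) ∘ₗ Φ ∘ₗ adTC J (cj_mem_TC_of_dom _),
    isCP_comp (adTC_isCP _ _) (isCP_comp hΦ (adTC_isCP _ _)), fun ρ σ τ hτ => ?_⟩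
  simp only [finLocalB, LinearMap.comp_apply, adTC_apply]
  rw [hloc (adTC M (cj_mem_TC_of_dom _) ρ) (adTC J (cj_mem_TC_of_dom _) σ), cj_tmap]
  · congr 1
    rw [adTC_apply, cj_cj, hM, cj_id]
  · rw [adTC_apply, hτ, cj_tmap]; rfl

/-- A local map preserves the support in the other system. -/
theorem local_supportB (J : K →L[ℂ] A) (M : L →L[ℂ] B) (hM : M† ∘L M = .id ℂ L)
    {Λ : TC (B ⊠ A) →ₗ[ℂ] TC (B ⊠ A')} (hΛ : IsLocalB Λ) (T : TC (L ⊠ K)) :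
    cj (tmap M (.id ℂ A')) (cj (tmap M† (.id ℂ A'))
      (Λ (adTC (tmap M J) (cj_mem_TC_of_dom _) T) : Op (B ⊠ A'))) =
      (Λ (adTC (tmap M J) (cj_mem_TC_of_dom _) T) : Op (B ⊠ A')) := by
  obtain ⟨hcp, Φ, hΦ, hloc⟩ := hΛ
  obtain ⟨T, hT⟩ := T
  induction mem_span_tmap T using Submodule.span_induction with
  | mem x hx =>
    obtain ⟨p, rfl⟩ := hx
    rw [hloc (adTC M (cj_mem_TC_of_dom _) ⟨p.1, mem_TC_of_finiteDimensional _⟩)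
      (adTC J (cj_mem_TC_of_dom _) ⟨p.2, mem_TC_of_finiteDimensional _⟩) _
      (by rw [adTC_apply, cj_tmap]; rfl)]
    rw [cj_tmap, cj_tmap]
    rw [cj_id, cj_id, adTC_apply, cj_cj, cj_cj, comp_assoc, hM]
    rfl
  | zero =>
    have : (⟨0, hT⟩ : TC (L ⊠ K)) = 0 := rfl
    rw [this, map_zero, map_zero, Submodule.coe_zero, cj_zero, cj_zero]
  | add x y _ _ hx hy =>
    have : (⟨x + y, hT⟩ : TC (L ⊠ K)) = ⟨x, mem_TC_of_finiteDimensional _⟩ +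
      ⟨y, mem_TC_of_finiteDimensional _⟩ := rfl
    rw [this, map_add, map_add, Submodule.coe_add, cj_add, cj_add, hx, hy]
  | smul c x _ hx =>
    have : (⟨c • x, hT⟩ : TC (L ⊠ K)) = c • ⟨x, mem_TC_of_finiteDimensional _⟩ := rfl
    rw [this, map_smul, map_smul, Submodule.coe_smul, cj_smul, cj_smul, hx]

/-- Monotonicity under compressed local channels. -/
theorem tsum_homExt_finLocalB_le {F : Op (L ⊠ K) → ℝ≥0∞} {F' : Op (L ⊠ K') → ℝ≥0∞}
    (hF : EM2B F F') (hA' : Sep A') (J : K →L[ℂ] A) (hJ : J† ∘L J = .id ℂ K)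
    (M : L →L[ℂ] B) (hM : M† ∘L M = .id ℂ L) {V : A' →L[ℂ] K'} (hV : ‖V‖ ≤ 1)
    {Λ : ℕ → TC (B ⊠ A) →ₗ[ℂ] TC (B ⊠ A')} (hΛ : ∀ k, IsLocalB (Λ k)) (hs : SumIsChannel Λ)
    (T : TC (L ⊠ K)) (hT : (T : Op (L ⊠ K)).IsPositive) :
    ∑' k, homExt F' (finLocalB J M V (Λ k) T : Op (L ⊠ K')) ≤ homExt F (T : Op (L ⊠ K)) := by
  by_cases hK : ∃ p : K', ‖p‖ = 1
  swap
  · have hV0 : V = 0 := by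
      ext x
      by_contra h
      exact hK ⟨((‖V x‖⁻¹ : ℝ) : ℂ) • V x, by
        have : V x ≠ 0 := by simpa using h
        simp [norm_smul, this]⟩
    have : ∀ k, homExt F' (finLocalB J M V (Λ k) T : Op (L ⊠ K')) = 0 := by
      intro k
      simp only [finLocalB, LinearMap.comp_apply, adTC_apply, hV0, tmap_zero_right, cj_zero_left,
        homExt_zero]
    simp [this]
  obtain ⟨p, hp⟩ := hK
  obtain ⟨D, hD⟩ := exists_defect hV
  have := countable_krausIdx hA'
  have hmain := sum_countable_le (F := F) (F' := F') isLocalB_zero hF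
    (fun q : ℕ × Option (OnbIdx A') => finLocalB J M (krausFam V D p q.2) (Λ q.1))
    (fun q => finLocalB_isLocalB J M hM _ (hΛ q.1)) (fun S hS => by
      rw [ENNReal.tsum_prod']
      have hpos : (adTC (tmap M J) (cj_mem_TC_of_dom _) S : Op (B ⊠ A)).IsPositive :=
        cj_isPositive _ hS
      have h1 : ∀ k, ∑' o, etr (finLocalB J M (krausFam V D p o) (Λ k) S : Op (L ⊠ K')) =
          etr (Λ k (adTC (tmap M J) (cj_mem_TC_of_dom _) S) : Op (B ⊠ A')) := by
        intro k
        have hpos2 := (hΛ k).1.pos hpos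
        refine (tsum_congr fun o => congrArg etr (?_ : _ = cj (tmap (.id ℂ L) (krausFam V D p o))
          (cj (tmap M† (.id ℂ A'))
            (Λ k (adTC (tmap M J) (cj_mem_TC_of_dom _) S) : Op (B ⊠ A'))))).trans ?_
        · rw [cj_cj, ← tmap_splitB]; rfl
        rw [tsum_etr_cj (cj_isPositive _ hpos2) (fun o => tmap (.id ℂ L) (krausFam V D p o))
          (tsum_enorm_tmap_right _ (tsum_krausFam hp hD))]
        conv_rhs => rw [← local_supportB J M hM (hΛ k) S]
        rw [etr_cj_isometry (cj_isPositive _ hpos2)]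
        exact norm_of_adjoint_comp (norm_tmap_isometry hM (by rw [id_adjoint]; rfl))
      simp only [h1]
      rw [hs _ hpos, adTC_apply, etr_cj_isometry hS (norm_of_adjoint_comp (norm_tmap_isometry hM hJ))])
    T hT (etr_ne_top _)
  rw [ENNReal.tsum_prod'] at hmain
  refine le_trans (ENNReal.tsum_le_tsum fun k => ?_) hmain
  exact ENNReal.le_tsum (f := fun o => homExt F'
    (finLocalB J M (krausFam V D p o) (Λ k) T : Op (L ⊠ K'))) none

theorem homExt_cj_leB {F : Op (L ⊠ K) → ℝ≥0∞} {F' : Op (L ⊠ K') → ℝ≥0∞}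
    (hF : EM2B F F') {V : K →L[ℂ] K'} (hV : ‖V‖ ≤ 1) {T : Op (L ⊠ K)} (hT : T.IsPositive) :
    homExt F' (cj (tmap (.id ℂ L) V) T) ≤ homExt F T := by
  have h := tsum_homExt_finLocalB_le hF (FinDim.sep (A := K) ‹_›) (.id ℂ K) (by rw [id_adjoint]; rfl)
    (.id ℂ L) (by rw [id_adjoint]; rfl) hV
    (Λ := fun k => if k = 0 then LinearMap.id else 0) (fun k => by
      split_ifs
      · exact ⟨isCP_id, LinearMap.id, isCP_id, fun ρ σ τ h => h⟩
      · exact isLocalB_zero)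
    (fun S _ => by
      rw [tsum_eq_single 0]
      · simp
      · intro k hk; simp [hk, etr_zero])
    ⟨T, mem_TC_of_finiteDimensional _⟩ hT
  refine le_trans (le_of_eq ?_) ((ENNReal.le_tsum 0).trans h)
  rw [if_pos rfl]
  refine congrArg (homExt F') (?_ : _ = cj (tmap (.id ℂ L)† V) (cj (tmap (.id ℂ L) (.id ℂ K)) T))
  rw [id_adjoint, tmap_id, cj_id]

end LocalB

/-! ### Projections -/

section Proj

variable {H : Hilb.{u}}

theorem norm_le_one_of_proj {P : Op H} (hP : P† = P) (hPP : P ∘L P = P) : ‖P‖ ≤ 1 := by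
  refine opNorm_le_bound _ zero_le_one fun x => ?_
  rw [one_mul]
  have h1 : ⟪P x, P x⟫_ℂ = ⟪x, P x⟫_ℂ := by
    rw [← adjoint_inner_right, hP]
    exact congrArg _ (congrArg (fun f => f x) hPP)
  have h2 : ‖P x‖ ^ 2 ≤ ‖x‖ * ‖P x‖ := by
    have := norm_inner_le_norm (𝕜 := ℂ) x (P x)
    rw [← h1, inner_self_eq_norm_sq_to_K] at this
    simpa using this
  rcases (norm_nonneg (P x)).eq_or_lt with h | h
  · rw [← h]; positivity
  · nlinarith

theorem one_sub_adjoint {P : Op H} (hP : P† = P) : (1 - P)† = 1 - P := by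
  rw [map_sub, hP, ← star_eq_adjoint, star_one]

theorem one_sub_comp {P : Op H} (hPP : P ∘L P = P) : (1 - P) ∘L (1 - P) = 1 - P := by
  ext x
  have := congrArg (fun f => f x) hPP
  simp only [comp_apply] at this
  simp [this]

theorem norm_le_one_of_isometry {K : Hilb.{u}} {V : H →L[ℂ] K} (hV : V† ∘L V = .id ℂ H) : ‖V‖ ≤ 1 :=
  opNorm_le_bound _ zero_le_one fun x => by rw [norm_of_adjoint_comp hV, one_mul]

theorem norm_adjoint_le_one {K : Hilb.{u}} {V : H →L[ℂ] K} (hV : ‖V‖ ≤ 1) : ‖V†‖ ≤ 1 := by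
  rwa [LinearIsometryEquiv.norm_map]

/-- The inclusion of the range of a projector. -/
def FinProj.incl (P : FinProj H) : P.space →L[ℂ] H := P.1.subtypeL

instance (P : FinProj H) : FiniteDimensional ℂ P.space := P.2

instance (P : FinProj H) {K : Hilb.{u}} (Q : FinProj K) : FiniteDimensional ℂ (P.space ⊠ Q.space) :=
  finiteDimensional_tensor (A := P.space) (B := Q.space)

theorem FinProj.finDim (P : FinProj H) : FinDim P.space := P.2

theorem FinProj.incl_isometry (P : FinProj H) : P.incl† ∘L P.incl = .id ℂ P.space :=
  (norm_map_iff_adjoint_comp_self P.incl).1 fun _ => rfl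

theorem FinProj.incl_comp_adjoint (P : FinProj H) : P.incl ∘L P.incl† = P.op := by
  ext x
  refine ext_inner_left ℂ fun y => ?_
  have : P.incl† = P.1.orthogonalProjectionOnto := by
    rw [FinProj.incl]
    exact Submodule.adjoint_subtypeL P.1
  rw [this]
  rfl

theorem FinProj.op_adjoint (P : FinProj H) : P.op† = P.op := by
  rw [← P.incl_comp_adjoint, adjoint_comp, adjoint_adjoint]

theorem FinProj.op_comp (P : FinProj H) : P.op ∘L P.op = P.op := by
  rw [← P.incl_comp_adjoint]
  ext x
  have := congrArg (fun f => f (P.incl† x)) P.incl_isometry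
  simp only [comp_apply, id_apply] at this ⊢
  rw [this]

theorem FinProj.op_apply_of_mem (P : FinProj H) {x : H} (hx : x ∈ P.1) : P.op x = x :=
  Submodule.starProjection_eq_self_iff.2 hx

theorem FinProj.norm_incl (P : FinProj H) : ‖P.incl‖ ≤ 1 := norm_le_one_of_isometry P.incl_isometry

theorem FinProj.norm_op (P : FinProj H) : ‖P.op‖ ≤ 1 := norm_le_one_of_proj P.op_adjoint P.op_comp

/-- Projectors onto the spans of finite subsets of a Hilbert basis. -/
def spanProj {ι : Type*} (b : HilbertBasis ι ℂ H) (s : Finset ι) : FinProj H :=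
  ⟨Submodule.span ℂ (b '' s), FiniteDimensional.span_of_finite ℂ (s.finite_toSet.image b)⟩

theorem tendsto_spanProj {ι : Type*} (b : HilbertBasis ι ℂ H) (x : H) :
    Tendsto (fun s => (spanProj b s).op x) atTop (𝓝 x) := by
  refine Submodule.starProjection_tendsto_self (fun s => (spanProj b s).1) ?_ x ?_
  · intro s t hst
    exact Submodule.span_mono (Set.image_mono hst)
  · rw [← b.dense_span]
    refine Submodule.topologicalClosure_mono (Submodule.span_le.2 ?_)
    rintro _ ⟨i, rfl⟩
    exact Submodule.mem_iSup_of_mem {i} (Submodule.subset_span ⟨i, by simp, rfl⟩)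

theorem exists_seq_finset (hH : Sep H) {ι : Type*} (b : HilbertBasis ι ℂ H) :
    ∃ s : ℕ → Finset ι, Tendsto s atTop atTop := by
  have := hH.countable b
  exact exists_seq_tendsto _

theorem exists_tendstoId (hH : Sep H) : ∃ P : ℕ → FinProj H, TendstoId P := by
  obtain ⟨s, hs⟩ := exists_seq_finset hH (onb H)
  exact ⟨fun n => spanProj (onb H) (s n), fun x => (tendsto_spanProj (onb H) x).comp hs⟩

end Proj

/-! ### Semicontinuity and convexity of the homogeneous extension -/

section HomExtFin

theorem TendstoWeak.real_smul {H : Hilb.{u}} {T : ℕ → Op H} {T₀ : Op H} (h : TendstoWeak T T₀)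
    {c : ℕ → ℝ} {c₀ : ℝ} (hc : Tendsto c atTop (𝓝 c₀)) :
    TendstoWeak (fun n => c n • T n) (c₀ • T₀) := by
  intro x y
  have : ∀ (c : ℝ) (T : Op H), ⟪x, (c • T) y⟫_ℂ = (c : ℂ) * ⟪x, T y⟫_ℂ := fun c T => by
    rw [_root_.smul_apply, inner_smul_right_eq_smul, Complex.real_smul]
  simp only [this]
  exact ((Complex.continuous_ofReal.tendsto _).comp hc).mul (h x y)

/-- Away from zero trace the normalized operators converge, in finite dimension even in trace norm,
and continuity of `F` on states applies. -/
theorem tendsto_homExt {K : Hilb.{u}} [FiniteDimensional ℂ K] {F : Op K → ℝ≥0∞}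
    (hF : ContOnStates F) {T : ℕ → Op K} {T₀ : Op K} (hT : ∀ n, (T n).IsPositive)
    (hT₀ : T₀.IsPositive) (h : TendstoWeak T T₀) (h0 : etr T₀ ≠ 0) :
    Tendsto (fun n => homExt F (T n)) atTop (𝓝 (homExt F T₀)) := by
  have htr := h.tr.tendsto_etr (etr_ne_top T₀)
  have htr' : Tendsto (fun n => ((etr (T n)).toReal)⁻¹) atTop (𝓝 ((etr T₀).toReal)⁻¹) :=
    ((ENNReal.tendsto_toReal (etr_ne_top T₀)).comp htr).inv₀
      (ENNReal.toReal_pos h0 (etr_ne_top T₀)).ne'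
  have hpos : ∀ᶠ n in atTop, etr (T n) ≠ 0 := htr.eventually_ne h0
  -- Continuity is a statement about sequences of states, so finitely many terms of possibly zero
  -- trace are cut off by a shift.
  obtain ⟨N, hN⟩ := eventually_atTop.1 hpos
  have hs : Tendsto (fun n => F (((etr (T (n + N))).toReal)⁻¹ • T (n + N))) atTop
      (𝓝 (F (((etr T₀).toReal)⁻¹ • T₀))) := by
    refine hF _ _ (fun n => normalize_mem_states (hT _) (hN _ (by omega)) (etr_ne_top _))
      (normalize_mem_states hT₀ h0 (etr_ne_top _)) ?_
    refine TendstoWeak.tr ?_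
    have := h.real_smul htr'
    intro x y
    exact (tendsto_add_atTop_iff_nat N).2 (this x y)
  have hs' := (tendsto_add_atTop_iff_nat
    (f := fun n => F (((etr (T n)).toReal)⁻¹ • T n)) N).1 hs
  exact ENNReal.Tendsto.mul htr (Or.inl h0) hs' (Or.inr (etr_ne_top _))

/-- At a limit of zero trace the value is 0, the least possible, so semicontinuity needs no control
of the normalized operators. -/
theorem homExt_le_liminf {K : Hilb.{u}} [FiniteDimensional ℂ K] {F : Op K → ℝ≥0∞}
    (hF : ContOnStates F) {T : ℕ → Op K} {T₀ : Op K} (hT : ∀ n, (T n).IsPositive)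
    (hT₀ : T₀.IsPositive) (h : TendstoWeak T T₀) :
    homExt F T₀ ≤ liminf (fun n => homExt F (T n)) atTop := by
  by_cases h0 : etr T₀ = 0
  · rw [homExt_of_etr_eq_zero F h0]; exact zero_le
  · exact (tendsto_homExt hF hT hT₀ h h0).liminf_eq.ge

/-- Convexity and homogeneity give subadditivity, through the weights `a / (a + b)` and `b / (a +
b)` of the normalized summands. -/
theorem homExt_add_le {A B : Hilb.{u}} {F : Op (A ⊠ B) → ℝ≥0∞} (hF : EM3 F)
    {T S : Op (A ⊠ B)} (hT : T.IsPositive) (hS : S.IsPositive) (hTt : etr T ≠ ⊤)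
    (hSt : etr S ≠ ⊤) : homExt F (T + S) ≤ homExt F T + homExt F S := by
  by_cases hT0 : etr T = 0
  · rw [eq_zero_of_etr_eq_zero hT hT0, homExt_zero, zero_add, zero_add]
  by_cases hS0 : etr S = 0
  · rw [eq_zero_of_etr_eq_zero hS hS0, homExt_zero, add_zero, add_zero]
  set a := (etr T).toReal with ha
  set b := (etr S).toReal with hb
  have hapos : 0 < a := ENNReal.toReal_pos hT0 hTt
  have hbpos : 0 < b := ENNReal.toReal_pos hS0 hSt
  have h := hF _ (normalize_mem_states hT hT0 hTt) _ (normalize_mem_states hS hS0 hSt)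
    (a / (a + b)) (by positivity) ((div_le_one (by positivity)).2 (by linarith))
  have hsum : etr (T + S) = ENNReal.ofReal (a + b) := by
    rw [etr_add hT hS, ENNReal.ofReal_add hapos.le hbpos.le, ENNReal.ofReal_toReal hTt,
      ENNReal.ofReal_toReal hSt]
  have h1 : (1 - a / (a + b)) = b / (a + b) := by field_simp; ring
  rw [h1, smul_smul, smul_smul] at h
  have h2 : a / (a + b) * a⁻¹ = (a + b)⁻¹ := by field_simp
  have h3 : b / (a + b) * b⁻¹ = (a + b)⁻¹ := by field_simp
  rw [← ha, ← hb, h2, h3, ← smul_add] at h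
  rw [homExt, hsum, ENNReal.toReal_ofReal (by positivity)]
  refine (mul_le_mul_right h _).trans (le_of_eq ?_)
  rw [mul_add, ← mul_assoc, ← mul_assoc, ← ENNReal.ofReal_mul (by positivity),
    ← ENNReal.ofReal_mul (by positivity), mul_div_cancel₀ _ (by positivity : a + b ≠ 0),
    mul_div_cancel₀ _ (by positivity : a + b ≠ 0), homExt, homExt, ← ha, ← hb,
    ← ENNReal.ofReal_toReal hTt, ← ENNReal.ofReal_toReal hSt, ← ha, ← hb]

end HomExtFin

/-! ### The universal extension -/

section UnivExt

variable {E : EntFun.{u}} {A B K K' L L' : Hilb.{u}}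

/-- `V ⊗ W` acts as `V ⊗ 1` followed by `1 ⊗ W`, and each step is a single outcome of a local
channel. -/
theorem IsMonotone.homExt_cj_le (hE : IsMonotone FinDim E) [hK : FiniteDimensional ℂ K]
    [hK' : FiniteDimensional ℂ K'] [hL : FiniteDimensional ℂ L] [hL' : FiniteDimensional ℂ L']
    {V : K →L[ℂ] K'} (hV : ‖V‖ ≤ 1) {W : L →L[ℂ] L'} (hW : ‖W‖ ≤ 1) {T : Op (K ⊠ L)}
    (hT : T.IsPositive) : homExt (E K' L') (cj (tmap V W) T) ≤ homExt (E K L) T := by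
  have h1 := homExt_cj_leA (hE.em2A K K' L hK hK' hL) hV hT
  have h2 := homExt_cj_leB (hE.em2B K' L L' hK' hL hL') hW (cj_isPositive (tmap V (.id ℂ L)) hT)
  rw [cj_cj, tmap_comp] at h2
  exact h2.trans h1

theorem compress_eq (P : FinProj A) (Q : FinProj B) (ω : Op (A ⊠ B)) :
    compress P Q ω = cj (tmap P.incl† Q.incl†) ω := by
  change (tmap P.incl Q.incl)† ∘L (ω ∘L tmap P.incl Q.incl) = _
  rw [cj, ← tmap_adjoint, adjoint_adjoint]

theorem truncVal_eq (P : FinProj A) (Q : FinProj B) (ω : Op (A ⊠ B)) :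
    truncVal E P Q ω = homExt (E P.space Q.space) (cj (tmap P.incl† Q.incl†) ω) := by
  rw [truncVal, compress_eq]

theorem truncVal_le_univExt (P : FinProj A) (Q : FinProj B) (ω : Op (A ⊠ B)) :
    truncVal E P Q ω ≤ univExt E A B ω :=
  le_iSup₂ (f := fun (P : FinProj A) (Q : FinProj B) => truncVal E P Q ω) P Q

theorem univExt_zero : univExt E A B 0 = 0 := by
  simp [univExt, truncVal_eq, cj_zero, homExt_zero]

theorem univExt_smul {c : ℝ} (hc : 0 ≤ c) (ω : Op (A ⊠ B)) :
    univExt E A B (c • ω) = ENNReal.ofReal c * univExt E A B ω := by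
  simp only [univExt, truncVal_eq, ENNReal.mul_iSup, cj_real_smul, homExt_smul _ hc]

/-- The supremum is built from homogeneous functions, so it is its own homogeneous extension and may
be used on unnormalized operators. -/
theorem homExt_univExt {T : Op (A ⊠ B)} (hT : T.IsPositive) (htr : etr T ≠ ⊤) :
    homExt (univExt E A B) T = univExt E A B T := by
  by_cases h0 : etr T = 0
  · rw [eq_zero_of_etr_eq_zero hT h0, homExt_zero, univExt_zero]
  · have := smul_normalize h0 htr
    conv_rhs => rw [← this, univExt_smul ENNReal.toReal_nonneg, ENNReal.ofReal_toReal htr]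
    rfl

theorem IsMonotone.univExt_cj_le (hE : IsMonotone FinDim E) [FiniteDimensional ℂ K]
    [FiniteDimensional ℂ L] {J : K →L[ℂ] A} (hJ : ‖J‖ ≤ 1) {M : L →L[ℂ] B} (hM : ‖M‖ ≤ 1)
    {X : Op (K ⊠ L)} (hX : X.IsPositive) :
    univExt E A B (cj (tmap J M) X) ≤ homExt (E K L) X := by
  refine iSup₂_le fun P Q => ?_
  rw [truncVal_eq, cj_cj, tmap_comp]
  refine hE.homExt_cj_le ?_ ?_ hX
  · exact (opNorm_comp_le _ _).trans (mul_le_one₀ (norm_adjoint_le_one P.norm_incl)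
      (norm_nonneg _) hJ)
  · exact (opNorm_comp_le _ _).trans (mul_le_one₀ (norm_adjoint_le_one Q.norm_incl)
      (norm_nonneg _) hM)

/-- The range of the adjoint of a map to a finite-dimensional space. -/
def adjRange [FiniteDimensional ℂ K] (V : A →L[ℂ] K) : FinProj A :=
  ⟨LinearMap.range (V† : K →ₗ[ℂ] A), inferInstance⟩

/-- `V` vanishes on the complement of the range of `V†`, so it factors through any projector whose
range contains that range. -/
theorem comp_incl_of_mem {V : A →L[ℂ] K} (P : FinProj A) (h : ∀ x, V† x ∈ P.1) :
    (V ∘L P.incl) ∘L P.incl† = V := by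
  rw [comp_assoc, FinProj.incl_comp_adjoint]
  have h2 : P.op ∘L V† = V† := by
    ext x
    rw [comp_apply, P.op_apply_of_mem (h x)]
  have := congrArg adjoint h2
  rwa [adjoint_comp, adjoint_adjoint, FinProj.op_adjoint] at this

theorem comp_adjRange [FiniteDimensional ℂ K] (V : A →L[ℂ] K) :
    (V ∘L (adjRange V).incl) ∘L (adjRange V).incl† = V :=
  comp_incl_of_mem _ fun x => LinearMap.mem_range_self (V† : K →ₗ[ℂ] A) x

/-- `V` and `W` factor through the finite-dimensional ranges of their adjoints: compression to these
ranges gives a term of the supremum, and the remaining contractions only decrease it. -/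
theorem IsMonotone.homExt_cj_le_univExt (hE : IsMonotone FinDim E) [FiniteDimensional ℂ K]
    [FiniteDimensional ℂ L] {V : A →L[ℂ] K} (hV : ‖V‖ ≤ 1) {W : B →L[ℂ] L} (hW : ‖W‖ ≤ 1)
    {T : Op (A ⊠ B)} (hT : T.IsPositive) :
    homExt (E K L) (cj (tmap V W) T) ≤ univExt E A B T := by
  obtain ⟨P, hP⟩ : ∃ P : FinProj A, (V ∘L P.incl) ∘L P.incl† = V := ⟨_, comp_adjRange V⟩
  obtain ⟨Q, hQ⟩ : ∃ Q : FinProj B, (W ∘L Q.incl) ∘L Q.incl† = W := ⟨_, comp_adjRange W⟩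
  refine le_trans ?_ (truncVal_le_univExt P Q T)
  have h1 : cj (tmap V W) T = cj (tmap (V ∘L P.incl) (W ∘L Q.incl)) (cj (tmap P.incl† Q.incl†) T) := by
    rw [cj_cj, tmap_comp, hP, hQ]
  rw [h1, truncVal_eq]
  have h2 : ‖V ∘L P.incl‖ ≤ 1 :=
    (opNorm_comp_le _ _).trans (mul_le_one₀ hV (norm_nonneg _) (FinProj.norm_incl _))
  have h3 : ‖W ∘L Q.incl‖ ≤ 1 :=
    (opNorm_comp_le _ _).trans (mul_le_one₀ hW (norm_nonneg _) (FinProj.norm_incl _))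
  exact hE.homExt_cj_le (K := P.space) (L := Q.space) h2 h3 (cj_isPositive _ hT)

theorem IsMonotone.univExt_cj_eq (hE : IsMonotone FinDim E) [FiniteDimensional ℂ K]
    [FiniteDimensional ℂ L] {J : K →L[ℂ] A} (hJ : J† ∘L J = .id ℂ K) {M : L →L[ℂ] B}
    (hM : M† ∘L M = .id ℂ L) {X : Op (K ⊠ L)} (hX : X.IsPositive) :
    univExt E A B (cj (tmap J M) X) = homExt (E K L) X := by
  refine le_antisymm (hE.univExt_cj_le (norm_le_one_of_isometry hJ) (norm_le_one_of_isometry hM) hX)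
    ?_
  have := hE.homExt_cj_le_univExt (norm_adjoint_le_one (norm_le_one_of_isometry hJ))
    (norm_adjoint_le_one (norm_le_one_of_isometry hM)) (cj_isPositive (tmap J M) hX)
  rwa [cj_cj, tmap_comp, hJ, hM, tmap_id, cj_id] at this

/-- `E` is continuous on the states of each finite-dimensional system. -/
def ContFin (E : EntFun.{u}) : Prop :=
  ∀ A B, FinDim A → FinDim B → ContOnStates (E A B)

/-- A supremum of lower semicontinuous functions. Each truncation sees a finite-dimensional space,
so convergence of matrix elements is enough. -/
theorem univExt_le_liminf (hc : ContFin E) {T : ℕ → Op (A ⊠ B)} {T₀ : Op (A ⊠ B)}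
    (hT : ∀ n, (T n).IsPositive) (hT₀ : T₀.IsPositive) (h : TendstoWeak T T₀) :
    univExt E A B T₀ ≤ liminf (fun n => univExt E A B (T n)) atTop := by
  refine iSup₂_le fun P Q => ?_
  refine le_trans (b := liminf (fun n => truncVal E P Q (T n)) atTop) ?_
    (liminf_le_liminf (Eventually.of_forall fun n => truncVal_le_univExt P Q (T n)))
  simp only [truncVal_eq]
  exact homExt_le_liminf (hc _ _ P.finDim Q.finDim) (fun n => cj_isPositive _ (hT n))
    (cj_isPositive _ hT₀) (h.cj _)

theorem tendstoWeak_cj {H : Hilb.{u}} (P : ℕ → Op H) (hP : ∀ n, (P n)† = P n)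
    (hlim : ∀ x, Tendsto (fun n => P n x) atTop (𝓝 x)) (T : Op H) :
    TendstoWeak (fun n => cj (P n) T) T := by
  intro x y
  simp only [inner_cj, hP]
  exact (hlim x).inner ((T.continuous.tendsto _).comp (hlim y))

/-- The universal extension is the limit along arbitrary approximations of the identities. -/
theorem IsMonotone.tendsto_univExt (hE : IsMonotone FinDim E) (hc : ContFin E)
    {T : Op (A ⊠ B)} (hT : T.IsPositive) (K L : ℕ → Hilb.{u})
    [∀ n, FiniteDimensional ℂ (K n)] [∀ n, FiniteDimensional ℂ (L n)]
    (V : ∀ n, A →L[ℂ] K n) (W : ∀ n, B →L[ℂ] L n) (hV : ∀ n, ‖V n‖ ≤ 1) (hW : ∀ n, ‖W n‖ ≤ 1)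
    (hV1 : ∀ x, Tendsto (fun n => ((V n)† ∘L V n) x) atTop (𝓝 x))
    (hW1 : ∀ x, Tendsto (fun n => ((W n)† ∘L W n) x) atTop (𝓝 x)) :
    Tendsto (fun n => homExt (E (K n) (L n)) (cj (tmap (V n) (W n)) T)) atTop
      (𝓝 (univExt E A B T)) := by
  have hnorm : ∀ {X Y : Hilb.{u}} {U : X →L[ℂ] Y}, ‖U‖ ≤ 1 → ‖U† ∘L U‖ ≤ 1 := fun hU =>
    (opNorm_comp_le _ _).trans (mul_le_one₀ (norm_adjoint_le_one hU) (norm_nonneg _) hU)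
  refine tendsto_of_le_liminf_of_limsup_le ?_ ?_
  -- Lower bound: `T` is the weak limit of its images under `V_n† V_n ⊗ W_n† W_n`, and these arise
  -- by contractions from the truncations in question, hence have no larger value.
  · have hw : TendstoWeak (fun n => cj (tmap ((V n)† ∘L V n) ((W n)† ∘L W n)) T) T := by
      refine tendstoWeak_cj _ (fun n => ?_) (fun z => ?_) T
      · rw [tmap_adjoint, adjoint_comp, adjoint_comp, adjoint_adjoint, adjoint_adjoint]
      · have := tendsto_tmap (fun n => (V n)† ∘L V n) (.id ℂ A) (fun n => (W n)† ∘L W n) (.id ℂ B)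
          (fun n => hnorm (hV n)) (fun n => hnorm (hW n)) hV1 hW1 z
        rwa [tmap_id] at this
    refine (univExt_le_liminf hc (fun n => cj_isPositive _ hT) hT hw).trans
      (liminf_le_liminf (Eventually.of_forall fun n => ?_))
    have := hE.univExt_cj_le (norm_adjoint_le_one (hV n)) (norm_adjoint_le_one (hW n))
      (cj_isPositive (tmap (V n) (W n)) hT)
    rwa [cj_cj, tmap_comp] at this
  · exact limsup_le_of_le (by isBoundedDefault)
      (Eventually.of_forall fun n => hE.homExt_cj_le_univExt (hV n) (hW n) hT)

theorem IsMonotone.tendsto_truncVal (hE : IsMonotone FinDim E) (hc : ContFin E)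
    {T : Op (A ⊠ B)} (hT : T.IsPositive) {P : ℕ → FinProj A} {Q : ℕ → FinProj B}
    (hP : TendstoId P) (hQ : TendstoId Q) :
    Tendsto (fun n => truncVal E (P n) (Q n) T) atTop (𝓝 (univExt E A B T)) := by
  simp only [truncVal_eq]
  refine hE.tendsto_univExt hc hT (fun n => (P n).space) (fun n => (Q n).space)
    (fun n => (P n).incl†) (fun n => (Q n).incl†) (fun n => norm_adjoint_le_one (P n).norm_incl)
    (fun n => norm_adjoint_le_one (Q n).norm_incl) (fun x => ?_) (fun x => ?_)
  · refine (hP x).congr fun n => ?_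
    rw [adjoint_adjoint, FinProj.incl_comp_adjoint]
  · refine (hQ x).congr fun n => ?_
    rw [adjoint_adjoint, FinProj.incl_comp_adjoint]

theorem IsMonotone.univExt_add_le (hE : IsMonotone FinDim E) {T S : Op (A ⊠ B)}
    (hT : T.IsPositive) (hS : S.IsPositive) :
    univExt E A B (T + S) ≤ univExt E A B T + univExt E A B S := by
  refine iSup₂_le fun P Q => ?_
  refine le_trans ?_ (add_le_add (truncVal_le_univExt P Q T) (truncVal_le_univExt P Q S))
  simp only [truncVal_eq, cj_add]
  exact homExt_add_le (hE.em3 _ _ P.finDim Q.finDim) (cj_isPositive _ hT) (cj_isPositive _ hS)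
    (etr_ne_top _) (etr_ne_top _)

theorem IsMonotone.univExt_em3 (hE : IsMonotone FinDim E) : EM3 (univExt E A B) := by
  intro ρ hρ σ hσ t h0 h1
  refine (hE.univExt_add_le (smul_isPositive hρ.1 h0)
    (smul_isPositive hσ.1 (sub_nonneg.2 h1))).trans ?_
  rw [univExt_smul h0, univExt_smul (sub_nonneg.2 h1)]

theorem univExt_lsc (hc : ContFin E) : LscOnStates (univExt E A B) :=
  fun _ _ hω hω₀ h => univExt_le_liminf hc (fun n => (hω n).1) hω₀.1 h.weak

end UnivExt

/-! ### Partial traces -/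

section PTrace

variable {H K : Hilb.{u}} {ι : Type*} {V : ι → K →L[ℂ] H} {ω : Op H}

theorem cj_adjoint_eq (V : K →L[ℂ] H) (ω : Op H) : V† ∘L (ω ∘L V) = cj V† ω := by
  rw [cj, adjoint_adjoint]

/-- The terms are positive, their operator norms are bounded by their traces, and the traces add up
to that of `ω`. Without summability the infinite sum defining the partial trace would be the default
value 0. -/
theorem summable_ptrace (hV : ∀ z, ∑' i, ‖(V i)† z‖ₑ ^ 2 = ‖z‖ₑ ^ 2) (hω : ω.IsPositive)
    (htr : etr ω ≠ ⊤) : Summable fun i => (V i)† ∘L (ω ∘L V i) := by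
  have h := tsum_etr_cj hω (fun i => (V i)†) hV
  have hne : ∑' i, etr (cj (V i)† ω) ≠ ⊤ := by rwa [h]
  refine Summable.of_norm_bounded (ENNReal.summable_toReal hne) fun i => ?_
  have hpos : (cj (V i)† ω).IsPositive := cj_isPositive _ hω
  have hfin : etr (cj (V i)† ω) ≠ ⊤ := ENNReal.ne_top_of_tsum_ne_top hne i
  rw [cj_adjoint_eq, ← traceNorm_eq_etr hpos]
  exact norm_le_traceNorm (by rwa [traceNorm_eq_etr hpos])

theorem hasSum_inner_ptrace (hV : ∀ z, ∑' i, ‖(V i)† z‖ₑ ^ 2 = ‖z‖ₑ ^ 2) (hω : ω.IsPositive)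
    (htr : etr ω ≠ ⊤) (x y : K) :
    HasSum (fun i => ⟪V i x, ω (V i y)⟫_ℂ) ⟪x, ptrace V ω y⟫_ℂ := by
  have h := (summable_ptrace hV hω htr).hasSum
  have h2 := h.mapL (ContinuousLinearMap.apply ℂ K y)
  have h3 := h2.mapL (innerSL ℂ x)
  refine h3.congr_fun fun i => ?_
  simp [adjoint_inner_right]

theorem ptrace_isPositive (hV : ∀ z, ∑' i, ‖(V i)† z‖ₑ ^ 2 = ‖z‖ₑ ^ 2) (hω : ω.IsPositive)
    (htr : etr ω ≠ ⊤) : (ptrace V ω).IsPositive :=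
  isPositive_of_forall fun x =>
    (hasSum_inner_ptrace hV hω htr x x).nonneg fun i => inner_nonneg hω (V i x)

theorem ofReal_inner_ptrace (hV : ∀ z, ∑' i, ‖(V i)† z‖ₑ ^ 2 = ‖z‖ₑ ^ 2) (hω : ω.IsPositive)
    (htr : etr ω ≠ ⊤) (x : K) :
    ENNReal.ofReal (⟪x, ptrace V ω x⟫_ℂ).re = ∑' i, ENNReal.ofReal (⟪V i x, ω (V i x)⟫_ℂ).re := by
  have h := Complex.hasSum_re (hasSum_inner_ptrace hV hω htr x x)
  have hre : ∀ i, 0 ≤ (⟪V i x, ω (V i x)⟫_ℂ).re := fun i => hω.re_inner_nonneg_right _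
  rw [← h.tsum_eq, ENNReal.ofReal_tsum_of_nonneg hre h.summable]

theorem etr_ptrace (hV : ∀ z, ∑' i, ‖(V i)† z‖ₑ ^ 2 = ‖z‖ₑ ^ 2) (hω : ω.IsPositive)
    (htr : etr ω ≠ ⊤) : etr (ptrace V ω) = etr ω := by
  rw [etr]
  simp only [ofReal_inner_ptrace hV hω htr]
  rw [ENNReal.tsum_comm, ← tsum_etr_cj hω (fun i => (V i)†) hV]
  refine tsum_congr fun i => ?_
  simp only [etr, inner_cj, adjoint_adjoint]

end PTrace

/-! ### Selective monotonicity of the universal extension -/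

/-- Semicontinuity in the form of a convergent minorant: limits of minorants can be added over
finitely many `k`, which keeps lower limits of sums out of the argument. -/
theorem exists_le_tendsto_homExt {K : Hilb.{u}} [FiniteDimensional ℂ K] {F : Op K → ℝ≥0∞}
    (hF : ContOnStates F) {T : ℕ → Op K} {T₀ : Op K} (hT : ∀ n, (T n).IsPositive)
    (hT₀ : T₀.IsPositive) (h : TendstoWeak T T₀) :
    ∃ g : ℕ → ℝ≥0∞, (∀ n, g n ≤ homExt F (T n)) ∧ Tendsto g atTop (𝓝 (homExt F T₀)) := by
  by_cases h0 : etr T₀ = 0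
  · refine ⟨fun _ => 0, fun _ => zero_le, ?_⟩
    rw [homExt_of_etr_eq_zero F h0]
    exact tendsto_const_nhds
  · exact ⟨_, fun _ => le_rfl, tendsto_homExt hF hT hT₀ h h0⟩

theorem one_sub_norm_le {H : Hilb.{u}} {P : Op H} (hP : P† = P) (hPP : P ∘L P = P) : ‖1 - P‖ ≤ 1 :=
  norm_le_one_of_proj (one_sub_adjoint hP) (one_sub_comp hPP)

section Trunc

variable {A B : Hilb.{u}}

theorem tmap_op_adjoint (P : FinProj A) (Q : FinProj B) :
    (tmap P.op Q.op)† = tmap P.op Q.op := by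
  rw [tmap_adjoint, P.op_adjoint, Q.op_adjoint]

theorem tmap_op_comp (P : FinProj A) (Q : FinProj B) :
    tmap P.op Q.op ∘L tmap P.op Q.op = tmap P.op Q.op := by
  rw [tmap_comp, P.op_comp, Q.op_comp]

theorem cj_op_eq (P : FinProj A) (Q : FinProj B) (ω : Op (A ⊠ B)) :
    cj (tmap P.op Q.op) ω = cj (tmap P.incl Q.incl) (cj (tmap P.incl† Q.incl†) ω) := by
  rw [cj_cj, tmap_comp, P.incl_comp_adjoint, Q.incl_comp_adjoint]

theorem tendsto_tmap_op {P : ℕ → FinProj A} {Q : ℕ → FinProj B} (hP : TendstoId P)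
    (hQ : TendstoId Q) (z : A ⊠ B) :
    Tendsto (fun n => tmap (P n).op (Q n).op z) atTop (𝓝 z) := by
  have := tendsto_tmap (fun n => (P n).op) (.id ℂ A) (fun n => (Q n).op) (.id ℂ B)
    (fun n => (P n).norm_op) (fun n => (Q n).norm_op) hP hQ z
  rwa [tmap_id] at this

theorem IsPosContr.tendstoTr_op {K : Hilb.{u}} {G : TC (A ⊠ B) →ₗ[ℂ] TC K} (hG : IsPosContr G)
    {P : ℕ → FinProj A} {Q : ℕ → FinProj B} (hP : TendstoId P) (hQ : TendstoId Q)
    (T : TC (A ⊠ B)) (hT : (T : Op (A ⊠ B)).IsPositive) (htr : etr (T : Op (A ⊠ B)) ≠ ⊤)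
    (T' : ℕ → TC (A ⊠ B))
    (hT' : ∀ n, (T' n : Op (A ⊠ B)) = cj (tmap (P n).op (Q n).op) (T : Op (A ⊠ B))) :
    TendstoTr (fun n => (G (T' n) : Op K)) (G T : Op K) :=
  hG.tendsto_trunc T hT htr _ (fun n => tmap_op_adjoint (P n) (Q n))
    (fun _ => norm_le_one_of_proj (tmap_op_adjoint _ _) (tmap_op_comp _ _))
    (fun _ => one_sub_norm_le (tmap_op_adjoint _ _) (tmap_op_comp _ _))
    (fun z => tendsto_tmap_op hP hQ z) T' hT'

theorem tendstoTr_op {P : ℕ → FinProj A} {Q : ℕ → FinProj B} (hP : TendstoId P) (hQ : TendstoId Q)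
    {T : Op (A ⊠ B)} (hT : T.IsPositive) (htr : etr T ≠ ⊤) :
    TendstoTr (fun n => cj (tmap (P n).op (Q n).op) T) T :=
  tendstoTr_trunc hT htr _ (fun n => tmap_op_adjoint (P n) (Q n))
    (fun _ => norm_le_one_of_proj (tmap_op_adjoint _ _) (tmap_op_comp _ _))
    (fun _ => one_sub_norm_le (tmap_op_adjoint _ _) (tmap_op_comp _ _))
    (fun z => tendsto_tmap_op hP hQ z)

end Trunc

/-! ### EM2 of the extension for operations on `A` -/

section UnivA

variable {E : EntFun.{u}} {A A' B : Hilb.{u}}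

/-- The operator on the ranges of the projectors, as an element of the trace class. -/
def truncTCA (R : FinProj A) (S : FinProj B) (ω : Op (A ⊠ B)) : TC (R.space ⊠ S.space) :=
  ⟨cj (tmap R.incl† S.incl†) ω, mem_TC_of_finiteDimensional _⟩

/-- The output is supported on `S` on the passive side, so its truncation by `Q` factors through the
truncation by `S`, followed by the contraction `Q† S`. -/
theorem IsMonotone.truncVal_finLocalA_le (hE : IsMonotone FinDim E)
    {Λ : TC (A ⊠ B) →ₗ[ℂ] TC (A' ⊠ B)} (hΛ : IsLocalA Λ) (P : FinProj A') (Q : FinProj B)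
    (R : FinProj A) (S : FinProj B) (T : TC (R.space ⊠ S.space))
    (hT : (T : Op (R.space ⊠ S.space)).IsPositive) :
    truncVal E P Q (Λ (adTC (tmap R.incl S.incl) (cj_mem_TC_of_dom _) T) : Op (A' ⊠ B)) ≤
      homExt (E P.space S.space)
        (finLocalA R.incl S.incl P.incl† Λ T : Op (P.space ⊠ S.space)) := by
  have hsup := local_supportA R.incl S.incl S.incl_isometry hΛ T
  have hpos : (Λ (adTC (tmap R.incl S.incl) (cj_mem_TC_of_dom _) T) : Op (A' ⊠ B)).IsPositive :=
    hΛ.1.pos (cj_isPositive _ hT)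
  have key : cj (tmap P.incl† Q.incl†)
      (Λ (adTC (tmap R.incl S.incl) (cj_mem_TC_of_dom _) T) : Op (A' ⊠ B)) =
      cj (tmap (.id ℂ P.space) (Q.incl† ∘L S.incl))
        (finLocalA R.incl S.incl P.incl† Λ T : Op (P.space ⊠ S.space)) := by
    have h1 : (finLocalA R.incl S.incl P.incl† Λ T : Op (P.space ⊠ S.space)) =
      cj (tmap P.incl† S.incl†)
        (Λ (adTC (tmap R.incl S.incl) (cj_mem_TC_of_dom _) T) : Op (A' ⊠ B)) := rfl
    conv_lhs => rw [← hsup]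
    rw [h1, cj_cj, cj_cj, cj_cj, tmap_comp, tmap_comp, tmap_comp]
    rfl
  rw [truncVal_eq, key]
  refine hE.homExt_cj_le (K := P.space) (L := S.space) norm_id_le ?_ ?_
  · exact (opNorm_comp_le _ _).trans (mul_le_one₀ (norm_adjoint_le_one Q.norm_incl)
      (norm_nonneg _) S.norm_incl)
  · exact cj_isPositive _ hpos

theorem IsMonotone.univExt_em2A (hE : IsMonotone FinDim E) (hc : ContFin E) (hA : Sep A)
    (hA' : Sep A') (hB : Sep B) : EM2A (univExt E A B) (univExt E A' B) := by
  intro Λ hΛ hs ω hω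
  have htr : etr (ω : Op (A ⊠ B)) ≠ ⊤ := by rw [hω.2]; simp
  have hpos : ∀ k, (Λ k ω : Op (A' ⊠ B)).IsPositive := fun k => (hΛ k).1.pos hω.1
  have hcontr : ∀ k, IsPosContr (Λ k) := isPosContr_of_channel (fun k => (hΛ k).1) hs
  have hfin : ∀ k, etr (Λ k ω : Op (A' ⊠ B)) ≠ ⊤ :=
    fun k => etr_ne_top_of_le ((hcontr k).le ω hω.1) htr
  simp only [homExt_univExt (hpos _) (hfin _)]
  obtain ⟨P, hP⟩ := exists_tendstoId hA'
  obtain ⟨Q, hQ⟩ := exists_tendstoId hB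
  obtain ⟨R, hR⟩ := exists_tendstoId hA
  -- Two limits are taken, both over finite partial sums: first `n → ∞` in the truncations of the
  -- outputs, then, for fixed `n`, `m → ∞` in the truncations of the input.
  rw [ENNReal.tsum_eq_iSup_sum]
  refine iSup_le fun s => ?_
  refine le_of_tendsto' (tendsto_finsetSum s fun k _ =>
    hE.tendsto_truncVal hc (hpos k) hP hQ) fun n => ?_
  -- The truncated input, put back into the full space so that `Λ k` can act on it. Positivity of `Λ
  -- k` makes the outputs converge in trace norm.
  set X : ℕ → TC (A ⊠ B) := fun m =>
    adTC (tmap (R m).incl (Q m).incl) (cj_mem_TC_of_dom _) (truncTCA (R m) (Q m) (ω : Op (A ⊠ B))) with hX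
  have hconv : ∀ k, TendstoWeak (fun m => cj (tmap (P n).incl† (Q n).incl†) (Λ k (X m) : Op (A' ⊠ B)))
      (cj (tmap (P n).incl† (Q n).incl†) (Λ k ω : Op (A' ⊠ B))) := fun k =>
    ((hcontr k).tendstoTr_op hR hQ ω hω.1 htr X (fun m => (cj_op_eq _ _ _).symm)).weak.cj _
  have hposT : ∀ m, (truncTCA (R m) (Q m) (ω : Op (A ⊠ B)) :
      Op ((R m).space ⊠ (Q m).space)).IsPositive := fun m => cj_isPositive _ hω.1
  have hg := fun k => exists_le_tendsto_homExt (hc _ _ (P n).finDim (Q n).finDim)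
    (fun m => cj_isPositive (tmap (P n).incl† (Q n).incl†)
      ((hΛ k).1.pos (cj_isPositive _ (hposT m)) : (Λ k (X m) : Op (A' ⊠ B)).IsPositive))
    (cj_isPositive _ (hpos k)) (hconv k)
  choose g hg1 hg2 using hg
  simp only [truncVal_eq]
  refine le_of_tendsto' (tendsto_finsetSum s fun k _ => hg2 k) fun m => ?_
  calc ∑ k ∈ s, g k m
      ≤ ∑ k ∈ s, homExt (E (P n).space (Q m).space) (finLocalA (R m).incl (Q m).incl (P n).incl†
          (Λ k) (truncTCA (R m) (Q m) (ω : Op (A ⊠ B))) : Op ((P n).space ⊠ (Q m).space)) := by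
        refine Finset.sum_le_sum fun k _ => (hg1 k m).trans ?_
        have := hE.truncVal_finLocalA_le (hΛ k) (P n) (Q n) (R m) (Q m)
          (truncTCA (R m) (Q m) (ω : Op (A ⊠ B))) (hposT m)
        rwa [truncVal_eq] at this
    _ ≤ ∑' k, homExt (E (P n).space (Q m).space) (finLocalA (R m).incl (Q m).incl (P n).incl†
          (Λ k) (truncTCA (R m) (Q m) (ω : Op (A ⊠ B))) : Op ((P n).space ⊠ (Q m).space)) :=
        ENNReal.sum_le_tsum s
    _ ≤ homExt (E (R m).space (Q m).space) (truncTCA (R m) (Q m) (ω : Op (A ⊠ B)) :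
          Op ((R m).space ⊠ (Q m).space)) :=
        tsum_homExt_finLocalA_le (hE.em2A _ _ _ (R m).finDim (P n).finDim (Q m).finDim) hA'
          (R m).incl (R m).incl_isometry (Q m).incl (Q m).incl_isometry
          (norm_adjoint_le_one (P n).norm_incl) hΛ hs _ (hposT m)
    _ ≤ univExt E A B (ω : Op (A ⊠ B)) := by
        have := truncVal_le_univExt (E := E) (R m) (Q m) (ω : Op (A ⊠ B))
        rwa [truncVal_eq] at this

end UnivA

/-! ### EM2 of the extension for operations on the second factor -/

section UnivB

variable {E : EntFun.{u}} {A A' B : Hilb.{u}}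

/-- The operator on the ranges of the projectors, as an element of the trace class. -/
def truncTCB (R : FinProj A) (S : FinProj B) (ω : Op (B ⊠ A)) : TC (S.space ⊠ R.space) :=
  ⟨cj (tmap S.incl† R.incl†) ω, mem_TC_of_finiteDimensional _⟩

theorem IsMonotone.truncVal_finLocalB_le (hE : IsMonotone FinDim E)
    {Λ : TC (B ⊠ A) →ₗ[ℂ] TC (B ⊠ A')} (hΛ : IsLocalB Λ) (P : FinProj A') (Q : FinProj B)
    (R : FinProj A) (S : FinProj B) (T : TC (S.space ⊠ R.space))
    (hT : (T : Op (S.space ⊠ R.space)).IsPositive) :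
    truncVal E Q P (Λ (adTC (tmap S.incl R.incl) (cj_mem_TC_of_dom _) T) : Op (B ⊠ A')) ≤
      homExt (E S.space P.space)
        (finLocalB R.incl S.incl P.incl† Λ T : Op (S.space ⊠ P.space)) := by
  have hsup := local_supportB R.incl S.incl S.incl_isometry hΛ T
  have hpos : (Λ (adTC (tmap S.incl R.incl) (cj_mem_TC_of_dom _) T) : Op (B ⊠ A')).IsPositive :=
    hΛ.1.pos (cj_isPositive _ hT)
  have key : cj (tmap Q.incl† P.incl†)
      (Λ (adTC (tmap S.incl R.incl) (cj_mem_TC_of_dom _) T) : Op (B ⊠ A')) =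
      cj (tmap (Q.incl† ∘L S.incl) (.id ℂ P.space))
        (finLocalB R.incl S.incl P.incl† Λ T : Op (S.space ⊠ P.space)) := by
    have h1 : (finLocalB R.incl S.incl P.incl† Λ T : Op (S.space ⊠ P.space)) =
      cj (tmap S.incl† P.incl†)
        (Λ (adTC (tmap S.incl R.incl) (cj_mem_TC_of_dom _) T) : Op (B ⊠ A')) := rfl
    conv_lhs => rw [← hsup]
    rw [h1, cj_cj, cj_cj, cj_cj, tmap_comp, tmap_comp, tmap_comp]
    rfl
  rw [truncVal_eq, key]
  refine hE.homExt_cj_le (K := S.space) (L := P.space) ?_ norm_id_le ?_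
  · exact (opNorm_comp_le _ _).trans (mul_le_one₀ (norm_adjoint_le_one Q.norm_incl)
      (norm_nonneg _) S.norm_incl)
  · exact cj_isPositive _ hpos

theorem IsMonotone.univExt_em2B (hE : IsMonotone FinDim E) (hc : ContFin E) (hA : Sep A)
    (hA' : Sep A') (hB : Sep B) : EM2B (univExt E B A) (univExt E B A') := by
  intro Λ hΛ hs ω hω
  have htr : etr (ω : Op (B ⊠ A)) ≠ ⊤ := by rw [hω.2]; simp
  have hpos : ∀ k, (Λ k ω : Op (B ⊠ A')).IsPositive := fun k => (hΛ k).1.pos hω.1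
  have hcontr : ∀ k, IsPosContr (Λ k) := isPosContr_of_channel (fun k => (hΛ k).1) hs
  have hfin : ∀ k, etr (Λ k ω : Op (B ⊠ A')) ≠ ⊤ :=
    fun k => etr_ne_top_of_le ((hcontr k).le ω hω.1) htr
  simp only [homExt_univExt (hpos _) (hfin _)]
  obtain ⟨P, hP⟩ := exists_tendstoId hA'
  obtain ⟨Q, hQ⟩ := exists_tendstoId hB
  obtain ⟨R, hR⟩ := exists_tendstoId hA
  rw [ENNReal.tsum_eq_iSup_sum]
  refine iSup_le fun s => ?_
  refine le_of_tendsto' (tendsto_finsetSum s fun k _ =>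
    hE.tendsto_truncVal hc (hpos k) hQ hP) fun n => ?_
  set X : ℕ → TC (B ⊠ A) := fun m =>
    adTC (tmap (Q m).incl (R m).incl) (cj_mem_TC_of_dom _) (truncTCB (R m) (Q m) (ω : Op (B ⊠ A))) with hX
  have hconv : ∀ k, TendstoWeak (fun m => cj (tmap (Q n).incl† (P n).incl†) (Λ k (X m) : Op (B ⊠ A')))
      (cj (tmap (Q n).incl† (P n).incl†) (Λ k ω : Op (B ⊠ A'))) := fun k =>
    ((hcontr k).tendstoTr_op hQ hR ω hω.1 htr X (fun m => (cj_op_eq _ _ _).symm)).weak.cj _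
  have hposT : ∀ m, (truncTCB (R m) (Q m) (ω : Op (B ⊠ A)) :
      Op ((Q m).space ⊠ (R m).space)).IsPositive := fun m => cj_isPositive _ hω.1
  have hg := fun k => exists_le_tendsto_homExt (hc _ _ (Q n).finDim (P n).finDim)
    (fun m => cj_isPositive (tmap (Q n).incl† (P n).incl†)
      ((hΛ k).1.pos (cj_isPositive _ (hposT m)) : (Λ k (X m) : Op (B ⊠ A')).IsPositive))
    (cj_isPositive _ (hpos k)) (hconv k)
  choose g hg1 hg2 using hg
  simp only [truncVal_eq]
  refine le_of_tendsto' (tendsto_finsetSum s fun k _ => hg2 k) fun m => ?_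
  calc ∑ k ∈ s, g k m
      ≤ ∑ k ∈ s, homExt (E (Q m).space (P n).space) (finLocalB (R m).incl (Q m).incl (P n).incl†
          (Λ k) (truncTCB (R m) (Q m) (ω : Op (B ⊠ A))) : Op ((Q m).space ⊠ (P n).space)) := by
        refine Finset.sum_le_sum fun k _ => (hg1 k m).trans ?_
        have := hE.truncVal_finLocalB_le (hΛ k) (P n) (Q n) (R m) (Q m)
          (truncTCB (R m) (Q m) (ω : Op (B ⊠ A))) (hposT m)
        rwa [truncVal_eq] at this
    _ ≤ ∑' k, homExt (E (Q m).space (P n).space) (finLocalB (R m).incl (Q m).incl (P n).incl†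
          (Λ k) (truncTCB (R m) (Q m) (ω : Op (B ⊠ A))) : Op ((Q m).space ⊠ (P n).space)) :=
        ENNReal.sum_le_tsum s
    _ ≤ homExt (E (Q m).space (R m).space) (truncTCB (R m) (Q m) (ω : Op (B ⊠ A)) :
          Op ((Q m).space ⊠ (R m).space)) :=
        tsum_homExt_finLocalB_le (hE.em2B _ _ _ (Q m).finDim (R m).finDim (P n).finDim) hA'
          (R m).incl (R m).incl_isometry (Q m).incl (Q m).incl_isometry
          (norm_adjoint_le_one (P n).norm_incl) hΛ hs _ (hposT m)
    _ ≤ univExt E B A (ω : Op (B ⊠ A)) := by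
        have := truncVal_le_univExt (E := E) (Q m) (R m) (ω : Op (B ⊠ A))
        rwa [truncVal_eq] at this

end UnivB

/-! ### Normalization -/

theorem traceNorm_real_smul_le {H : Hilb.{u}} (c : ℝ) (T : Op H) :
    traceNorm (c • T) ≤ ENNReal.ofReal |c| * traceNorm T := by
  have h := traceNorm_smul_le (c : ℂ) T
  rw [Complex.norm_real, Real.norm_eq_abs] at h
  exact (le_of_eq (congrArg traceNorm (Complex.coe_smul c T).symm)).trans h

/-- The traces converge as well, and the error splits into a scaled `T n - T₀` and a small multiple
of `T₀`. -/
theorem TendstoTr.normalize {H : Hilb.{u}} {T : ℕ → Op H} {T₀ : Op H} (h : TendstoTr T T₀)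
    (h0 : etr T₀ ≠ 0) (h1 : etr T₀ ≠ ⊤) (hT₀ : T₀.IsPositive) :
    TendstoTr (fun n => ((etr (T n)).toReal)⁻¹ • T n) (((etr T₀).toReal)⁻¹ • T₀) := by
  have hc : Tendsto (fun n => ((etr (T n)).toReal)⁻¹) atTop (𝓝 ((etr T₀).toReal)⁻¹) :=
    ((ENNReal.tendsto_toReal h1).comp (h.tendsto_etr h1)).inv₀ (ENNReal.toReal_pos h0 h1).ne'
  set c : ℕ → ℝ := fun n => ((etr (T n)).toReal)⁻¹
  set c₀ : ℝ := ((etr T₀).toReal)⁻¹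
  have hlim : Tendsto (fun n => ENNReal.ofReal |c n| * traceNorm (T n - T₀) +
      ENNReal.ofReal |c n - c₀| * etr T₀) atTop (𝓝 0) := by
    have e1 : Tendsto (fun n => ENNReal.ofReal |c n|) atTop (𝓝 (ENNReal.ofReal |c₀|)) :=
      ENNReal.tendsto_ofReal hc.abs
    have e2 : Tendsto (fun n => ENNReal.ofReal |c n - c₀|) atTop (𝓝 0) := by
      have := ENNReal.tendsto_ofReal (hc.sub_const c₀).abs
      simpa using this
    have e3 := ENNReal.Tendsto.mul e1 (Or.inr ENNReal.zero_ne_top) h (Or.inr ENNReal.ofReal_ne_top)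
    have e4 := ENNReal.Tendsto.mul_const e2 (b := etr T₀) (Or.inr h1)
    simpa using e3.add e4
  refine tendsto_of_tendsto_of_tendsto_of_le_of_le tendsto_const_nhds hlim (fun _ => bot_le)
    fun n => ?_
  have hsplit : c n • T n - c₀ • T₀ = c n • (T n - T₀) + (c n - c₀) • T₀ := by module
  simp only
  rw [hsplit]
  refine (traceNorm_add_le _ _).trans (add_le_add (traceNorm_real_smul_le _ _) ?_)
  rw [← traceNorm_eq_etr hT₀]
  exact traceNorm_real_smul_le _ _

theorem traceNorm_cj_adjoint_le {H K : Hilb.{u}} {V : K →L[ℂ] H} (hV : V† ∘L V = .id ℂ K)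
    (T : Op H) : traceNorm (cj V† T) ≤ traceNorm T := by
  rw [traceNorm_le_iff]
  intro n e f he hf
  let V' : K →ₗᵢ[ℂ] H := ⟨V, norm_of_adjoint_comp hV⟩
  have h1 : Orthonormal ℂ (fun i => V (e i)) := he.comp_linearIsometry V'
  have h2 : Orthonormal ℂ (fun i => V (f i)) := hf.comp_linearIsometry V'
  refine le_trans (le_of_eq ?_) (le_traceNorm T h1 h2)
  refine Finset.sum_congr rfl fun i _ => ?_
  rw [inner_cj, adjoint_adjoint]

theorem exists_traceNorm_cj_le {H K : Hilb.{u}} [FiniteDimensional ℂ H] (V : H →L[ℂ] K) :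
    ∃ C : ℝ≥0∞, C ≠ ⊤ ∧ ∀ T : Op H, traceNorm (cj V T) ≤ C * traceNorm T := by
  refine ⟨∑ i : Fin (Module.finrank ℂ H), ∑ j : Fin (Module.finrank ℂ H),
    ENNReal.ofReal (‖V (stdOrthonormalBasis ℂ H i)‖ ^ 2 +
          ‖V (stdOrthonormalBasis ℂ H j)‖ ^ 2), ?_, fun T => ?_⟩
  · exact (ENNReal.sum_lt_top.2 fun i _ => ENNReal.sum_lt_top.2 fun j _ =>
      ENNReal.ofReal_lt_top).ne
  · refine (traceNorm_cj_le_sum V T).trans ?_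
    rw [Finset.sum_mul]
    refine Finset.sum_le_sum fun i _ => ?_
    rw [Finset.sum_mul]
    refine Finset.sum_le_sum fun j _ => ?_
    rw [mul_comm]
    gcongr
    exact norm_inner_le_traceNorm T ((stdOrthonormalBasis ℂ H).norm_eq_one i)
      ((stdOrthonormalBasis ℂ H).norm_eq_one j)

/-! ### Separable states -/

section Separable

variable {A B K L : Hilb.{u}}

/-- The product states. -/
def prodStates (A B : Hilb.{u}) : Set (Op (A ⊠ B)) :=
  {τ | ∃ ρ ∈ states A, ∃ σ ∈ states B, τ = tmap ρ σ}

theorem convex_states {H : Hilb.{u}} : Convex ℝ (states H) := by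
  intro ρ hρ σ hσ a b ha hb hab
  refine ⟨(smul_isPositive hρ.1 ha).add (smul_isPositive hσ.1 hb), ?_⟩
  rw [etr_add (smul_isPositive hρ.1 ha) (smul_isPositive hσ.1 hb), etr_smul ha, etr_smul hb,
    hρ.2, hσ.2, mul_one, mul_one, ← ENNReal.ofReal_add ha hb, hab, ENNReal.ofReal_one]

theorem prodStates_subset : prodStates A B ⊆ states (A ⊠ B) := by
  rintro _ ⟨ρ, hρ, σ, hσ, rfl⟩
  exact ⟨tmap_isPositive hρ.1 hσ.1, by rw [etr_tmap hρ.1 hσ.1, hρ.2, hσ.2, one_mul]⟩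

theorem convexHull_prodStates_subset : convexHull ℝ (prodStates A B) ⊆ states (A ⊠ B) :=
  convexHull_min prodStates_subset convex_states

/-- The convex cone generated by the product states. -/
def sepCone (A B : Hilb.{u}) : Set (Op (A ⊠ B)) :=
  {τ | τ = 0 ∨ ∃ c : ℝ, 0 < c ∧ ∃ χ ∈ convexHull ℝ (prodStates A B), τ = c • χ}

theorem sepCone_add {x y : Op (A ⊠ B)} (hx : x ∈ sepCone A B) (hy : y ∈ sepCone A B) :
    x + y ∈ sepCone A B := by
  rcases hx with rfl | ⟨c, hc, χ, hχ, rfl⟩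
  · rwa [zero_add]
  rcases hy with rfl | ⟨d, hd, ξ, hξ, rfl⟩
  · rw [add_zero]; exact Or.inr ⟨c, hc, χ, hχ, rfl⟩
  refine Or.inr ⟨c + d, by positivity, (c / (c + d)) • χ + (d / (c + d)) • ξ, ?_, ?_⟩
  · exact convex_convexHull ℝ _ hχ hξ (by positivity) (by positivity) (by field_simp)
  · rw [smul_add, smul_smul, smul_smul]
    congr 2 <;> field_simp

theorem sepCone_smul {x : Op (A ⊠ B)} (hx : x ∈ sepCone A B) {a : ℝ} (ha : 0 ≤ a) :
    a • x ∈ sepCone A B := by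
  rcases ha.eq_or_lt with rfl | ha
  · exact Or.inl (zero_smul _ _)
  rcases hx with rfl | ⟨c, hc, χ, hχ, rfl⟩
  · exact Or.inl (smul_zero _)
  · exact Or.inr ⟨a * c, by positivity, χ, hχ, smul_smul _ _ _⟩

theorem tmap_mem_sepCone {ρ : Op A} {σ : Op B} (hρ : ρ.IsPositive) (hσ : σ.IsPositive)
    (hρt : etr ρ ≠ ⊤) (hσt : etr σ ≠ ⊤) : tmap ρ σ ∈ sepCone A B := by
  by_cases h0 : etr ρ = 0
  · left; rw [eq_zero_of_etr_eq_zero hρ h0, tmap_zero_left]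
  by_cases h1 : etr σ = 0
  · left; rw [eq_zero_of_etr_eq_zero hσ h1, tmap_zero_right]
  right
  have hc := ENNReal.toReal_pos h0 hρt
  have hd := ENNReal.toReal_pos h1 hσt
  refine ⟨(etr ρ).toReal * (etr σ).toReal, by positivity, _,
    subset_convexHull ℝ _ ⟨_, normalize_mem_states hρ h0 hρt, _, normalize_mem_states hσ h1 hσt,
      rfl⟩, ?_⟩
  have hl : ∀ (c : ℝ) (T : Op A) (S : Op B), tmap (c • T) S = c • tmap T S := fun c T S => by
    have := tmap_smul_left (c : ℂ) T S
    rwa [Complex.coe_smul, Complex.coe_smul] at this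
  have hr : ∀ (c : ℝ) (T : Op A) (S : Op B), tmap T (c • S) = c • tmap T S := fun c T S => by
    have := tmap_smul_right (c : ℂ) T S
    rwa [Complex.coe_smul, Complex.coe_smul] at this
  rw [hl, hr, smul_smul, smul_smul]
  have : (etr ρ).toReal * (etr σ).toReal * ((etr ρ).toReal)⁻¹ * ((etr σ).toReal)⁻¹ = 1 := by
    field_simp
  rw [this, one_smul]

/-- A compressed product state is a product of positive operators, possibly zero and not normalized.
Convex combinations of such operators stay in the cone, though not in the hull of states. -/
theorem cj_mem_sepCone {V : A →L[ℂ] K} {W : B →L[ℂ] L} (hV : ‖V‖ ≤ 1) (hW : ‖W‖ ≤ 1)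
    {χ : Op (A ⊠ B)} (hχ : χ ∈ convexHull ℝ (prodStates A B)) :
    cj (tmap V W) χ ∈ sepCone K L := by
  have : convexHull ℝ (prodStates A B) ⊆ {χ | cj (tmap V W) χ ∈ sepCone K L} := by
    refine convexHull_min ?_ ?_
    · rintro _ ⟨ρ, hρ, σ, hσ, rfl⟩
      rw [Set.mem_ofPred_eq, cj_tmap]
      exact tmap_mem_sepCone (cj_isPositive _ hρ.1) (cj_isPositive _ hσ.1)
        (etr_ne_top_of_le (etr_cj_le hρ.1 hV) (by rw [hρ.2]; simp))
        (etr_ne_top_of_le (etr_cj_le hσ.1 hW) (by rw [hσ.2]; simp))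
    · intro x hx y hy a b ha hb _
      rw [Set.mem_ofPred_eq, cj_add, cj_real_smul, cj_real_smul]
      exact sepCone_add (sepCone_smul hx ha) (sepCone_smul hy hb)
  exact this hχ

theorem normalize_mem_of_sepCone {χ : Op (A ⊠ B)} (h : χ ∈ sepCone A B) (h0 : etr χ ≠ 0) :
    ((etr χ).toReal)⁻¹ • χ ∈ convexHull ℝ (prodStates A B) := by
  rcases h with rfl | ⟨c, hc, χ, hχ, rfl⟩
  · exact absurd etr_zero h0
  · rw [etr_smul hc.le, (convexHull_prodStates_subset hχ).2, mul_one, ENNReal.toReal_ofReal hc.le,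
      smul_smul, inv_mul_cancel₀ hc.ne', one_smul]
    exact hχ

theorem IsSeparable.exists_seq {ω : Op (A ⊠ B)} (h : IsSeparable ω) :
    ∃ χ : ℕ → Op (A ⊠ B), (∀ n, χ n ∈ convexHull ℝ (prodStates A B)) ∧ TendstoTr χ ω := by
  obtain ⟨ε, -, hε, hε0⟩ := exists_seq_strictAnti_tendsto' (zero_lt_one (α := ℝ≥0∞))
  choose χ hχ hlt using fun n => h.2 (ε n) (hε n).1
  refine ⟨χ, hχ, tendsto_of_tendsto_of_tendsto_of_le_of_le tendsto_const_nhds hε0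
    (fun _ => bot_le) fun n => ?_⟩
  simp only
  rw [traceNorm_sub_comm]
  exact (hlt n).le

theorem isSeparable_of_seq {ω : Op (A ⊠ B)} (hω : ω ∈ states (A ⊠ B)) {χ : ℕ → Op (A ⊠ B)}
    (hχ : ∀ᶠ n in atTop, χ n ∈ convexHull ℝ (prodStates A B)) (h : TendstoTr χ ω) :
    IsSeparable ω := by
  refine ⟨hω, fun ε hε => ?_⟩
  obtain ⟨n, h1, h2⟩ := (hχ.and (h.eventually (gt_mem_nhds hε))).exists
  exact ⟨χ n, h1, by rwa [traceNorm_sub_comm]⟩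

/-- Compress an approximating sequence of mixtures of product states: compression by the adjoint of
an isometry does not increase the trace norm, and nonzero trace in the limit permits normalization.
-/
theorem IsSeparable.normalize_cj {J : K →L[ℂ] A} {M : L →L[ℂ] B} (hJ : J† ∘L J = .id ℂ K)
    (hM : M† ∘L M = .id ℂ L) {ω : Op (A ⊠ B)} (h : IsSeparable ω)
    (h0 : etr (cj (tmap J† M†) ω) ≠ 0) :
    IsSeparable (((etr (cj (tmap J† M†) ω)).toReal)⁻¹ • cj (tmap J† M†) ω) := by
  obtain ⟨χ, hχ, hlim⟩ := h.exists_seq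
  have hpos : (cj (tmap J† M†) ω).IsPositive := cj_isPositive _ h.1.1
  have hJ1 := norm_adjoint_le_one (norm_le_one_of_isometry hJ)
  have hM1 := norm_adjoint_le_one (norm_le_one_of_isometry hM)
  have hfin : etr (cj (tmap J† M†) ω) ≠ ⊤ :=
    etr_ne_top_of_le (etr_cj_le h.1.1 (norm_tmap_le_one hJ1 hM1)) (by rw [h.1.2]; simp)
  have hlim2 : TendstoTr (fun n => cj (tmap J† M†) (χ n)) (cj (tmap J† M†) ω) := by
    refine tendsto_of_tendsto_of_tendsto_of_le_of_le tendsto_const_nhds hlim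
      (fun _ => bot_le) fun n => ?_
    simp only
    rw [← cj_sub, ← tmap_adjoint]
    exact traceNorm_cj_adjoint_le (norm_tmap_isometry hJ hM) _
  refine isSeparable_of_seq (normalize_mem_states hpos h0 hfin) ?_ (hlim2.normalize h0 hfin hpos)
  filter_upwards [(hlim2.tendsto_etr hfin).eventually_ne h0] with n hn
  exact normalize_mem_of_sepCone (cj_mem_sepCone hJ1 hM1 (hχ n)) hn

theorem IsSeparable.embed [FiniteDimensional ℂ K] [FiniteDimensional ℂ L] {J : K →L[ℂ] A}
    {M : L →L[ℂ] B} (hJ : J† ∘L J = .id ℂ K) (hM : M† ∘L M = .id ℂ L) {τ : Op (K ⊠ L)}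
    (h : IsSeparable τ) : IsSeparable (cj (tmap J M) τ) := by
  obtain ⟨χ, hχ, hlim⟩ := h.exists_seq
  obtain ⟨C, hC, hbound⟩ := exists_traceNorm_cj_le (tmap J M)
  have hst : ∀ {X Y : Hilb.{u}} {W : X →L[ℂ] Y} {T : Op X}, W† ∘L W = .id ℂ X → T ∈ states X →
      cj W T ∈ states Y := fun hW hT =>
    ⟨cj_isPositive _ hT.1, by rw [etr_cj_isometry hT.1 (norm_of_adjoint_comp hW), hT.2]⟩
  refine isSeparable_of_seq (hst (norm_tmap_isometry hJ hM) h.1)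
    (χ := fun n => cj (tmap J M) (χ n)) (Eventually.of_forall fun n => ?_) ?_
  · have : convexHull ℝ (prodStates K L) ⊆
        {χ | cj (tmap J M) χ ∈ convexHull ℝ (prodStates A B)} := by
      refine convexHull_min ?_ ?_
      · rintro _ ⟨ρ, hρ, σ, hσ, rfl⟩
        exact subset_convexHull ℝ _ ⟨_, hst hJ hρ, _, hst hM hσ, cj_tmap _ _ _ _⟩
      · intro x hx y hy a b ha hb hab
        rw [Set.mem_ofPred_eq, cj_add, cj_real_smul, cj_real_smul]
        exact convex_convexHull ℝ _ hx hy ha hb hab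
    exact this (hχ n)
  · have hz := ENNReal.Tendsto.const_mul (a := C) hlim (Or.inr hC)
    rw [mul_zero] at hz
    refine tendsto_of_tendsto_of_tendsto_of_le_of_le tendsto_const_nhds hz
      (fun _ => bot_le) fun n => ?_
    simp only
    rw [← cj_sub]
    exact hbound _

theorem isSeparable_of_tendstoTr {ω : Op (A ⊠ B)} (hω : ω ∈ states (A ⊠ B)) {χ : ℕ → Op (A ⊠ B)}
    (hχ : ∀ᶠ n in atTop, IsSeparable (χ n)) (h : TendstoTr χ ω) : IsSeparable ω := by
  refine ⟨hω, fun ε hε => ?_⟩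
  have hε2 : 0 < ε / 2 := ENNReal.half_pos hε.ne'
  obtain ⟨n, h1, h2⟩ := (hχ.and (h.eventually (gt_mem_nhds hε2))).exists
  obtain ⟨ξ, hξ, hlt⟩ := h1.2 _ hε2
  refine ⟨ξ, hξ, ?_⟩
  have := traceNorm_add_le (ω - χ n) (χ n - ξ)
  rw [sub_add_sub_cancel] at this
  refine this.trans_lt ?_
  rw [traceNorm_sub_comm ω]
  calc _ < ε / 2 + ε / 2 := ENNReal.add_lt_add h2 hlt
    _ = ε := ENNReal.add_halves ε

theorem IsMonotone.univExt_em1 {E : EntFun.{u}} (hE : IsMonotone FinDim E) (hA : Sep A)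
    (hB : Sep B) : EM1 (univExt E A B) := by
  intro ω hω
  have htr : etr ω ≠ ⊤ := by rw [hω.2]; simp
  constructor
  -- If the supremum vanishes, so does every truncated value; by EM1 of `E` the normalized
  -- truncations are separable, and so is their trace norm limit `ω`.
  · intro h
    obtain ⟨P, hP⟩ := exists_tendstoId hA
    obtain ⟨Q, hQ⟩ := exists_tendstoId hB
    have hlim := tendstoTr_op hP hQ hω.1 htr
    have hlim2 := hlim.normalize (by rw [hω.2]; simp) htr hω.1
    rw [hω.2] at hlim2
    simp only [ENNReal.toReal_one, inv_one, one_smul] at hlim2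
    refine isSeparable_of_tendstoTr hω ?_ hlim2
    filter_upwards [(hlim.tendsto_etr htr).eventually_ne (show etr ω ≠ 0 by rw [hω.2]; simp)] with n hn
    have hX : (cj (tmap (P n).incl† (Q n).incl†) ω).IsPositive := cj_isPositive _ hω.1
    have het : etr (cj (tmap (P n).op (Q n).op) ω) = etr (cj (tmap (P n).incl† (Q n).incl†) ω) := by
      rw [cj_op_eq, etr_cj_isometry hX (norm_of_adjoint_comp
        (norm_tmap_isometry (P n).incl_isometry (Q n).incl_isometry))]
    rw [het] at hn ⊢
    have hle := truncVal_le_univExt (E := E) (P n) (Q n) ω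
    rw [h, nonpos_iff_eq_zero, truncVal_eq, homExt, mul_eq_zero] at hle
    have h2 := hle.resolve_left hn
    rw [hE.em1 _ _ (P n).finDim (Q n).finDim _ (normalize_mem_states hX hn (etr_ne_top _))] at h2
    have h3 := h2.embed (P n).incl_isometry (Q n).incl_isometry
    rwa [cj_real_smul, ← cj_op_eq] at h3
  -- Conversely, normalized compressions of a separable state are separable, so every term of the
  -- supremum is 0.
  · intro h
    refine le_antisymm (iSup₂_le fun P Q => ?_) zero_le
    rw [truncVal_eq]
    by_cases h0 : etr (cj (tmap P.incl† Q.incl†) ω) = 0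
    · rw [homExt_of_etr_eq_zero _ h0]
    · have h2 := h.normalize_cj P.incl_isometry Q.incl_isometry h0
      rw [homExt, (hE.em1 _ _ P.finDim Q.finDim _ h2.1).2 h2, mul_zero]

end Separable

/-! ### States with finite rank marginals -/

section Support

variable {A B : Hilb.{u}} {ω : Op (A ⊠ B)}

theorem tsum_slice_left (z : A ⊠ B) :
    ∑' j, ‖(inR A (onb B j))† z‖ₑ ^ 2 = ‖z‖ₑ ^ 2 :=
  parseval_slice_left (onb B) z

theorem tsum_slice_right (z : A ⊠ B) :
    ∑' i, ‖(inL (onb A i) B)† z‖ₑ ^ 2 = ‖z‖ₑ ^ 2 :=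
  parseval_slice_right (onb A) z

theorem margA_isPositive (hω : ω.IsPositive) (htr : etr ω ≠ ⊤) : (margA ω).IsPositive :=
  ptrace_isPositive tsum_slice_left hω htr

theorem margB_isPositive (hω : ω.IsPositive) (htr : etr ω ≠ ⊤) : (margB ω).IsPositive :=
  ptrace_isPositive tsum_slice_right hω htr

theorem eq_zero_of_hilbertBasis {H F : Type*} [NormedAddCommGroup H] [InnerProductSpace ℂ H]
    [NormedAddCommGroup F] [NormedSpace ℂ F] {ι : Type*} (b : HilbertBasis ι ℂ H)
    {T : H →L[ℂ] F} (h : ∀ i, T (b i) = 0) : T = 0 := by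
  refine ContinuousLinearMap.ext_on (s := Set.range b)
    (Submodule.dense_iff_topologicalClosure_eq_top.2 b.dense_span) ?_
  rintro _ ⟨i, rfl⟩
  simpa using h i

/-- With `S` the square root of `ω`, the quadratic form of the marginal at `R x` is `∑_j ‖S (R x ⊗
b_j)‖²`. If the marginal kills `R x`, every summand vanishes. -/
theorem comp_tmap_eq_zeroA (hω : ω.IsPositive) (htr : etr ω ≠ ⊤) {R : Op A}
    (hR : ∀ x, margA ω (R x) = 0) : ω ∘L tmap R (.id ℂ B) = 0 := by
  obtain ⟨S, hS, hSS⟩ := exists_sqrt hω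
  have h1 : ∀ x, S ∘L inL (R x) B = 0 := fun x => by
    refine eq_zero_of_hilbertBasis (onb B) fun j => ?_
    have h := ofReal_inner_ptrace tsum_slice_left hω htr (R x)
    have h0 : ptrace (fun j => inR A (onb B j)) ω (R x) = 0 := hR x
    rw [h0, inner_zero_right, Complex.zero_re, ENNReal.ofReal_zero, eq_comm,
      ENNReal.tsum_eq_zero] at h
    have h2 := h j
    rw [re_inner_of_sqrt hS hSS, ofReal_norm_sq, pow_eq_zero_iff two_ne_zero, enorm_eq_zero] at h2
    exact h2
  have h2 : S ∘L tmap R (.id ℂ B) = 0 := by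
    refine ext_tmk fun a b => ?_
    rw [comp_apply, tmap_tmk]
    exact congrArg (fun f => f b) (h1 a)
  rw [← hSS, comp_assoc, h2, comp_zero]

theorem comp_tmap_eq_zeroB (hω : ω.IsPositive) (htr : etr ω ≠ ⊤) {R : Op B}
    (hR : ∀ x, margB ω (R x) = 0) : ω ∘L tmap (.id ℂ A) R = 0 := by
  obtain ⟨S, hS, hSS⟩ := exists_sqrt hω
  have h1 : ∀ x, S ∘L inR A (R x) = 0 := fun x => by
    refine eq_zero_of_hilbertBasis (onb A) fun j => ?_
    have h := ofReal_inner_ptrace tsum_slice_right hω htr (R x)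
    have h0 : ptrace (fun j => inL (onb A j) B) ω (R x) = 0 := hR x
    rw [h0, inner_zero_right, Complex.zero_re, ENNReal.ofReal_zero, eq_comm,
      ENNReal.tsum_eq_zero] at h
    have h2 := h j
    rw [re_inner_of_sqrt hS hSS, ofReal_norm_sq, pow_eq_zero_iff two_ne_zero, enorm_eq_zero] at h2
    exact h2
  have h2 : S ∘L tmap (.id ℂ A) R = 0 := by
    refine ext_tmk fun a b => ?_
    rw [comp_apply, tmap_tmk]
    exact congrArg (fun f => f a) (h1 b)
  rw [← hSS, comp_assoc, h2, comp_zero]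

/-- A self-adjoint operator vanishes on the orthogonal complement of any subspace that contains its
range. -/
theorem apply_one_sub_eq_zero {H : Hilb.{u}} {T : Op H} (hT : T.IsPositive) (P : FinProj H)
    (h : ∀ x, T x ∈ P.1) (x : H) : T ((1 - P.op) x) = 0 := by
  have h1 : P.op ∘L T = T := by
    ext y
    rw [comp_apply, P.op_apply_of_mem (h y)]
  have h2 := congrArg adjoint h1
  rw [adjoint_comp, P.op_adjoint, hT.isSelfAdjoint.adjoint_eq] at h2
  have h3 := congrArg (fun f => f x) h2
  simp only [comp_apply] at h3
  rw [_root_.sub_apply, map_sub, h3, one_apply_eq_self, sub_self]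

/-- The support of `ω` lies in the product of the supports of its marginals. This is proved on the
right of `ω`, and taking adjoints gives the left. -/
theorem cj_op_of_marg (hω : ω.IsPositive) (htr : etr ω ≠ ⊤) (P : FinProj A) (Q : FinProj B)
    (hP : ∀ x, margA ω x ∈ P.1) (hQ : ∀ x, margB ω x ∈ Q.1) :
    cj (tmap P.op Q.op) ω = ω := by
  have hsplitA : tmap P.op (.id ℂ B) + tmap (1 - P.op) (.id ℂ B) = .id ℂ (A ⊠ B) := by
    rw [← tmap_add_left, add_sub_cancel, ← tmap_id]
    rfl
  have hsplitB : tmap (.id ℂ A) Q.op + tmap (.id ℂ A) (1 - Q.op) = .id ℂ (A ⊠ B) := by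
    rw [← tmap_add_right, add_sub_cancel, ← tmap_id]
    rfl
  have hA : ω ∘L tmap P.op (.id ℂ B) = ω := by
    conv_rhs => rw [← comp_id ω, ← hsplitA, comp_add, comp_tmap_eq_zeroA hω htr
      (apply_one_sub_eq_zero (margA_isPositive hω htr) P hP), add_zero]
  have hB : ω ∘L tmap (.id ℂ A) Q.op = ω := by
    conv_rhs => rw [← comp_id ω, ← hsplitB, comp_add, comp_tmap_eq_zeroB hω htr
      (apply_one_sub_eq_zero (margB_isPositive hω htr) Q hQ), add_zero]
  have hAB : ω ∘L tmap P.op Q.op = ω := by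
    have : tmap P.op Q.op = tmap P.op (.id ℂ B) ∘L tmap (.id ℂ A) Q.op := by
      rw [tmap_comp]; rfl
    rw [this, ← comp_assoc, hA, hB]
  have hAB' := congrArg adjoint hAB
  rw [adjoint_comp, tmap_op_adjoint, hω.isSelfAdjoint.adjoint_eq] at hAB'
  rw [cj, tmap_op_adjoint, hAB, hAB']

theorem marg_mem_of_cj_op (hω : ω.IsPositive) (htr : etr ω ≠ ⊤) {P : FinProj A} {Q : FinProj B}
    (h : cj (tmap P.op Q.op) ω = ω) :
    (∀ x, margA ω x ∈ P.1) ∧ ∀ x, margB ω x ∈ Q.1 := by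
  have h1 : tmap P.op Q.op ∘L ω = ω := by
    conv_lhs => rw [← h]
    conv_rhs => rw [← h]
    rw [cj, ← comp_assoc, tmap_op_comp]
  have h2 : ∀ a b z, ⟪tmk (P.op a) b, ω z⟫_ℂ = ⟪tmk a b, ω z⟫_ℂ := fun a b z => by
    rw [← h1, comp_apply, ← adjoint_inner_left (tmap P.op Q.op), ← adjoint_inner_left (tmap P.op Q.op),
      tmap_op_adjoint, tmap_tmk, tmap_tmk]
    exact congrArg (fun c => ⟪tmk c _, _⟫_ℂ) (congrArg (fun f => f a) P.op_comp)
  have h3 : ∀ a b z, ⟪tmk a (Q.op b), ω z⟫_ℂ = ⟪tmk a b, ω z⟫_ℂ := fun a b z => by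
    rw [← h1, comp_apply, ← adjoint_inner_left (tmap P.op Q.op), ← adjoint_inner_left (tmap P.op Q.op),
      tmap_op_adjoint, tmap_tmk, tmap_tmk]
    exact congrArg (fun c => ⟪tmk _ c, _⟫_ℂ) (congrArg (fun f => f b) Q.op_comp)
  constructor
  · intro x
    refine Submodule.starProjection_eq_self_iff.1 (ext_inner_left ℂ fun y => ?_)
    change ⟪y, P.op (margA ω x)⟫_ℂ = _
    rw [← adjoint_inner_left, P.op_adjoint]
    have e1 := hasSum_inner_ptrace tsum_slice_left hω htr (P.op y) x
    have e2 := hasSum_inner_ptrace tsum_slice_left hω htr y x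
    refine e1.unique (e2.congr_fun fun j => ?_)
    exact h2 _ _ _
  · intro x
    refine Submodule.starProjection_eq_self_iff.1 (ext_inner_left ℂ fun y => ?_)
    change ⟪y, Q.op (margB ω x)⟫_ℂ = _
    rw [← adjoint_inner_left, Q.op_adjoint]
    have e1 := hasSum_inner_ptrace tsum_slice_right hω htr (Q.op y) x
    have e2 := hasSum_inner_ptrace tsum_slice_right hω htr y x
    refine e1.unique (e2.congr_fun fun j => ?_)
    exact h3 _ _ _

end Support

/-! ### Agreement with `E` on finite rank, and uniqueness -/

section Unique

variable {E : EntFun.{u}} {A B : Hilb.{u}}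

theorem IsMonotone.univExt_cj_op (hE : IsMonotone FinDim E) (P : FinProj A) (Q : FinProj B)
    {ω : Op (A ⊠ B)} (hω : ω.IsPositive) :
    univExt E A B (cj (tmap P.op Q.op) ω) = truncVal E P Q ω := by
  rw [cj_op_eq, truncVal_eq]
  exact hE.univExt_cj_eq P.incl_isometry Q.incl_isometry (cj_isPositive _ hω)

theorem IsMonotone.univExt_agrees (hE : IsMonotone FinDim E) :
    AgreesOnFiniteRank E (univExt E A B) := by
  intro ω hω hA hB
  have htr : etr ω ≠ ⊤ := by rw [hω.2]; simp
  set P : FinProj A := ⟨_, hA⟩ with hPdef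
  set Q : FinProj B := ⟨_, hB⟩ with hQdef
  have h := cj_op_of_marg hω.1 htr P Q
    (fun x => LinearMap.mem_range_self (margA ω : A →ₗ[ℂ] A) x)
    (fun x => LinearMap.mem_range_self (margB ω : B →ₗ[ℂ] B) x)
  have h1 := hE.univExt_cj_op P Q hω.1
  rw [h] at h1
  rw [h1, truncVal, homExt_state]
  have h2 : etr (cj (tmap P.op Q.op) ω) = 1 := by rw [h, hω.2]
  rwa [cj_op_eq, etr_cj_isometry (cj_isPositive _ hω.1) (norm_of_adjoint_comp
        (norm_tmap_isometry P.incl_isometry Q.incl_isometry)), ← compress_eq] at h2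

theorem IsMonotone.eq_univExt_of_cj_op (hE : IsMonotone FinDim E) {F : Op (A ⊠ B) → ℝ≥0∞}
    (hF : AgreesOnFiniteRank E F) {ω : Op (A ⊠ B)} (hω : ω ∈ states (A ⊠ B)) {P : FinProj A}
    {Q : FinProj B} (h : cj (tmap P.op Q.op) ω = ω) : F ω = univExt E A B ω := by
  have htr : etr ω ≠ ⊤ := by rw [hω.2]; simp
  obtain ⟨h1, h2⟩ := marg_mem_of_cj_op hω.1 htr h
  have hA : FiniteDimensional ℂ (LinearMap.range (margA ω : A →ₗ[ℂ] A)) :=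
    Submodule.finiteDimensional_of_le (S₂ := P.1) (by rintro _ ⟨x, rfl⟩; exact h1 x)
  have hB : FiniteDimensional ℂ (LinearMap.range (margB ω : B →ₗ[ℂ] B)) :=
    Submodule.finiteDimensional_of_le (S₂ := Q.1) (by rintro _ ⟨x, rfl⟩; exact h2 x)
  rw [hF ω hω hA hB, hE.univExt_agrees ω hω hA hB]

theorem IsMonotone.homExt_eq_univExt (hE : IsMonotone FinDim E) {F : Op (A ⊠ B) → ℝ≥0∞}
    (hF : AgreesOnFiniteRank E F) {ω : Op (A ⊠ B)} (hω : ω.IsPositive) (htr : etr ω ≠ ⊤)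
    {P : FinProj A} {Q : FinProj B} (h : cj (tmap P.op Q.op) ω = ω) :
    homExt F ω = univExt E A B ω := by
  rw [← homExt_univExt hω htr]
  by_cases h0 : etr ω = 0
  · rw [homExt_of_etr_eq_zero _ h0, homExt_of_etr_eq_zero _ h0]
  · rw [homExt, homExt, hE.eq_univExt_of_cj_op hF (normalize_mem_states hω h0 htr) (P := P) (Q := Q)]
    rw [cj_real_smul, h]

theorem proj_enorm_sq_add {H : Hilb.{u}} {P : Op H} (hP : P† = P) (hPP : P ∘L P = P) (x : H) :
    ∑' i : Bool, ‖(bif i then P else 1 - P) x‖ₑ ^ 2 = ‖x‖ₑ ^ 2 := by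
  have h0 : ⟪P x, (1 - P) x⟫_ℂ = 0 := by
    rw [← adjoint_inner_right, hP, _root_.sub_apply, map_sub, one_apply_eq_self]
    have := congrArg (fun f => f x) hPP
    simp only [comp_apply] at this
    rw [this, sub_self, inner_zero_right]
  have h1 := norm_add_sq_eq_norm_sq_add_norm_sq_of_inner_eq_zero _ _ h0
  have h2 : P x + (1 - P) x = x := by simp
  rw [h2] at h1
  rw [tsum_bool, add_comm]
  simp only [cond_true, cond_false, ← ofReal_norm_sq]
  rw [← ENNReal.ofReal_add (by positivity) (by positivity)]
  congr 1
  nlinarith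

/-- The measurement `{P, 1 - P}` is a local channel on the same system, and one outcome is kept. A
monotone on a single system admits no compression to a subspace as a separate system, hence
projections are used here. -/
theorem homExt_cj_projA_le {F : Op (A ⊠ B) → ℝ≥0∞} (hF : EM2A F F) (P : FinProj A)
    {ω : Op (A ⊠ B)} (hω : ω.IsPositive) (htr : etr ω ≠ ⊤) :
    homExt F (cj (tmap P.op (.id ℂ B)) ω) ≤ homExt F ω := by
  have hR : ∀ i : Bool, (bif i then P.op else 1 - P.op)† = bif i then P.op else 1 - P.op := by
    rintro (_ | _)
    · exact one_sub_adjoint P.op_adjoint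
    · exact P.op_adjoint
  have hRR : ∀ i : Bool, (bif i then P.op else 1 - P.op) ∘L (bif i then P.op else 1 - P.op) =
      bif i then P.op else 1 - P.op := by
    rintro (_ | _)
    · exact one_sub_comp P.op_comp
    · exact P.op_comp
  have h := sum_countable_le (F := F) (F' := F) isLocalA_zero hF
    (fun i : Bool => adTC (tmap (bif i then P.op else 1 - P.op) (.id ℂ B))
      (cj_mem_TC_of_proj (by rw [tmap_adjoint, hR, id_adjoint]) (by rw [tmap_comp, hRR]; rfl)))
    (fun i => ⟨adTC_isCP _ _, adTC (bif i then P.op else 1 - P.op)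
      (cj_mem_TC_of_proj (hR i) (hRR i)), adTC_isCP _ _, fun ρ σ τ hτ => by
        rw [adTC_apply, adTC_apply, hτ, cj_tmap, cj_id]⟩)
    (fun T hT => by
      simp only [adTC_apply]
      exact tsum_etr_cj hT _ (tsum_enorm_tmap_left _ (proj_enorm_sq_add P.op_adjoint P.op_comp)))
    ⟨ω, mem_TC_of_etr hω htr⟩ hω htr
  exact (ENNReal.le_tsum true).trans h

theorem homExt_cj_projB_le {F : Op (A ⊠ B) → ℝ≥0∞} (hF : EM2B F F) (P : FinProj B)
    {ω : Op (A ⊠ B)} (hω : ω.IsPositive) (htr : etr ω ≠ ⊤) :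
    homExt F (cj (tmap (.id ℂ A) P.op) ω) ≤ homExt F ω := by
  have hR : ∀ i : Bool, (bif i then P.op else 1 - P.op)† = bif i then P.op else 1 - P.op := by
    rintro (_ | _)
    · exact one_sub_adjoint P.op_adjoint
    · exact P.op_adjoint
  have hRR : ∀ i : Bool, (bif i then P.op else 1 - P.op) ∘L (bif i then P.op else 1 - P.op) =
      bif i then P.op else 1 - P.op := by
    rintro (_ | _)
    · exact one_sub_comp P.op_comp
    · exact P.op_comp
  have h := sum_countable_le (F := F) (F' := F) isLocalB_zero hF
    (fun i : Bool => adTC (tmap (.id ℂ A) (bif i then P.op else 1 - P.op))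
      (cj_mem_TC_of_proj (by rw [tmap_adjoint, hR, id_adjoint]) (by rw [tmap_comp, hRR]; rfl)))
    (fun i => ⟨adTC_isCP _ _, adTC (bif i then P.op else 1 - P.op)
      (cj_mem_TC_of_proj (hR i) (hRR i)), adTC_isCP _ _, fun ρ σ τ hτ => by
        rw [adTC_apply, adTC_apply, hτ, cj_tmap, cj_id]⟩)
    (fun T hT => by
      simp only [adTC_apply]
      exact tsum_etr_cj hT _ (tsum_enorm_tmap_right _ (proj_enorm_sq_add P.op_adjoint P.op_comp)))
    ⟨ω, mem_TC_of_etr hω htr⟩ hω htr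
  exact (ENNReal.le_tsum true).trans h

theorem homExt_cj_op_le {F : Op (A ⊠ B) → ℝ≥0∞} (hF : IsMonotoneOn A B F) (P : FinProj A)
    (Q : FinProj B) {ω : Op (A ⊠ B)} (hω : ω.IsPositive) (htr : etr ω ≠ ⊤) :
    homExt F (cj (tmap P.op Q.op) ω) ≤ homExt F ω := by
  have hle : ‖tmap P.op (.id ℂ B)‖ ≤ 1 := norm_tmap_le_one P.norm_op norm_id_le
  have h1 := homExt_cj_projA_le hF.em2A P hω htr
  have h2 := homExt_cj_projB_le hF.em2B Q (cj_isPositive (tmap P.op (.id ℂ B)) hω)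
    (etr_ne_top_of_le (etr_cj_le hω hle) htr)
  rw [cj_cj, tmap_comp] at h2
  exact h2.trans h1

/-- The universal extension is the only lower semicontinuous monotone that agrees with `E` on the
states with finite rank marginals. -/
theorem IsMonotone.univExt_unique (hE : IsMonotone FinDim E) (hA : Sep A) (hB : Sep B)
    {F : Op (A ⊠ B) → ℝ≥0∞} (hF : IsMonotoneOn A B F) (hlsc : LscOnStates F)
    (hag : AgreesOnFiniteRank E F) {ω : Op (A ⊠ B)} (hω : ω ∈ states (A ⊠ B)) :
    F ω = univExt E A B ω := by
  have htr : etr ω ≠ ⊤ := by rw [hω.2]; simp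
  have hidem : ∀ (P : FinProj A) (Q : FinProj B),
      cj (tmap P.op Q.op) (cj (tmap P.op Q.op) ω) = cj (tmap P.op Q.op) ω := fun P Q => by
    rw [cj_cj, tmap_op_comp]
  have hfin : ∀ (P : FinProj A) (Q : FinProj B), etr (cj (tmap P.op Q.op) ω) ≠ ⊤ := fun P Q =>
    etr_ne_top_of_le (etr_cj_le hω.1 (norm_tmap_le_one P.norm_op Q.norm_op)) htr
  have hpos : ∀ (P : FinProj A) (Q : FinProj B), (cj (tmap P.op Q.op) ω).IsPositive :=
    fun P Q => cj_isPositive _ hω.1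
  refine le_antisymm ?_ (iSup₂_le fun P Q => ?_)
  -- Upper bound: semicontinuity of `F` along normalized truncations. There `F` agrees with the
  -- extension, which is at most its value at `ω` times a normalizing factor tending to 1.
  · obtain ⟨P, hP⟩ := exists_tendstoId hA
    obtain ⟨Q, hQ⟩ := exists_tendstoId hB
    have hlim := tendstoTr_op hP hQ hω.1 htr
    have h0 : etr ω ≠ 0 := by rw [hω.2]; simp
    have hlim2 := hlim.normalize h0 htr hω.1
    have htend := hlim.tendsto_etr htr
    obtain ⟨N, hN⟩ := eventually_atTop.1 (htend.eventually_ne h0)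
    have hst : ∀ n, ((etr (cj (tmap (P (n + N)).op (Q (n + N)).op) ω)).toReal)⁻¹ •
        cj (tmap (P (n + N)).op (Q (n + N)).op) ω ∈ states (A ⊠ B) := fun n =>
      normalize_mem_states (hpos _ _) (hN _ (by omega)) (hfin _ _)
    have hone : ((etr ω).toReal)⁻¹ • ω = ω := by rw [hω.2]; simp
    rw [hone] at hlim2
    refine (hlsc _ ω hst hω ((tendsto_add_atTop_iff_nat N).2 hlim2)).trans ?_
    have hc : Tendsto (fun n => ENNReal.ofReal
        ((etr (cj (tmap (P (n + N)).op (Q (n + N)).op) ω)).toReal)⁻¹ * univExt E A B ω) atTop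
        (𝓝 (ENNReal.ofReal ((etr ω).toReal)⁻¹ * univExt E A B ω)) := by
      -- The value at `ω` may be infinite, so the limit of the product relies on the limiting factor
      -- being nonzero.
      refine ENNReal.Tendsto.mul_const ?_ (Or.inl (by rw [hω.2]; simp))
      refine ENNReal.tendsto_ofReal ?_
      refine (((ENNReal.tendsto_toReal htr).comp htend).inv₀
        (ENNReal.toReal_pos h0 htr).ne').comp (tendsto_add_atTop_nat N)
    have hlast : ENNReal.ofReal ((etr ω).toReal)⁻¹ * univExt E A B ω = univExt E A B ω := by
      rw [hω.2]; simp
    rw [hlast] at hc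
    refine le_trans (liminf_le_liminf (Eventually.of_forall fun n => ?_)) hc.liminf_eq.le
    rw [hE.eq_univExt_of_cj_op hag (hst n) (P := P (n + N)) (Q := Q (n + N))
      (by rw [cj_real_smul, hidem]), univExt_smul (by positivity)]
    refine mul_le_mul_right ?_ _
    rw [hE.univExt_cj_op _ _ hω.1]
    exact truncVal_le_univExt _ _ _
  -- Lower bound: each truncated value is the value of `F` at a projected state, which monotonicity
  -- of `F` bounds by `F ω`.
  · rw [← hE.univExt_cj_op P Q hω.1, ← homExt_state F hω.2,
      ← hE.homExt_eq_univExt hag (hpos P Q) (hfin P Q) (hidem P Q)]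
    exact homExt_cj_op_le hF P Q hω.1 htr

end Unique

/-! ### Products of states -/

section Regroup

variable {A A' B B' K K' L L' : Hilb.{u}} {τ : Op ((A ⊠ A') ⊠ (B ⊠ B'))} {ω : Op (A ⊠ B)}
  {ω' : Op (A' ⊠ B')}

theorem isPositive_of_dense {H : Hilb.{u}} {T : Op H} {D : Set H} (hD : Dense D)
    (h : ∀ x ∈ D, 0 ≤ ⟪x, T x⟫_ℂ) : T.IsPositive := by
  have hc : IsClosed {x : H | 0 ≤ ⟪x, T x⟫_ℂ} :=
    isClosed_le continuous_const (continuous_id.inner T.continuous)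
  exact isPositive_of_forall fun x => hc.closure_subset_iff.2 h (hD x)

/-- The product basis of a regrouped product. -/
def prodBasis₄ (A A' B B' : Hilb.{u}) :
    HilbertBasis ((OnbIdx A × OnbIdx A') × (OnbIdx B × OnbIdx B')) ℂ ((A ⊠ A') ⊠ (B ⊠ B')) :=
  prodBasis (prodBasis (onb A) (onb A')) (prodBasis (onb B) (onb B'))

theorem prodBasis₄_apply (i : (OnbIdx A × OnbIdx A') × (OnbIdx B × OnbIdx B')) :
    prodBasis₄ A A' B B' i =
      tmk (tmk (onb A i.1.1) (onb A' i.1.2)) (tmk (onb B i.2.1) (onb B' i.2.2)) := by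
  rw [prodBasis₄, prodBasis_apply, prodBasis_apply, prodBasis_apply]

/-- In the product basis the matrix of `τ` is the Gram matrix of the vectors `S(a ⊗ b) ⊗ S'(a' ⊗
b')`, with `S`, `S'` the square roots. No unitary implementing the regrouping is needed. -/
theorem IsRegroupedTensor.isPositive (h : IsRegroupedTensor τ ω ω') (hω : ω.IsPositive)
    (hω' : ω'.IsPositive) : τ.IsPositive := by
  obtain ⟨S, hS, hSS⟩ := exists_sqrt hω
  obtain ⟨S', hS', hSS'⟩ := exists_sqrt hω'
  refine isPositive_of_dense (Submodule.dense_iff_topologicalClosure_eq_top.2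
    (prodBasis₄ A A' B B').dense_span) fun x hx => ?_
  obtain ⟨c, rfl⟩ := (Finsupp.mem_span_range_iff_exists_finsupp).1 hx
  have key : ∀ i j, ⟪prodBasis₄ A A' B B' i, τ (prodBasis₄ A A' B B' j)⟫_ℂ =
      ⟪tmk (S (tmk (onb A i.1.1) (onb B i.2.1))) (S' (tmk (onb A' i.1.2) (onb B' i.2.2))),
        tmk (S (tmk (onb A j.1.1) (onb B j.2.1))) (S' (tmk (onb A' j.1.2) (onb B' j.2.2)))⟫_ℂ :=
    fun i j => by
    rw [prodBasis₄_apply, prodBasis₄_apply, h, inner_of_sqrt hS hSS, inner_of_sqrt hS' hSS',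
      inner_tmk]
  set g : (OnbIdx A × OnbIdx A') × (OnbIdx B × OnbIdx B') → (A ⊠ B) ⊠ (A' ⊠ B') := fun i =>
    tmk (S (tmk (onb A i.1.1) (onb B i.2.1))) (S' (tmk (onb A' i.1.2) (onb B' i.2.2))) with hg
  have h2 : ⟪c.sum fun i a => a • prodBasis₄ A A' B B' i,
      τ (c.sum fun i a => a • prodBasis₄ A A' B B' i)⟫_ℂ =
      ⟪c.sum fun i a => a • g i, c.sum fun i a => a • g i⟫_ℂ := by
    simp only [Finsupp.sum, map_sum, map_smul, sum_inner, inner_sum]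
    refine Finset.sum_congr rfl fun i _ => Finset.sum_congr rfl fun j _ => ?_
    rw [inner_smul_left, inner_smul_left, inner_smul_right, inner_smul_right, key]
  rw [h2, inner_self_eq_norm_sq_to_K, ← RCLike.ofReal_pow]
  exact Complex.zero_le_real.2 (sq_nonneg _)

theorem IsRegroupedTensor.etr_eq (h : IsRegroupedTensor τ ω ω') (hω : ω.IsPositive)
    (hω' : ω'.IsPositive) : etr τ = etr ω * etr ω' := by
  rw [etr_eq_tsum (h.isPositive hω hω') (prodBasis₄ A A' B B'),
    etr_eq_tsum hω (prodBasis (onb A) (onb B)), etr_eq_tsum hω' (prodBasis (onb A') (onb B')),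
    ← (Equiv.prodProdProdComm (OnbIdx A) (OnbIdx B) (OnbIdx A') (OnbIdx B')).tsum_eq,
    ENNReal.tsum_prod', ← ENNReal.tsum_mul_right]
  refine tsum_congr fun i => ?_
  rw [← ENNReal.tsum_mul_left]
  refine tsum_congr fun j => ?_
  rw [prodBasis₄_apply, prodBasis_apply, prodBasis_apply, h]
  have h1 := inner_nonneg hω (tmk (onb A i.1) (onb B i.2))
  have h2 := inner_nonneg hω' (tmk (onb A' j.1) (onb B' j.2))
  rw [← ENNReal.ofReal_mul (Complex.le_def.1 h1).1, Equiv.prodProdProdComm_apply, Complex.mul_re,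
    ← (Complex.le_def.1 h1).2]
  simp

set_option synthInstance.maxHeartbeats 200000 in
theorem IsRegroupedTensor.smul (h : IsRegroupedTensor τ ω ω') (c c' : ℝ) :
    IsRegroupedTensor ((c * c') • τ) (c • ω) (c' • ω') := by
  intro a₁ a₂ a₁' a₂' b₁ b₂ b₁' b₂'
  have : ∀ {H : Hilb.{u}} (c : ℝ) (T : Op H) (x y : H), ⟪x, (c • T) y⟫_ℂ = (c : ℂ) * ⟪x, T y⟫_ℂ :=
    fun c T x y => by rw [_root_.smul_apply, inner_smul_right_eq_smul, Complex.real_smul]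
  rw [this, this, this, h]
  push_cast
  ring

theorem IsRegroupedTensor.cj (h : IsRegroupedTensor τ ω ω') (V : A →L[ℂ] K) (V' : A' →L[ℂ] K')
    (W : B →L[ℂ] L) (W' : B' →L[ℂ] L') :
    IsRegroupedTensor (Entanglement.cj (tmap (tmap V V') (tmap W W')) τ)
      (Entanglement.cj (tmap V W) ω) (Entanglement.cj (tmap V' W') ω') := by
  intro a₁ a₂ a₁' a₂' b₁ b₂ b₁' b₂'
  rw [inner_cj, inner_cj, inner_cj, tmap_adjoint, tmap_adjoint, tmap_adjoint, tmap_adjoint,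
    tmap_adjoint]
  rw [tmap_tmk (tmap V† V'†) (tmap W† W'†), tmap_tmk (tmap V† V'†) (tmap W† W'†)]
  repeat rw [tmap_tmk]
  exact h _ _ _ _ _ _ _ _

/-- Each term on the right carries the trace of the other factor, because `τ` has trace `etr ω * etr
ω'`. The relation `R` is equality for additivity and `≤` for subadditivity. -/
theorem homExt_regrouped {F : Op (A ⊠ B) → ℝ≥0∞} {F' : Op (A' ⊠ B') → ℝ≥0∞}
    {G : Op ((A ⊠ A') ⊠ (B ⊠ B')) → ℝ≥0∞} (R : ℝ≥0∞ → ℝ≥0∞ → Prop) (hR : R 0 0)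
    (hmul : ∀ c x y, R x y → R (c * x) (c * y))
    (h : ∀ ω ∈ states (A ⊠ B), ∀ ω' ∈ states (A' ⊠ B'), ∀ τ, IsRegroupedTensor τ ω ω' →
      R (G τ) (F ω + F' ω'))
    (hτ : IsRegroupedTensor τ ω ω') (hω : ω.IsPositive) (hω' : ω'.IsPositive) (hf : etr ω ≠ ⊤)
    (hf' : etr ω' ≠ ⊤) :
    R (homExt G τ) (etr ω' * homExt F ω + etr ω * homExt F' ω') := by
  have htr := hτ.etr_eq hω hω'
  by_cases h0 : etr ω = 0
  · rw [homExt_of_etr_eq_zero G (by rw [htr, h0, zero_mul]), homExt_of_etr_eq_zero F h0, h0,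
      mul_zero, zero_mul, add_zero]
    exact hR
  by_cases h1 : etr ω' = 0
  · rw [homExt_of_etr_eq_zero G (by rw [htr, h1, mul_zero]), homExt_of_etr_eq_zero F' h1, h1,
      mul_zero, zero_mul, add_zero]
    exact hR
  have h2 := hmul (etr ω * etr ω') _ _ (h _ (normalize_mem_states hω h0 hf) _
    (normalize_mem_states hω' h1 hf') _ (hτ.smul _ _))
  have h3 : etr ω' * homExt F ω + etr ω * homExt F' ω' = etr ω * etr ω' *
      (F ((etr ω).toReal⁻¹ • ω) + F' ((etr ω').toReal⁻¹ • ω')) := by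
    rw [homExt, homExt]; ring
  rw [h3, homExt, htr, ENNReal.toReal_mul, mul_inv]
  exact h2

theorem tendsto_incl_tensor {P : ℕ → FinProj A} {P' : ℕ → FinProj A'} (hP : TendstoId P)
    (hP' : TendstoId P') (x : A ⊠ A') :
    Tendsto (fun n => ((tmap (P n).incl† (P' n).incl†)† ∘L tmap (P n).incl† (P' n).incl†) x) atTop
      (𝓝 x) := by
  refine (tendsto_tmap_op hP hP' x).congr fun n => ?_
  rw [tmap_adjoint, tmap_comp, adjoint_adjoint, adjoint_adjoint, FinProj.incl_comp_adjoint,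
    FinProj.incl_comp_adjoint]

theorem norm_incl_tensor (P : FinProj A) (P' : FinProj A') : ‖tmap P.incl† P'.incl†‖ ≤ 1 :=
  norm_tmap_le_one (norm_adjoint_le_one P.norm_incl) (norm_adjoint_le_one P'.norm_incl)

theorem tendsto_etr_truncVal {P : ℕ → FinProj A} {Q : ℕ → FinProj B} (hP : TendstoId P)
    (hQ : TendstoId Q) (hω : ω ∈ states (A ⊠ B)) :
    Tendsto (fun n => etr (cj (tmap (P n).incl† (Q n).incl†) ω)) atTop (𝓝 1) := by
  have htr : etr ω ≠ ⊤ := by rw [hω.2]; simp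
  have h := (tendstoTr_op hP hQ hω.1 htr).tendsto_etr htr
  rw [hω.2] at h
  refine h.congr fun n => ?_
  rw [cj_op_eq, etr_cj_isometry (cj_isPositive _ hω.1) (norm_of_adjoint_comp
      (norm_tmap_isometry (P n).incl_isometry (Q n).incl_isometry))]

variable {E : EntFun.{u}}

/-- Truncating `τ` by `P ⊗ P'` and `Q ⊗ Q'` regroups the truncations of `ω` and `ω'`. The limit
formula applies on both sides, and the trace weights tend to 1. -/
theorem IsMonotone.exists_tendsto_regrouped (hE : IsMonotone FinDim E) (hc : ContFin E)
    (hA : Sep A) (hA' : Sep A') (hB : Sep B) (hB' : Sep B') (R : ℝ≥0∞ → ℝ≥0∞ → Prop) (hR : R 0 0)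
    (hmul : ∀ c x y, R x y → R (c * x) (c * y))
    (h : ∀ A A' B B', FinDim A → FinDim A' → FinDim B → FinDim B' →
      ∀ ω ∈ states (A ⊠ B), ∀ ω' ∈ states (A' ⊠ B'), ∀ τ : Op ((A ⊠ A') ⊠ (B ⊠ B')),
      IsRegroupedTensor τ ω ω' → R (E (A ⊠ A') (B ⊠ B') τ) (E A B ω + E A' B' ω'))
    (hω : ω ∈ states (A ⊠ B)) (hω' : ω' ∈ states (A' ⊠ B')) (hτ : IsRegroupedTensor τ ω ω') :
    ∃ f g : ℕ → ℝ≥0∞, (∀ n, R (f n) (g n)) ∧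
      Tendsto f atTop (𝓝 (univExt E (A ⊠ A') (B ⊠ B') τ)) ∧
      Tendsto g atTop (𝓝 (univExt E A B ω + univExt E A' B' ω')) := by
  obtain ⟨P, hP⟩ := exists_tendstoId hA
  obtain ⟨P', hP'⟩ := exists_tendstoId hA'
  obtain ⟨Q, hQ⟩ := exists_tendstoId hB
  obtain ⟨Q', hQ'⟩ := exists_tendstoId hB'
  refine ⟨_, _, fun n => homExt_regrouped R hR hmul
    (h _ _ _ _ (P n).finDim (P' n).finDim (Q n).finDim (Q' n).finDim)
    (hτ.cj (P n).incl† (P' n).incl† (Q n).incl† (Q' n).incl†) (cj_isPositive _ hω.1)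
    (cj_isPositive _ hω'.1) (etr_ne_top _) (etr_ne_top _), ?_, ?_⟩
  · exact hE.tendsto_univExt hc (hτ.isPositive hω.1 hω'.1)
      (fun n => (P n).space ⊠ (P' n).space) (fun n => (Q n).space ⊠ (Q' n).space) _ _
      (fun n => norm_incl_tensor _ _) (fun n => norm_incl_tensor _ _)
      (tendsto_incl_tensor hP hP') (tendsto_incl_tensor hQ hQ')
  · have h1 := hE.tendsto_truncVal hc hω.1 hP hQ
    have h2 := hE.tendsto_truncVal hc hω'.1 hP' hQ'
    simp only [truncVal_eq] at h1 h2
    have h3 := ENNReal.Tendsto.mul (tendsto_etr_truncVal hP' hQ' hω') (Or.inl one_ne_zero) h1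
      (Or.inr ENNReal.one_ne_top)
    have h4 := ENNReal.Tendsto.mul (tendsto_etr_truncVal hP hQ hω) (Or.inl one_ne_zero) h2
      (Or.inr ENNReal.one_ne_top)
    rw [one_mul] at h3 h4
    exact h3.add h4

theorem IsMonotone.univExt_em5 (hE : IsMonotone FinDim E) (hc : ContFin E) (h : EM5 FinDim E) :
    EM5 Sep (univExt E) := by
  intro A A' B B' hA hA' hB hB' ω hω ω' hω' τ hτ
  obtain ⟨f, g, hfg, hf, hg⟩ := hE.exists_tendsto_regrouped hc hA hA' hB hB' (· = ·) rfl
    (fun c x y h => by rw [h]) h hω hω' hτ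
  exact tendsto_nhds_unique hf (hg.congr fun n => (hfg n).symm)

theorem IsMonotone.univExt_em6 (hE : IsMonotone FinDim E) (hc : ContFin E) (h : EM6 FinDim E) :
    EM6 Sep (univExt E) := by
  intro A A' B B' hA hA' hB hB' ω hω ω' hω' τ hτ
  obtain ⟨f, g, hfg, hf, hg⟩ := hE.exists_tendsto_regrouped hc hA hA' hB hB' (· ≤ ·) le_rfl
    (fun c x y h => mul_le_mul_right h c) h hω hω' hτ
  exact le_of_tendsto_of_tendsto' hf hg hfg

end Regroup

/-! ### Superadditivity and monogamy -/

section Slices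

variable {A B H R : Hilb.{u}} {κ : Type u}

/-- Polarization: a matrix element is a combination of the quadratic form at `u + c v` for the four
values `c = ±1, ±i`. -/
theorem tendsto_inner_of_quadratic {K : Hilb.{u}} {T : ℕ → Op K} {T₀ : Op K}
    (hT : ∀ n, (T n).IsPositive) (hT₀ : T₀.IsPositive) (u v : K)
    (h : ∀ c : ℂ, Tendsto (fun n => ENNReal.ofReal (⟪u + c • v, T n (u + c • v)⟫_ℂ).re) atTop
      (𝓝 (ENNReal.ofReal (⟪u + c • v, T₀ (u + c • v)⟫_ℂ).re))) :
    Tendsto (fun n => ⟪u, T n v⟫_ℂ) atTop (𝓝 ⟪u, T₀ v⟫_ℂ) := by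
  have hre : ∀ {T : Op K}, T.IsPositive → ∀ x, ((ENNReal.ofReal (⟪x, T x⟫_ℂ).re).toReal : ℂ) =
      ⟪T x, x⟫_ℂ := fun {T} hT x => by
    have h0 := Complex.le_def.1 (inner_nonneg hT x)
    rw [ENNReal.toReal_ofReal h0.1, ← hT.isSelfAdjoint.adjoint_eq, adjoint_inner_left,
      hT.isSelfAdjoint.adjoint_eq]
    exact Complex.ext rfl h0.2
  have h1 : ∀ c : ℂ, Tendsto (fun n => ⟪T n (u + c • v), u + c • v⟫_ℂ) atTop
      (𝓝 ⟪T₀ (u + c • v), u + c • v⟫_ℂ) := fun c => by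
    have := (Complex.continuous_ofReal.tendsto _).comp
      ((ENNReal.tendsto_toReal ENNReal.ofReal_ne_top).comp (h c))
    rw [hre hT₀] at this
    exact this.congr fun n => hre (hT n) _
  have hpol : ∀ {T : Op K}, T.IsPositive → ⟪u, T v⟫_ℂ =
      (⟪T (u + (1 : ℂ) • v), u + (1 : ℂ) • v⟫_ℂ - ⟪T (u + (-1 : ℂ) • v), u + (-1 : ℂ) • v⟫_ℂ -
        Complex.I * ⟪T (u + Complex.I • v), u + Complex.I • v⟫_ℂ +
        Complex.I * ⟪T (u + (-Complex.I) • v), u + (-Complex.I) • v⟫_ℂ) / 4 := fun {T} hT => by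
    have := inner_map_polarization' (T : K →ₗ[ℂ] K) u v
    simp only [one_smul, neg_smul, ← sub_eq_add_neg]
    rw [← adjoint_inner_left, hT.isSelfAdjoint.adjoint_eq]
    exact this
  rw [hpol hT₀]
  simp only [hpol (hT _)]
  exact ((((h1 1).sub (h1 (-1))).sub ((h1 Complex.I).const_mul _)).add
    ((h1 (-Complex.I)).const_mul _)).div_const 4

theorem TendstoWeak.of_tmk {K L : Hilb.{u}} [FiniteDimensional ℂ K] [FiniteDimensional ℂ L]
    {T : ℕ → Op (K ⊠ L)} {T₀ : Op (K ⊠ L)}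
    (h : ∀ a b a' b', Tendsto (fun n => ⟪tmk a b, T n (tmk a' b')⟫_ℂ) atTop
      (𝓝 ⟪tmk a b, T₀ (tmk a' b')⟫_ℂ)) : TendstoWeak T T₀ := by
  have h1 : ∀ a b y, Tendsto (fun n => ⟪tmk a b, T n y⟫_ℂ) atTop (𝓝 ⟪tmk a b, T₀ y⟫_ℂ) := by
    intro a b y
    induction exists_finite_sum_tmk y using Submodule.span_induction with
    | mem y hy => obtain ⟨p, rfl⟩ := hy; exact h _ _ _ _
    | zero => simp
    | add y z _ _ hy hz => simpa only [map_add, inner_add_right] using hy.add hz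
    | smul c y _ hy => simpa only [map_smul, inner_smul_right] using hy.const_mul c
  intro x y
  induction exists_finite_sum_tmk x using Submodule.span_induction with
  | mem x hx => obtain ⟨p, rfl⟩ := hx; exact h1 _ _ _
  | zero => simp
  | add x z _ _ hx hz => simpa only [inner_add_left] using hx.add hz
  | smul c x _ hx => simpa only [inner_smul_left] using hx.const_mul _

theorem inner_cj_tmk {K L : Hilb.{u}} (V : A →L[ℂ] K) (W : B →L[ℂ] L) (T : Op (A ⊠ B)) (a a' : K)
    (b b' : L) : ⟪tmk a b, cj (tmap V W) T (tmk a' b')⟫_ℂ =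
      ⟪tmk (V† a) (W† b), T (tmk (V† a') (W† b'))⟫_ℂ := by
  rw [inner_cj, tmap_adjoint, tmap_tmk, tmap_tmk]

/-- Inside a finite-dimensional truncation product vectors span, and the inclusions carry product
vectors to product vectors. Convergence at combinations of two product vectors therefore suffices.
-/
theorem univExt_le_liminf_of_quadratic {E : EntFun.{u}} (hc : ContFin E) {T : ℕ → Op (A ⊠ B)}
    {T₀ : Op (A ⊠ B)} (hT : ∀ n, (T n).IsPositive) (hT₀ : T₀.IsPositive)
    (h : ∀ a b a' b' (c : ℂ), Tendsto (fun n => ENNReal.ofReal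
      (⟪tmk a b + c • tmk a' b', T n (tmk a b + c • tmk a' b')⟫_ℂ).re) atTop
      (𝓝 (ENNReal.ofReal (⟪tmk a b + c • tmk a' b', T₀ (tmk a b + c • tmk a' b')⟫_ℂ).re))) :
    univExt E A B T₀ ≤ liminf (fun n => univExt E A B (T n)) atTop := by
  refine iSup₂_le fun P Q => ?_
  refine le_trans (b := liminf (fun n => truncVal E P Q (T n)) atTop) ?_
    (liminf_le_liminf (Eventually.of_forall fun n => truncVal_le_univExt P Q (T n)))
  simp only [truncVal_eq]
  refine homExt_le_liminf (hc _ _ P.finDim Q.finDim) (fun n => cj_isPositive _ (hT n))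
    (cj_isPositive _ hT₀) (TendstoWeak.of_tmk (K := P.space) (L := Q.space) fun a b a' b' => ?_)
  rw [inner_cj_tmk]
  exact (tendsto_inner_of_quadratic hT hT₀ _ _ fun c => h _ _ _ _ c).congr fun n =>
    (inner_cj_tmk P.incl† Q.incl† (T n) a a' b b').symm

/-- The family `V` is the family of slices, along an orthonormal basis `r`, of the isometries
`(a ⊗ b) ⊗ r ↦ L a b r`. -/
structure IsSliced (V : κ → (A ⊠ B) →L[ℂ] H) (L : A → B → R →L[ℂ] H) (r : HilbertBasis κ ℂ R) :
    Prop where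
  parseval : ∀ z, ∑' k, ‖(V k)† z‖ₑ ^ 2 = ‖z‖ₑ ^ 2
  apply : ∀ k a b, V k (tmk a b) = L a b (r k)

/-- At a combination of two product vectors the sum over slices is itself a trace, taken over the
discarded system. Convergence of marginals thus reduces to convergence of traces of conjugated
operators. -/
theorem IsSliced.ofReal_inner {V : κ → (A ⊠ B) →L[ℂ] H} {L : A → B → R →L[ℂ] H}
    {r : HilbertBasis κ ℂ R} (hV : IsSliced V L r) {ω : Op H} (hω : ω.IsPositive)
    (htr : etr ω ≠ ⊤) (a a' : A) (b b' : B) (c : ℂ) :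
    ENNReal.ofReal (⟪tmk a b + c • tmk a' b', ptrace V ω (tmk a b + c • tmk a' b')⟫_ℂ).re =
      etr (cj (L a b + c • L a' b')† ω) := by
  rw [ofReal_inner_ptrace hV.parseval hω htr, etr_eq_tsum (cj_isPositive _ hω) r]
  refine tsum_congr fun k => ?_
  rw [inner_cj, adjoint_adjoint, map_add, map_smul, hV.apply, hV.apply]
  rfl

/-- The marginal of a truncated state is not the truncated marginal, since the discarded system is
cut as well. Embedded back by `J` and `M`, these marginals still converge to the full one in the
sense needed for semicontinuity. Condition `hL` says that slicing commutes with truncation. -/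
theorem IsMonotone.univExt_ptrace_le_liminf {E : EntFun.{u}} (hE : IsMonotone FinDim E)
    (hc : ContFin E) {V : κ → (A ⊠ B) →L[ℂ] H} {L : A → B → R →L[ℂ] H} {r : HilbertBasis κ ℂ R}
    (hV : IsSliced V L r) {ω : Op H} (hω : ω.IsPositive) (htr : etr ω ≠ ⊤)
    {A' B' H' R' : ℕ → Hilb.{u}} [∀ n, FiniteDimensional ℂ (A' n)]
    [∀ n, FiniteDimensional ℂ (B' n)] {κ' : ℕ → Type u} {V' : ∀ n, κ' n → (A' n ⊠ B' n) →L[ℂ] H' n}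
    {L' : ∀ n, A' n → B' n → R' n →L[ℂ] H' n} {r' : ∀ n, HilbertBasis (κ' n) ℂ (R' n)}
    (hV' : ∀ n, IsSliced (V' n) (L' n) (r' n)) (J : ∀ n, A' n →L[ℂ] A) (M : ∀ n, B' n →L[ℂ] B)
    (U : ∀ n, H →L[ℂ] H' n) (ι : ∀ n, R' n →L[ℂ] R) (hJ : ∀ n, (J n)† ∘L J n = .id ℂ (A' n))
    (hM : ∀ n, (M n)† ∘L M n = .id ℂ (B' n)) (hU : ∀ n, ‖U n‖ ≤ 1)
    (hι : ∀ n, (ι n)† ∘L ι n = .id ℂ (R' n))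
    (hU1 : ∀ x, Tendsto (fun n => ((U n)† ∘L U n) x) atTop (𝓝 x))
    (hL : ∀ n a b, L' n ((J n)† a) ((M n)† b) ∘L (ι n)† = U n ∘L L a b) :
    univExt E A B (ptrace V ω) ≤
      liminf (fun n => homExt (E (A' n) (B' n)) (ptrace (V' n) (cj (U n) ω))) atTop := by
  have hfin : ∀ n, etr (cj (U n) ω) ≠ ⊤ := fun n => etr_ne_top_of_le (etr_cj_le hω (hU n)) htr
  have hpos : ∀ n, (ptrace (V' n) (cj (U n) ω)).IsPositive := fun n =>
    ptrace_isPositive (hV' n).parseval (cj_isPositive _ hω) (hfin n)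
  have heq : ∀ n, homExt (E (A' n) (B' n)) (ptrace (V' n) (cj (U n) ω)) =
      univExt E A B (cj (tmap (J n) (M n)) (ptrace (V' n) (cj (U n) ω))) := fun n =>
    (hE.univExt_cj_eq (hJ n) (hM n) (hpos n)).symm
  simp only [heq]
  refine univExt_le_liminf_of_quadratic hc (fun n => cj_isPositive _ (hpos n))
    (ptrace_isPositive hV.parseval hω htr) fun a b a' b' c => ?_
  rw [hV.ofReal_inner hω htr]
  -- The isometry `ι n` moves the trace from the truncated discarded system to the full one, where
  -- `hL` leaves only the factor `U_n† U_n`, tending strongly to 1.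
  have key : ∀ n, ENNReal.ofReal (⟪tmk a b + c • tmk a' b',
      cj (tmap (J n) (M n)) (ptrace (V' n) (cj (U n) ω)) (tmk a b + c • tmk a' b')⟫_ℂ).re =
      etr (cj ((L a b + c • L a' b')† ∘L ((U n)† ∘L U n)) ω) := fun n => by
    rw [inner_cj, tmap_adjoint, map_add, map_smul, tmap_tmk, tmap_tmk,
      (hV' n).ofReal_inner (cj_isPositive _ hω) (hfin n),
      ← etr_cj_isometry (cj_isPositive _ (cj_isPositive _ hω)) (norm_of_adjoint_comp (hι n)),
      cj_cj, cj_cj]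
    congr 2
    have h1 : (U n)† ∘L ((L' n ((J n)† a) ((M n)† b) + c • L' n ((J n)† a') ((M n)† b')) ∘L (ι n)†) =
        ((U n)† ∘L U n) ∘L (L a b + c • L a' b') := by
      rw [add_comp, smul_comp, hL, hL, comp_assoc, comp_add (U n), comp_smul (U n)]
    have h2 := congrArg adjoint h1
    rw [adjoint_comp, adjoint_comp, adjoint_adjoint, adjoint_adjoint, adjoint_comp, adjoint_comp,
      adjoint_adjoint] at h2
    exact h2
  simp only [key]
  refine tendsto_etr_cj hω htr _ _ (C := ‖(L a b + c • L a' b')†‖ * 1) (fun n => ?_) fun x => ?_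
  · refine (opNorm_comp_le _ _).trans (mul_le_mul_of_nonneg_left ?_ (norm_nonneg _))
    exact (opNorm_comp_le _ _).trans (mul_le_one₀ (norm_adjoint_le_one (hU n)) (norm_nonneg _) (hU n))
  · exact ((L a b + c • L a' b')†.continuous.tendsto x).comp (hU1 x)

theorem ptrace_real_smul {K : Hilb.{u}} (V : κ → K →L[ℂ] H) (c : ℝ) (ω : Op H) :
    ptrace V (c • ω) = c • ptrace V ω := by
  simp only [ptrace, cj_adjoint_eq, cj_real_smul]
  exact tsum_const_smul'' c

theorem homExt_ptrace_add_le {K K' : Hilb.{u}} {κ' : Type u} {V : κ → K →L[ℂ] H}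
    {V' : κ' → K' →L[ℂ] H} (hV : ∀ z, ∑' k, ‖(V k)† z‖ₑ ^ 2 = ‖z‖ₑ ^ 2)
    (hV' : ∀ z, ∑' k, ‖(V' k)† z‖ₑ ^ 2 = ‖z‖ₑ ^ 2) {F : Op K → ℝ≥0∞} {F' : Op K' → ℝ≥0∞}
    {G : Op H → ℝ≥0∞} (h : ∀ ω ∈ states H, F (ptrace V ω) + F' (ptrace V' ω) ≤ G ω) {ω : Op H}
    (hω : ω.IsPositive) (htr : etr ω ≠ ⊤) :
    homExt F (ptrace V ω) + homExt F' (ptrace V' ω) ≤ homExt G ω := by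
  rw [homExt, homExt, homExt, etr_ptrace hV hω htr, etr_ptrace hV' hω htr, ← mul_add,
    ← ptrace_real_smul, ← ptrace_real_smul]
  by_cases h0 : etr ω = 0
  · rw [h0, zero_mul, zero_mul]
  · exact mul_le_mul_right (h _ (normalize_mem_states hω h0 htr)) _

end Slices

/-! ### The concrete marginals, and EM7 and EM8 of the extension -/

section Marginals

variable {A A' B B' C : Hilb.{u}}

theorem tsum_enorm_tmap_prod {K K' L L' : Hilb.{u}} {κ κ' : Type*} (V : κ → K →L[ℂ] K')
    (W : κ' → L →L[ℂ] L') (hV : ∀ x, ∑' k, ‖V k x‖ₑ ^ 2 = ‖x‖ₑ ^ 2)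
    (hW : ∀ x, ∑' k, ‖W k x‖ₑ ^ 2 = ‖x‖ₑ ^ 2) (z : K ⊠ L) :
    ∑' k : κ × κ', ‖tmap (V k.1) (W k.2) z‖ₑ ^ 2 = ‖z‖ₑ ^ 2 := by
  rw [ENNReal.tsum_prod', ← tsum_enorm_tmap_left V hV z]
  refine tsum_congr fun i => ?_
  rw [← tsum_enorm_tmap_right W hW]
  refine tsum_congr fun j => ?_
  rw [tmap_comp_apply]
  rfl

theorem isSliced_margAB : IsSliced (fun k : OnbIdx A' × OnbIdx B' =>
    tmap (inR A (onb A' k.1)) (inR B (onb B' k.2))) (fun a b => tmap (inL a A') (inL b B'))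
    (prodBasis (onb A') (onb B')) where
  parseval z := by
    refine (tsum_congr fun k => by rw [tmap_adjoint]).trans ?_
    exact tsum_enorm_tmap_prod _ _ tsum_slice_left tsum_slice_left z
  apply k a b := by
    rw [prodBasis_apply, tmap_tmk, tmap_tmk]; rfl

theorem isSliced_margA'B' : IsSliced (fun k : OnbIdx A × OnbIdx B =>
    tmap (inL (onb A k.1) A') (inL (onb B k.2) B')) (fun a b => tmap (inR A a) (inR B b))
    (prodBasis (onb A) (onb B)) where
  parseval z := by
    refine (tsum_congr fun k => by rw [tmap_adjoint]).trans ?_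
    exact tsum_enorm_tmap_prod _ _ tsum_slice_right tsum_slice_right z
  apply k a b := by
    rw [prodBasis_apply, tmap_tmk, tmap_tmk]; rfl

theorem isSliced_traceOutC : IsSliced (fun k => tmap (.id ℂ A) (inR B (onb C k)))
    (fun a b => inL a (B ⊠ C) ∘L inL b C) (onb C) where
  parseval z := by
    refine (tsum_congr fun k => by rw [tmap_adjoint, id_adjoint]).trans ?_
    exact tsum_enorm_tmap_right _ tsum_slice_left z
  apply k a b := by
    rw [tmap_tmk]; rfl

theorem isSliced_traceOutB : IsSliced (fun k => tmap (.id ℂ A) (inL (onb B k) C))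
    (fun a c => inL a (B ⊠ C) ∘L inR B c) (onb B) where
  parseval z := by
    refine (tsum_congr fun k => by rw [tmap_adjoint, id_adjoint]).trans ?_
    exact tsum_enorm_tmap_right _ tsum_slice_right z
  apply k a b := by
    rw [tmap_tmk]; rfl

theorem tmap_comp_inL {K K' : Hilb.{u}} (V : A →L[ℂ] K) (V' : A' →L[ℂ] K') (a : A) :
    tmap V V' ∘L inL a A' = inL (V a) K' ∘L V' := by
  ext x
  exact tmap_tmk V V' a x

theorem tmap_comp_inR {K K' : Hilb.{u}} (V : A →L[ℂ] K) (V' : A' →L[ℂ] K') (a : A') :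
    tmap V V' ∘L inR A a = inR K (V' a) ∘L V := by
  ext x
  exact tmap_tmk V V' x a

theorem tendsto_tmap_adjoint_comp {K L : ℕ → Hilb.{u}} {V : ∀ n, A →L[ℂ] K n}
    {W : ∀ n, B →L[ℂ] L n} (hV : ∀ n, ‖V n‖ ≤ 1) (hW : ∀ n, ‖W n‖ ≤ 1)
    (hV1 : ∀ x, Tendsto (fun n => ((V n)† ∘L V n) x) atTop (𝓝 x))
    (hW1 : ∀ x, Tendsto (fun n => ((W n)† ∘L W n) x) atTop (𝓝 x)) (z : A ⊠ B) :
    Tendsto (fun n => ((tmap (V n) (W n))† ∘L tmap (V n) (W n)) z) atTop (𝓝 z) := by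
  have hnorm : ∀ {X Y : Hilb.{u}} {U : X →L[ℂ] Y}, ‖U‖ ≤ 1 → ‖U† ∘L U‖ ≤ 1 := fun hU =>
    (opNorm_comp_le _ _).trans (mul_le_one₀ (norm_adjoint_le_one hU) (norm_nonneg _) hU)
  have := tendsto_tmap (fun n => (V n)† ∘L V n) (.id ℂ A) (fun n => (W n)† ∘L W n) (.id ℂ B)
    (fun n => hnorm (hV n)) (fun n => hnorm (hW n)) hV1 hW1 z
  rw [tmap_id] at this
  refine this.congr fun n => ?_
  rw [tmap_adjoint, tmap_comp]

theorem tendsto_incl {P : ℕ → FinProj A} (hP : TendstoId P) (x : A) :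
    Tendsto (fun n => (((P n).incl†)† ∘L (P n).incl†) x) atTop (𝓝 x) := by
  refine (hP x).congr fun n => ?_
  rw [adjoint_adjoint, FinProj.incl_comp_adjoint]

variable {E : EntFun.{u}}

/-- Lower limits are suprema of the increasing sequences of tail infima, and such suprema add. -/
theorem le_of_le_liminf_add {a b c : ℝ≥0∞} {f g : ℕ → ℝ≥0∞} (hf : a ≤ liminf f atTop)
    (hg : b ≤ liminf g atTop) (h : ∀ n, f n + g n ≤ c) : a + b ≤ c := by
  refine (add_le_add hf hg).trans ?_
  rw [liminf_eq_iSup_iInf_of_nat, liminf_eq_iSup_iInf_of_nat, ENNReal.iSup_add_iSup_of_monotone]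
  · exact iSup_le fun n => (add_le_add (iInf₂_le n le_rfl) (iInf₂_le n le_rfl)).trans (h n)
  · exact fun m n hmn => biInf_mono fun i hi => hmn.trans hi
  · exact fun m n hmn => biInf_mono fun i hi => hmn.trans hi

theorem IsMonotone.univExt_em7 (hE : IsMonotone FinDim E) (hc : ContFin E) (h : EM7 FinDim E) :
    EM7 Sep (univExt E) := by
  intro A A' B B' hA hA' hB hB' ω hω
  have htr : etr ω ≠ ⊤ := by rw [hω.2]; simp
  obtain ⟨P, hP⟩ := exists_tendstoId hA
  obtain ⟨P', hP'⟩ := exists_tendstoId hA'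
  obtain ⟨Q, hQ⟩ := exists_tendstoId hB
  obtain ⟨Q', hQ'⟩ := exists_tendstoId hB'
  set U := fun n => tmap (tmap (P n).incl† (P' n).incl†) (tmap (Q n).incl† (Q' n).incl†) with hUdef
  have hU : ∀ n, ‖U n‖ ≤ 1 := fun n =>
    norm_tmap_le_one (norm_incl_tensor _ _) (norm_incl_tensor _ _)
  have hU1 : ∀ x, Tendsto (fun n => ((U n)† ∘L U n) x) atTop (𝓝 x) :=
    tendsto_tmap_adjoint_comp (fun n => norm_incl_tensor _ _) (fun n => norm_incl_tensor _ _)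
      (tendsto_incl_tensor hP hP') (tendsto_incl_tensor hQ hQ')
  refine le_of_le_liminf_add
    (hE.univExt_ptrace_le_liminf hc isSliced_margAB hω.1 htr (fun n => isSliced_margAB)
      (fun n => (P n).incl) (fun n => (Q n).incl) U (fun n => tmap (P' n).incl (Q' n).incl)
      (fun n => (P n).incl_isometry) (fun n => (Q n).incl_isometry) hU
      (fun n => norm_tmap_isometry (P' n).incl_isometry (Q' n).incl_isometry) hU1 fun n a b => ?_)
    (hE.univExt_ptrace_le_liminf hc isSliced_margA'B' hω.1 htr (fun n => isSliced_margA'B')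
      (fun n => (P' n).incl) (fun n => (Q' n).incl) U (fun n => tmap (P n).incl (Q n).incl)
      (fun n => (P' n).incl_isometry) (fun n => (Q' n).incl_isometry) hU
      (fun n => norm_tmap_isometry (P n).incl_isometry (Q n).incl_isometry) hU1 fun n a b => ?_)
    fun n => ?_
  · rw [hUdef, tmap_adjoint, tmap_comp, tmap_comp, tmap_comp_inL, tmap_comp_inL]
  · rw [hUdef, tmap_adjoint, tmap_comp, tmap_comp, tmap_comp_inR, tmap_comp_inR]
  -- Superadditivity of `E` at each truncated state, whose value is bounded by the extension at `ω`.
  · refine (homExt_ptrace_add_le isSliced_margAB.parseval isSliced_margA'B'.parseval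
      (h _ _ _ _ (P n).finDim (P' n).finDim (Q n).finDim (Q' n).finDim)
      (cj_isPositive (U n) hω.1) (etr_ne_top_of_le (etr_cj_le hω.1 (hU n)) htr)).trans ?_
    exact hE.homExt_cj_le_univExt (norm_incl_tensor _ _) (norm_incl_tensor _ _) hω.1

theorem IsMonotone.univExt_em8 (hE : IsMonotone FinDim E) (hc : ContFin E) (h : EM8 FinDim E) :
    EM8 Sep (univExt E) := by
  intro A B C hA hB hC ω hω
  have htr : etr ω ≠ ⊤ := by rw [hω.2]; simp
  obtain ⟨P, hP⟩ := exists_tendstoId hA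
  obtain ⟨Q, hQ⟩ := exists_tendstoId hB
  obtain ⟨R, hR⟩ := exists_tendstoId hC
  set U := fun n => tmap (P n).incl† (tmap (Q n).incl† (R n).incl†) with hUdef
  have hP1 : ∀ n, ‖(P n).incl†‖ ≤ 1 := fun n => norm_adjoint_le_one (P n).norm_incl
  have hU : ∀ n, ‖U n‖ ≤ 1 := fun n => norm_tmap_le_one (hP1 n) (norm_incl_tensor _ _)
  have hU1 : ∀ x, Tendsto (fun n => ((U n)† ∘L U n) x) atTop (𝓝 x) :=
    tendsto_tmap_adjoint_comp hP1 (fun n => norm_incl_tensor _ _) (tendsto_incl hP)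
      (tendsto_incl_tensor hQ hR)
  refine le_of_le_liminf_add
    (hE.univExt_ptrace_le_liminf hc isSliced_traceOutC hω.1 htr (fun n => isSliced_traceOutC)
      (fun n => (P n).incl) (fun n => (Q n).incl) U (fun n => (R n).incl)
      (fun n => (P n).incl_isometry) (fun n => (Q n).incl_isometry) hU
      (fun n => (R n).incl_isometry) hU1 fun n a b => ?_)
    (hE.univExt_ptrace_le_liminf hc isSliced_traceOutB hω.1 htr (fun n => isSliced_traceOutB)
      (fun n => (P n).incl) (fun n => (R n).incl) U (fun n => (Q n).incl)
      (fun n => (P n).incl_isometry) (fun n => (R n).incl_isometry) hU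
      (fun n => (Q n).incl_isometry) hU1 fun n a b => ?_)
    fun n => ?_
  · rw [hUdef, ← comp_assoc, tmap_comp_inL, comp_assoc, comp_assoc, tmap_comp_inL]
  · rw [hUdef, ← comp_assoc, tmap_comp_inL, comp_assoc, comp_assoc, tmap_comp_inR]
  · refine (homExt_ptrace_add_le isSliced_traceOutC.parseval isSliced_traceOutB.parseval
      (h _ _ _ (P n).finDim (Q n).finDim (R n).finDim)
      (cj_isPositive (U n) hω.1) (etr_ne_top_of_le (etr_cj_le hω.1 (hU n)) htr)).trans ?_
    exact hE.homExt_cj_le_univExt (hP1 n) (norm_incl_tensor _ _) hω.1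

end Marginals

/-! ### Entropy of trace class operators -/

section Eigenbasis

variable {H K : Hilb.{u}}

/-- An eigenvalue lies in the spectrum. The set of continuous functions for which the claim holds is
a closed subalgebra containing the identity function, hence everything. -/
theorem cfc_apply_eigenvector {T : Op H} (hT : IsSelfAdjoint T) {x : H} {l : ℝ} (hx : x ≠ 0)
    (h : T x = (l : ℂ) • x) (f : ℝ → ℝ) (hf : Continuous f) : cfc f T x = (f l : ℂ) • x := by
  have hl : l ∈ spectrum ℝ T := by
    rw [spectrum.mem_iff]
    rintro ⟨v, hv⟩
    have h1 : (v : Op H) x = 0 := by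
      rw [hv, _root_.sub_apply, h, sub_eq_zero, Algebra.algebraMap_eq_smul_one, _root_.smul_apply,
        one_apply_eq_self, Complex.coe_smul]
    have h2 : (↑v⁻¹ * (v : Op H)) x = x := by rw [Units.inv_mul, one_apply_eq_self]
    rw [mul_apply_eq_comp, h1, map_zero] at h2
    exact hx h2.symm
  have key : ∀ g : C(spectrum ℝ T, ℝ), cfcHom hT g x = (g ⟨l, hl⟩ : ℂ) • x := by
    intro g
    induction g using ContinuousMap.induction_on_of_compact with
    | const r =>
      have : cfcHom hT (.const _ r) = algebraMap ℝ (Op H) r := AlgHomClass.commutes (cfcHom hT) r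
      rw [this, Algebra.algebraMap_eq_smul_one, _root_.smul_apply, one_apply_eq_self,
        ContinuousMap.const_apply, Complex.coe_smul]
    | id => rw [cfcHom_id hT, h]; rfl
    | star_id => rw [map_star, cfcHom_id hT, hT.star_eq, h]; rfl
    | add f g hf hg =>
      rw [map_add, _root_.add_apply, hf, hg, ← add_smul, ContinuousMap.add_apply, Complex.ofReal_add]
    | mul f g hf hg =>
      rw [map_mul, mul_apply_eq_comp, hg, map_smul, hf, smul_smul, ContinuousMap.mul_apply,
        Complex.ofReal_mul, mul_comm]
    | frequently f h =>
      refine h.mem_of_closed (isClosed_eq ?_ ?_)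
      · exact (ContinuousLinearMap.apply ℂ H x).continuous.comp (cfcHom_continuous hT)
      · exact (Complex.continuous_ofReal.comp (continuous_eval_const _)).smul
          continuous_const
  rw [cfc_apply f T hT hf.continuousOn, key]
  rfl

/-- `e` diagonalizes `T` with eigenvalues `l`. -/
def IsEigenbasis {ι : Type*} (T : Op H) (e : HilbertBasis ι ℂ H) (l : ι → ℝ) : Prop :=
  ∀ i, T (e i) = (l i : ℂ) • e i

theorem inner_hilbertBasis_self {ι : Type*} (e : HilbertBasis ι ℂ H) (i : ι) :
    ⟪e i, e i⟫_ℂ = 1 := by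
  rw [inner_self_eq_norm_sq_to_K, e.orthonormal.1 i]
  simp

theorem IsEigenbasis.inner {ι : Type*} {T : Op H} {e : HilbertBasis ι ℂ H} {l : ι → ℝ}
    (h : IsEigenbasis T e l) (i : ι) : ⟪e i, T (e i)⟫_ℂ = l i := by
  rw [h, inner_smul_right, inner_hilbertBasis_self, mul_one]

theorem IsEigenbasis.etr {ι : Type*} {T : Op H} {e : HilbertBasis ι ℂ H} {l : ι → ℝ}
    (h : IsEigenbasis T e l) (hT : T.IsPositive) :
    Entanglement.etr T = ∑' i, ENNReal.ofReal (l i) := by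
  rw [etr_eq_tsum hT e]
  simp only [h.inner, Complex.ofReal_re]

theorem IsEigenbasis.nonneg {ι : Type*} {T : Op H} {e : HilbertBasis ι ℂ H} {l : ι → ℝ}
    (h : IsEigenbasis T e l) (hT : T.IsPositive) (i : ι) : 0 ≤ l i := by
  have := inner_nonneg hT (e i)
  rw [h.inner] at this
  exact Complex.zero_le_real.1 this

theorem IsEigenbasis.le_etr {ι : Type*} {T : Op H} {e : HilbertBasis ι ℂ H} {l : ι → ℝ}
    (h : IsEigenbasis T e l) (hT : T.IsPositive) (i : ι) :
    ENNReal.ofReal (l i) ≤ Entanglement.etr T := by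
  rw [h.etr hT]
  exact ENNReal.le_tsum i

theorem IsEigenbasis.real_smul {ι : Type*} {T : Op H} {e : HilbertBasis ι ℂ H} {l : ι → ℝ}
    (h : IsEigenbasis T e l) (c : ℝ) : IsEigenbasis (c • T) e fun i => c * l i := fun i => by
  rw [_root_.smul_apply, h, ← Complex.coe_smul, smul_smul, Complex.ofReal_mul]

/-- On `[0, 1]` the function `-x log x` is nonnegative, so the operator in the definition of the
entropy is positive and its trace may be computed in any basis. -/
theorem spectrum_subset_of_state {T : Op H} (hT : T ∈ states H) {x : ℝ} (hx : x ∈ spectrum ℝ T) :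
    0 ≤ x ∧ x ≤ 1 := by
  have h0 : (0 : Op H) ≤ T := (nonneg_iff_isPositive T).2 hT.1
  refine ⟨spectrum_nonneg_of_nonneg h0 hx, ?_⟩
  have hne : traceNorm T ≠ ⊤ := by rw [traceNorm_eq_etr hT.1, hT.2]; simp
  have h1 : ‖T‖ ≤ 1 := by
    have := norm_le_traceNorm hne
    rwa [traceNorm_eq_etr hT.1, hT.2, ENNReal.toReal_one] at this
  have h2 : Nontrivial H := by
    by_contra hn
    rw [not_nontrivial_iff_subsingleton] at hn
    have : T = 0 := Subsingleton.elim _ _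
    have h3 := hT.2
    rw [this, etr_zero] at h3
    exact zero_ne_one h3
  exact ((Real.le_norm_self x).trans (spectrum.norm_le_norm_of_mem hx)).trans h1

theorem IsEigenbasis.entropy_eq {ι : Type*} {T : Op H} {e : HilbertBasis ι ℂ H} {l : ι → ℝ}
    (h : IsEigenbasis T e l) (hT : T ∈ states H) :
    entropy T = ∑' i, ENNReal.ofReal (Real.negMulLog (l i)) := by
  have hpos : (cfc Real.negMulLog T).IsPositive := by
    rw [← nonneg_iff_isPositive]
    refine cfc_nonneg fun x hx => ?_
    obtain ⟨h0, h1⟩ := spectrum_subset_of_state hT hx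
    exact Real.negMulLog_nonneg h0 h1
  have h2 : IsEigenbasis (cfc Real.negMulLog T) e fun i => Real.negMulLog (l i) := fun i =>
    cfc_apply_eigenvector hT.1.isSelfAdjoint (e.orthonormal.ne_zero i) (h i) _
      Real.continuous_negMulLog
  exact h2.etr hpos

/-- Finite rank truncations converge in trace norm, hence in operator norm. -/
theorem isCompactOperator_of_etr (hH : Sep H) {T : Op H} (hT : T.IsPositive) (htr : etr T ≠ ⊤) :
    IsCompactOperator T := by
  obtain ⟨P, hP⟩ := exists_tendstoId hH
  have hlim := tendstoTr_trunc hT htr (fun n => (P n).op) (fun n => (P n).op_adjoint)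
    (fun n => (P n).norm_op) (fun n => one_sub_norm_le (P n).op_adjoint (P n).op_comp) hP
  refine isCompactOperator_of_tendsto (F := fun n => cj (P n).op T) (l := atTop) ?_
    (Eventually.of_forall fun n => ?_)
  · rw [tendsto_iff_norm_sub_tendsto_zero]
    have h2 := (ENNReal.tendsto_toReal ENNReal.zero_ne_top).comp hlim
    refine squeeze_zero (fun _ => norm_nonneg _) (fun n => norm_le_traceNorm ?_) h2
    have h3 : cj (P n).op T ∈ TC H := mem_TC_of_etr (cj_isPositive _ hT)
      (etr_ne_top_of_le (etr_cj_le hT (P n).norm_op) htr)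
    exact (mem_TC.1 ((TC H).sub_mem h3 (mem_TC_of_etr hT htr))).ne
  · have h4 : IsCompactOperator (P n).incl := isCompactOperator_of_locallyCompactSpace_rng _
    have h5 := h4.comp_clm ((P n).incl† ∘L (T ∘L (P n).op†))
    rw [cj, ← FinProj.incl_comp_adjoint]
    rw [← FinProj.incl_comp_adjoint] at h5
    exact h5

theorem exists_isEigenbasis (hH : Sep H) {T : Op H} (hT : T.IsPositive) (htr : etr T ≠ ⊤) :
    ∃ (ι : Type u) (e : HilbertBasis ι ℂ H) (l : ι → ℝ), IsEigenbasis T e l := by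
  have hc := isCompactOperator_of_etr hH hT htr
  have hs : (T : H →ₗ[ℂ] H).IsSymmetric := hT.isSymmetric
  have hbot := orthogonalComplement_iSup_eigenspaces_eq_bot hc hs
  set G := fun μ : ℂ => Module.End.eigenspace (T : H →ₗ[ℂ] H) μ with hG
  have hmem : ∀ {μ : ℂ} {x : H}, x ∈ G μ ↔ T x = μ • x := fun {μ x} =>
    Module.End.mem_eigenspace_iff
  -- Closed eigenspaces have Hilbert bases; glued over all `μ` they are orthonormal, and total by
  -- the spectral theorem for compact symmetric operators.
  have hcomplete : ∀ μ, CompleteSpace (G μ) := fun μ => by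
    have : (G μ : Set H) = {x | T x = μ • x} := Set.ext fun x => hmem
    have hcl : IsClosed (G μ : Set H) := by
      rw [this]
      exact isClosed_eq T.continuous (continuous_const_smul μ)
    exact hcl.completeSpace_coe
  choose w b hb using fun μ => exists_hilbertBasis ℂ (G μ)
  have hon := hs.orthogonalFamily_eigenspaces.orthonormal_sigma_orthonormal
    (v_family := fun μ => b μ) fun μ => (b μ).orthonormal
  set v : (Σ μ, w μ) → H := fun a => (b a.1 a.2 : H) with hv
  have horth : (Submodule.span ℂ (Set.range v))ᗮ = ⊥ := by
    rw [eq_bot_iff, ← hbot]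
    intro x hx
    rw [Submodule.mem_orthogonal'] at hx ⊢
    intro y hy
    have h1 : ∀ μ, G μ ≤ LinearMap.ker (innerSL ℂ x : H →ₗ[ℂ] ℂ) := fun μ y hy => by
      have h2 : (innerSL ℂ x) ∘L (G μ).subtypeL = 0 := eq_zero_of_hilbertBasis (b μ) fun i =>
        hx _ (Submodule.subset_span ⟨⟨μ, i⟩, rfl⟩)
      exact congrArg (fun f => f ⟨y, hy⟩) h2
    exact iSup_le h1 hy
  -- Taking real parts of the eigenvalues is harmless: positivity of `T` makes them real.
  refine ⟨_, HilbertBasis.mkOfOrthogonalEqBot hon horth, fun i => i.1.re, fun i => ?_⟩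
  have h1 : HilbertBasis.mkOfOrthogonalEqBot hon horth i = v i :=
    congrFun (HilbertBasis.coe_mkOfOrthogonalEqBot hon horth) i
  have h2 : T (v i) = i.1 • v i := hmem.1 (b i.1 i.2).2
  have h3 := inner_nonneg hT (v i)
  have h4 : ‖v i‖ = 1 := hon.1 i
  rw [h2, inner_smul_right, inner_self_eq_norm_sq_to_K, h4] at h3
  rw [h1, h2]
  congr 1
  have h5 := Complex.le_def.1 h3
  simp at h5
  exact Complex.ext (by simp) (by simp [h5.2])

end Eigenbasis

/-! ### Entropy along spectral truncations -/

section Truncation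

variable {H K : Hilb.{u}} {ι : Type*}

/-- The part of a Hilbert basis in the span of finitely many of its vectors. -/
def spanVec (e : HilbertBasis ι ℂ H) (s : Finset ι) (i : s) : (spanProj e s).space :=
  ⟨e i, Submodule.subset_span ⟨i, i.2, rfl⟩⟩

theorem orthonormal_spanVec (e : HilbertBasis ι ℂ H) (s : Finset ι) :
    Orthonormal ℂ (spanVec e s) :=
  (LinearIsometry.orthonormal_comp_iff (spanProj e s).1.subtypeₗᵢ).1
    (e.orthonormal.comp (fun i : s => (i : ι)) Subtype.val_injective)

theorem orthogonal_spanVec (e : HilbertBasis ι ℂ H) (s : Finset ι) :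
    (Submodule.span ℂ (Set.range (spanVec e s)))ᗮ = ⊥ := by
  rw [eq_bot_iff]
  intro x hx
  rw [Submodule.mem_orthogonal'] at hx
  have h1 : (spanProj e s).1 ≤ LinearMap.ker (innerSL ℂ (x : H) : H →ₗ[ℂ] ℂ) := by
    refine Submodule.span_le.2 ?_
    rintro _ ⟨i, hi, rfl⟩
    exact hx _ (Submodule.subset_span ⟨⟨i, hi⟩, rfl⟩)
  have h2 : ⟪(x : H), (x : H)⟫_ℂ = 0 := h1 x.2
  exact Subtype.ext (inner_self_eq_zero.1 h2)

/-- The Hilbert basis of the span of finitely many vectors of a Hilbert basis. -/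
def spanBasis (e : HilbertBasis ι ℂ H) (s : Finset ι) :
    HilbertBasis s ℂ (spanProj e s).space :=
  HilbertBasis.mkOfOrthogonalEqBot (orthonormal_spanVec e s) (orthogonal_spanVec e s)

theorem incl_spanBasis (e : HilbertBasis ι ℂ H) (s : Finset ι) (i : s) :
    (spanProj e s).incl (spanBasis e s i) = e i := by
  have : spanBasis e s i = spanVec e s i := congrFun (HilbertBasis.coe_mkOfOrthogonalEqBot _ _) i
  rw [this]
  rfl

theorem IsEigenbasis.trunc {T : Op H} {e : HilbertBasis ι ℂ H} {l : ι → ℝ}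
    (h : IsEigenbasis T e l) (s : Finset ι) :
    IsEigenbasis (cj (spanProj e s).incl† T) (spanBasis e s) fun i => l i := fun i => by
  rw [cj_apply, adjoint_adjoint, incl_spanBasis, h, map_smul, ← incl_spanBasis e s i]
  exact congrArg _ (congrArg (fun f => f (spanBasis e s i)) (spanProj e s).incl_isometry)

/-- With `η(x) = -x log x` and `t` the trace, `η(t s) = s η(t) + t η(s)` is applied to `s = l_i / t`
and summed. Trace at most 1 keeps all terms nonnegative, so passing to `[0, ∞]` loses nothing. -/
theorem IsEigenbasis.tsum_negMulLog {T : Op H} {e : HilbertBasis ι ℂ H} {l : ι → ℝ}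
    (h : IsEigenbasis T e l) (hT : T.IsPositive) (htr : Entanglement.etr T ≤ 1) :
    ∑' i, ENNReal.ofReal (Real.negMulLog (l i)) =
      homExt entropy T + ENNReal.ofReal (Real.negMulLog (Entanglement.etr T).toReal) := by
  have hfin : Entanglement.etr T ≠ ⊤ := (htr.trans_lt ENNReal.one_lt_top).ne
  by_cases h0 : Entanglement.etr T = 0
  · have hl : ∀ i, l i = 0 := fun i => by
      have := h.le_etr hT i
      rw [h0, nonpos_iff_eq_zero, ENNReal.ofReal_eq_zero] at this
      exact le_antisymm this (h.nonneg hT i)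
    simp [hl, h0, homExt_of_etr_eq_zero]
  set t := (Entanglement.etr T).toReal with ht
  have htpos : 0 < t := ENNReal.toReal_pos h0 hfin
  have ht1 : t ≤ 1 := by
    have := ENNReal.toReal_mono ENNReal.one_ne_top htr
    rwa [ENNReal.toReal_one] at this
  have het : Entanglement.etr T = ENNReal.ofReal t := (ENNReal.ofReal_toReal hfin).symm
  have hlt : ∀ i, l i ≤ t := fun i => by
    have := h.le_etr hT i
    rw [het] at this
    exact (ENNReal.ofReal_le_ofReal_iff htpos.le).1 this
  have hη : 0 ≤ Real.negMulLog t := Real.negMulLog_nonneg htpos.le ht1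
  have hpt : ∀ i, ENNReal.ofReal (Real.negMulLog (l i)) =
      Entanglement.etr T * ENNReal.ofReal (Real.negMulLog (t⁻¹ * l i)) +
        ENNReal.ofReal (t⁻¹ * Real.negMulLog t) * ENNReal.ofReal (l i) := fun i => by
    have h1 : 0 ≤ t⁻¹ * l i := mul_nonneg (inv_nonneg.2 htpos.le) (h.nonneg hT i)
    have h2 : t⁻¹ * l i ≤ 1 := by
      rw [inv_mul_le_iff₀ htpos, mul_one]; exact hlt i
    have h3 := Real.negMulLog_nonneg h1 h2
    rw [het, ← ENNReal.ofReal_mul htpos.le, ← ENNReal.ofReal_mul (by positivity),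
      ← ENNReal.ofReal_add (by positivity) (mul_nonneg (by positivity) (h.nonneg hT i))]
    congr 1
    have h4 := Real.negMulLog_mul t (t⁻¹ * l i)
    rw [← mul_assoc, mul_inv_cancel₀ htpos.ne', one_mul] at h4
    rw [h4]; ring
  simp only [hpt]
  rw [ENNReal.tsum_add, ENNReal.tsum_mul_left, ENNReal.tsum_mul_left, ← h.etr hT, homExt,
    (h.real_smul t⁻¹).entropy_eq (normalize_mem_states hT h0 hfin)]
  congr 1
  rw [het, ← ENNReal.ofReal_mul (by positivity)]
  congr 1
  field_simp

/-- The homogenized entropy of a spectral truncation differs from a partial sum of `∑ η(l_i)` by `η`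
of the truncated trace, which tends to `η(1) = 0`. -/
theorem IsEigenbasis.tendsto_entropy {T : Op H} {e : HilbertBasis ι ℂ H} {l : ι → ℝ}
    (h : IsEigenbasis T e l) (hT : T ∈ states H) {s : ℕ → Finset ι} (hs : Tendsto s atTop atTop)
    {a : ℝ≥0∞}
    (ha : Tendsto (fun n => homExt entropy (cj (spanProj e (s n)).incl† T)) atTop (𝓝 a)) :
    a = entropy T := by
  have htr : ∀ n, Entanglement.etr (cj (spanProj e (s n)).incl† T) =
      ∑ i ∈ s n, ENNReal.ofReal (l i) := fun n => by
    rw [(h.trunc (s n)).etr (cj_isPositive _ hT.1), tsum_fintype,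
      Finset.sum_coe_sort (s n) fun i => ENNReal.ofReal (l i)]
  have hle : ∀ n, Entanglement.etr (cj (spanProj e (s n)).incl† T) ≤ 1 := fun n => by
    rw [← hT.2]
    exact etr_cj_le hT.1 (norm_adjoint_le_one (spanProj e (s n)).norm_incl)
  have h1 : Tendsto (fun n => Entanglement.etr (cj (spanProj e (s n)).incl† T)) atTop (𝓝 1) := by
    simp only [htr]
    rw [← hT.2, h.etr hT.1]
    exact ENNReal.summable.hasSum.comp hs
  have h2 : Tendsto (fun n => ENNReal.ofReal (Real.negMulLog
      (Entanglement.etr (cj (spanProj e (s n)).incl† T)).toReal)) atTop (𝓝 0) := by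
    have := ENNReal.tendsto_ofReal ((Real.continuous_negMulLog.tendsto _).comp
      ((ENNReal.tendsto_toReal ENNReal.one_ne_top).comp h1))
    simpa using this
  have h3 := ha.add h2
  rw [add_zero] at h3
  have h4 : Tendsto (fun n => ∑ i ∈ s n, ENNReal.ofReal (Real.negMulLog (l i))) atTop
      (𝓝 (entropy T)) := by
    rw [h.entropy_eq hT]
    exact ENNReal.summable.hasSum.comp hs
  refine tendsto_nhds_unique h3 (h4.congr fun n => ?_)
  rw [← (h.trunc (s n)).tsum_negMulLog (cj_isPositive _ hT.1) (hle n), tsum_fintype,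
    Finset.sum_coe_sort (s n) fun i => ENNReal.ofReal (Real.negMulLog (l i))]

end Truncation

/-! ### Pure states -/

section Pure

variable {H K : Hilb.{u}}

theorem inner_rankOne_right (φ x y : H) :
    ⟪x, (InnerProductSpace.rankOne ℂ φ φ : Op H) y⟫_ℂ = ⟪φ, y⟫_ℂ * ⟪x, φ⟫_ℂ := by
  rw [InnerProductSpace.rankOne_apply, inner_smul_right]

theorem real_smul_rankOne {c : ℝ} (hc : 0 ≤ c) (φ : H) :
    c • (InnerProductSpace.rankOne ℂ φ φ : Op H) =
      InnerProductSpace.rankOne ℂ ((√c : ℂ) • φ) ((√c : ℂ) • φ) := by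
  ext x
  rw [_root_.smul_apply, InnerProductSpace.rankOne_apply, InnerProductSpace.rankOne_apply,
    inner_smul_left, smul_smul, ← Complex.coe_smul, smul_smul, Complex.conj_ofReal]
  congr 1
  have : (√c : ℂ) * √c = c := by rw [← Complex.ofReal_mul, Real.mul_self_sqrt hc]
  rw [← this]; ring

theorem apply_eq_zero_of_inner {T : Op H} (hT : T.IsPositive) {x : H} (h : ⟪x, T x⟫_ℂ = 0) :
    T x = 0 := by
  obtain ⟨S, hS, hSS⟩ := exists_sqrt hT
  rw [inner_of_sqrt hS hSS, inner_self_eq_zero] at h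
  rw [← hSS, comp_apply, h, map_zero]

/-- A self-adjoint operator vanishing on the complement of `φ` is a multiple of the rank one
operator, and the unit trace fixes the factor. -/
theorem eq_rankOne_of_kernel {T : Op H} (hT : T ∈ states H) {φ : H}
    (hφ : (InnerProductSpace.rankOne ℂ φ φ : Op H) ∈ states H)
    (h : ∀ x, ⟪φ, x⟫_ℂ = 0 → T x = 0) : T = InnerProductSpace.rankOne ℂ φ φ := by
  have hφ0 : ⟪φ, φ⟫_ℂ ≠ 0 := fun h0 => by
    rw [inner_self_eq_zero] at h0
    have := hφ.2
    rw [h0] at this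
    simp [etr_zero] at this
  have hsa : ∀ x y, ⟪T x, y⟫_ℂ = ⟪x, T y⟫_ℂ := fun x y => by
    rw [← adjoint_inner_left, hT.1.isSelfAdjoint.adjoint_eq]
  set d : ℂ := ⟪φ, T φ⟫_ℂ / ⟪φ, φ⟫_ℂ with hd
  have h1 : T φ = d • φ := by
    refine ext_inner_left ℂ fun y => ?_
    have h2 := h (y - (⟪φ, y⟫_ℂ / ⟪φ, φ⟫_ℂ) • φ) (by
      rw [inner_sub_right, inner_smul_right, div_mul_cancel₀ _ hφ0, sub_self])
    have h3 : ⟪y - (⟪φ, y⟫_ℂ / ⟪φ, φ⟫_ℂ) • φ, T φ⟫_ℂ = 0 := by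
      rw [← hsa, h2, inner_zero_left]
    rw [inner_sub_left, inner_smul_left, sub_eq_zero, map_div₀, inner_conj_symm, inner_conj_symm]
      at h3
    rw [h3, inner_smul_right, hd]
    ring
  have h4 : ∀ x, T x = (⟪φ, T φ⟫_ℂ / ⟪φ, φ⟫_ℂ ^ 2) • (InnerProductSpace.rankOne ℂ φ φ : Op H) x :=
    fun x => by
    have h2 := h (x - (⟪φ, x⟫_ℂ / ⟪φ, φ⟫_ℂ) • φ) (by
      rw [inner_sub_right, inner_smul_right, div_mul_cancel₀ _ hφ0, sub_self])
    rw [map_sub, map_smul, sub_eq_zero] at h2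
    rw [h2, InnerProductSpace.rankOne_apply, smul_smul]
    conv_lhs => rw [h1, hd, smul_smul]
    congr 1
    field_simp
  have hinn := inner_nonneg hT.1 φ
  have hsq : ⟪φ, φ⟫_ℂ ^ 2 = ((‖φ‖ ^ 4 : ℝ) : ℂ) := by
    rw [inner_self_eq_norm_sq_to_K]; push_cast; ring_nf; rfl
  set c : ℝ := (⟪φ, T φ⟫_ℂ).re / ‖φ‖ ^ 4 with hc
  have hc0 : 0 ≤ c := div_nonneg (Complex.le_def.1 hinn).1 (by positivity)
  have h5 : T = c • (InnerProductSpace.rankOne ℂ φ φ : Op H) := by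
    ext x
    rw [h4, _root_.smul_apply, ← Complex.coe_smul, hsq]
    congr 1
    rw [hc, Complex.ofReal_div]
    congr 1
    exact Complex.ext (by simp) (by simpa using (Complex.le_def.1 hinn).2.symm)
  have h6 := hT.2
  rw [h5, etr_smul hc0, hφ.2, mul_one] at h6
  have h7 : c = 1 := by
    rw [← ENNReal.ofReal_one] at h6
    exact (ENNReal.ofReal_eq_ofReal_iff hc0 zero_le_one).1 h6
  rw [h5, h7, one_smul]

/-- In a convex decomposition the nonnegative quadratic forms of both parts must vanish wherever
their sum does, that is, on the complement of `φ`. -/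
theorem rankOne_mem_pureStates {φ : H}
    (hφ : (InnerProductSpace.rankOne ℂ φ φ : Op H) ∈ states H) :
    (InnerProductSpace.rankOne ℂ φ φ : Op H) ∈ pureStates H := by
  rw [pureStates, mem_extremePoints_iff_left]
  refine ⟨hφ, fun X hX Y hY ⟨a, b, ha, hb, hab, h⟩ => eq_rankOne_of_kernel hX hφ fun x hx => ?_⟩
  have h1 : ⟪x, (a • X + b • Y) x⟫_ℂ = 0 := by
    rw [h, inner_rankOne_right, hx, zero_mul]
  have h2 : ⟪x, (a • X + b • Y) x⟫_ℂ = a * ⟪x, X x⟫_ℂ + b * ⟪x, Y x⟫_ℂ := by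
    rw [_root_.add_apply, inner_add_right, _root_.smul_apply, _root_.smul_apply,
      inner_smul_right_eq_smul, inner_smul_right_eq_smul, Complex.real_smul, Complex.real_smul]
  have hXn := inner_nonneg hX.1 x
  have hYn := inner_nonneg hY.1 x
  have ha' : (0 : ℂ) < a := Complex.zero_lt_real.2 ha
  have hb' : (0 : ℂ) < b := Complex.zero_lt_real.2 hb
  rw [h2] at h1
  have h3 := ((add_eq_zero_iff_of_nonneg (mul_nonneg ha'.le hXn) (mul_nonneg hb'.le hYn)).1 h1).1
  exact apply_eq_zero_of_inner hX.1 ((mul_eq_zero.1 h3).resolve_left ha'.ne')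

/-- With `S` the square root and `P` the projector onto a basis vector `f` such that `S f ≠ 0`,
write `ω = S P S + S (1 - P) S`. The first part is rank one and nonzero; extremality makes it
proportional to `ω`, unless the second part vanishes. -/
theorem exists_eq_rankOne {ω : Op H} (hω : ω ∈ pureStates H) :
    ∃ ψ : H, ω = InnerProductSpace.rankOne ℂ ψ ψ := by
  rw [pureStates, mem_extremePoints_iff_left] at hω
  obtain ⟨hst, hext⟩ := hω
  obtain ⟨S, hS, hSS⟩ := exists_sqrt hst.1
  obtain ⟨i, hi⟩ : ∃ i, S (onb H i) ≠ 0 := by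
    by_contra! hcon
    have := hst.2
    rw [etr_of_sqrt hS hSS (onb H)] at this
    simp [hcon] at this
  set f := onb H i with hf
  have hf1 : ⟪f, f⟫_ℂ = 1 := inner_hilbertBasis_self _ _
  set P : Op H := InnerProductSpace.rankOne ℂ f f with hP
  have hPpos : P.IsPositive := InnerProductSpace.isPositive_rankOne_self f
  have hPP : P ∘L P = P := by
    ext x
    rw [comp_apply, hP, InnerProductSpace.rankOne_apply, InnerProductSpace.rankOne_apply,
      inner_smul_right, hf1, mul_one]
  have hPadj : P† = P := hPpos.isSelfAdjoint.adjoint_eq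
  have hQpos : (1 - P : Op H).IsPositive := by
    have h1 : cj (1 - P) (1 : Op H) = 1 - P := by
      rw [cj, one_sub_adjoint hPadj]
      exact one_sub_comp hPP
    rw [← h1]
    exact cj_isPositive _ isPositive_one
  have hX : (cj S P).IsPositive := cj_isPositive _ hPpos
  have hY : (cj S (1 - P)).IsPositive := cj_isPositive _ hQpos
  have hXr : cj S P = InnerProductSpace.rankOne ℂ (S f) (S f) := cj_rankOne S f f
  have hsum : cj S P + cj S (1 - P) = ω := by
    rw [← cj_add, add_sub_cancel, cj, hS]
    exact hSS
  have htr : etr (cj S P) + etr (cj S (1 - P)) = 1 := by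
    rw [← etr_add hX hY, hsum, hst.2]
  have hXt : etr (cj S P) ≠ ⊤ := ne_top_of_le_ne_top ENNReal.one_ne_top (htr ▸ le_self_add)
  have hYt : etr (cj S (1 - P)) ≠ ⊤ := ne_top_of_le_ne_top ENNReal.one_ne_top (htr ▸ le_add_self)
  have hX0 : etr (cj S P) ≠ 0 := fun h0 => by
    have h1 := eq_zero_of_etr_eq_zero hX h0
    have h2 := congrArg (fun T : Op H => T (S f)) h1
    simp only [hXr, InnerProductSpace.rankOne_apply, _root_.zero_apply] at h2
    exact (smul_ne_zero (inner_self_ne_zero.2 hi) hi) h2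
  by_cases hY0 : etr (cj S (1 - P)) = 0
  · refine ⟨S f, ?_⟩
    rw [← hsum, eq_zero_of_etr_eq_zero hY hY0, add_zero, hXr]
  · have h1 := hext _ (normalize_mem_states hX hX0 hXt) _ (normalize_mem_states hY hY0 hYt)
      ⟨(etr (cj S P)).toReal, (etr (cj S (1 - P))).toReal, ENNReal.toReal_pos hX0 hXt,
        ENNReal.toReal_pos hY0 hYt, by rw [← ENNReal.toReal_add hXt hYt, htr, ENNReal.toReal_one],
        by rw [smul_normalize hX0 hXt, smul_normalize hY0 hYt, hsum]⟩
    have h2 := real_smul_rankOne (c := (etr (cj S P)).toReal⁻¹) (by positivity) (S f)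
    rw [← hXr, h1] at h2
    exact ⟨_, h2⟩

end Pure

/-- A larger projector approximates at least as well: `x - Q x = (1 - Q)(x - S x)`. -/
theorem TendstoId.of_le {H : Hilb.{u}} {S Q : ℕ → FinProj H} (hS : TendstoId S)
    (h : ∀ n, (S n).1 ≤ (Q n).1) : TendstoId Q := by
  intro x
  have h1 := tendsto_iff_norm_sub_tendsto_zero.1 (hS x)
  refine tendsto_iff_norm_sub_tendsto_zero.2 (squeeze_zero (fun _ => norm_nonneg _) (fun n => ?_) h1)
  have h2 : (Q n).op ((S n).op x) = (S n).op x :=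
    (Q n).op_apply_of_mem (h n (Submodule.starProjection_apply_mem _ x))
  have h3 : (1 - (Q n).op) (x - (S n).op x) = x - (Q n).op x := by
    rw [_root_.sub_apply, one_apply_eq_self, map_sub, h2]
    abel
  rw [norm_sub_rev, norm_sub_rev _ x, ← h3]
  refine ((1 - (Q n).op).le_of_opNorm_le (one_sub_norm_le (Q n).op_adjoint (Q n).op_comp) _).trans ?_
  rw [one_mul]

/-! ### Pure states and the entropy of the marginal on `A` -/

section PureA

variable {A B K L : Hilb.{u}}

theorem hasSum_margA_rankOne (ψ : A ⊠ B) (x y : A) :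
    HasSum (fun j => ⟪inR A (onb B j) x, (InnerProductSpace.rankOne ℂ ψ ψ : Op (A ⊠ B))
      (inR A (onb B j) y)⟫_ℂ) ⟪(inL y B)† ψ, (inL x B)† ψ⟫_ℂ := by
  refine ((onb B).hasSum_inner_mul_inner _ _).congr_fun fun j => ?_
  rw [inner_rankOne_right, adjoint_inner_left, adjoint_inner_right]
  rfl

theorem inner_margA_rankOne {ψ : A ⊠ B}
    (htr : etr (InnerProductSpace.rankOne ℂ ψ ψ : Op (A ⊠ B)) ≠ ⊤) (x y : A) :
    ⟪x, margA (InnerProductSpace.rankOne ℂ ψ ψ : Op (A ⊠ B)) y⟫_ℂ =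
      ⟪(inL y B)† ψ, (inL x B)† ψ⟫_ℂ :=
  (hasSum_inner_ptrace tsum_slice_left (InnerProductSpace.isPositive_rankOne_self ψ) htr x y).unique
    (hasSum_margA_rankOne ψ x y)

/-- When `Q` contains the partial inner products of `ψ` with the vectors of `P`, it cuts nothing off
`(P ⊗ 1) ψ`, so the marginal of the truncation is the truncated marginal. -/
theorem margA_cj_rankOne {ψ : A ⊠ B}
    (htr : etr (InnerProductSpace.rankOne ℂ ψ ψ : Op (A ⊠ B)) ≠ ⊤) (P : FinProj A) (Q : FinProj B)
    (hQ : ∀ x ∈ P.1, (inL x B)† ψ ∈ Q.1) :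
    margA (cj (tmap P.incl† Q.incl†) (InnerProductSpace.rankOne ℂ ψ ψ : Op (A ⊠ B))) =
      cj P.incl† (margA (InnerProductSpace.rankOne ℂ ψ ψ : Op (A ⊠ B))) := by
  have hadj : ∀ x : P.space, (inL x Q.space)† (tmap P.incl† Q.incl† ψ) =
      Q.incl† ((inL (P.incl x) B)† ψ) := fun x => by
    have h1 := congrArg adjoint (tmap_comp_inL P.incl Q.incl x)
    rw [adjoint_comp, adjoint_comp, tmap_adjoint] at h1
    exact congrArg (fun f => f ψ) h1
  refine ContinuousLinearMap.ext fun y => ext_inner_left ℂ fun x => ?_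
  rw [inner_cj, adjoint_adjoint, inner_margA_rankOne htr, cj_rankOne,
    inner_margA_rankOne (etr_ne_top _), hadj, hadj, adjoint_inner_right]
  have h2 : Q.incl (Q.incl† ((inL (P.incl y) B)† ψ)) = (inL (P.incl y) B)† ψ :=
    (congrArg (fun f => f ((inL (P.incl y) B)† ψ)) Q.incl_comp_adjoint).trans
      (Q.op_apply_of_mem (hQ _ y.2))
  rw [h2]

theorem sliceA_mem (ψ : A ⊠ B) (Q : FinProj B) {s : Set A} (h : ∀ x ∈ s, (inL x B)† ψ ∈ Q.1) {x : A}
    (hx : x ∈ Submodule.span ℂ s) : (inL x B)† ψ ∈ Q.1 := by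
  induction hx using Submodule.span_induction with
  | mem x hx => exact h x hx
  | zero =>
    have : inL (0 : A) B = 0 := by
      ext b
      rw [inL_apply, ← zero_smul ℂ (0 : A), tmk_smul_left, zero_smul]
      rfl
    rw [this, map_zero]
    exact Q.1.zero_mem
  | add x y _ _ hx hy =>
    have : inL (x + y) B = inL x B + inL y B := by
      ext b
      exact tmk_add_left x y b
    rw [this, map_add]
    exact Q.1.add_mem hx hy
  | smul c x _ hx =>
    have : inL (c • x) B = c • inL x B := by
      ext b
      exact tmk_smul_left c x b
    rw [this, map_smulₛₗ]
    exact Q.1.smul_mem _ hx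

theorem homExt_eq_entropyA {F : Op (A ⊠ B) → ℝ≥0∞}
    (hF : ∀ ω ∈ pureStates (A ⊠ B), F ω = entropy (margA ω)) {φ : A ⊠ B}
    (htr : etr (InnerProductSpace.rankOne ℂ φ φ : Op (A ⊠ B)) ≠ ⊤) :
    homExt F (InnerProductSpace.rankOne ℂ φ φ) =
      homExt entropy (margA (InnerProductSpace.rankOne ℂ φ φ : Op (A ⊠ B))) := by
  have hpos : (InnerProductSpace.rankOne ℂ φ φ : Op (A ⊠ B)).IsPositive :=
    InnerProductSpace.isPositive_rankOne_self φ
  have het : etr (margA (InnerProductSpace.rankOne ℂ φ φ : Op (A ⊠ B))) =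
      etr (InnerProductSpace.rankOne ℂ φ φ : Op (A ⊠ B)) := etr_ptrace tsum_slice_left hpos htr
  by_cases h0 : etr (InnerProductSpace.rankOne ℂ φ φ : Op (A ⊠ B)) = 0
  · rw [homExt_of_etr_eq_zero _ h0, homExt_of_etr_eq_zero _ (het.trans h0)]
  · have hst := normalize_mem_states hpos h0 htr
    have hpure : ((etr (InnerProductSpace.rankOne ℂ φ φ : Op (A ⊠ B))).toReal)⁻¹ •
        (InnerProductSpace.rankOne ℂ φ φ : Op (A ⊠ B)) ∈ pureStates (A ⊠ B) := by
      rw [real_smul_rankOne (by positivity)] at hst ⊢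
      exact rankOne_mem_pureStates hst
    rw [homExt, homExt, het, hF _ hpure, margA, margA, ptrace_real_smul]

theorem IsMonotone.univExt_eq_entropyA {E : EntFun.{u}} (hE : IsMonotone FinDim E)
    (hc : ContFin E) (h : ∀ A B, FinDim A → FinDim B → ∀ ω ∈ pureStates (A ⊠ B),
      E A B ω = entropy (margA ω)) (hA : Sep A) (hB : Sep B) {ω : Op (A ⊠ B)}
    (hω : ω ∈ pureStates (A ⊠ B)) : univExt E A B ω = entropy (margA ω) := by
  have hst : ω ∈ states (A ⊠ B) := extremePoints_subset hω
  have htr : etr ω ≠ ⊤ := by rw [hst.2]; simp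
  have hρ : margA ω ∈ states A :=
    ⟨margA_isPositive hst.1 htr, (etr_ptrace tsum_slice_left hst.1 htr).trans hst.2⟩
  obtain ⟨ψ, rfl⟩ := exists_eq_rankOne hω
  obtain ⟨ι, e, l, he⟩ := exists_isEigenbasis hA hρ.1 (by rw [hρ.2]; simp)
  obtain ⟨s, hs⟩ := exists_seq_finset hA e
  obtain ⟨S, hS⟩ := exists_tendstoId hB
  -- Spectral projectors of the marginal on `A`. On `B` an approximation `S` of the identity is
  -- enlarged by the finitely many slices of `ψ` along the chosen eigenvectors. B allows any such
  -- sequences.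
  set P : ℕ → FinProj A := fun n => spanProj e (s n) with hPdef
  have hP : TendstoId P := fun x => (tendsto_spanProj e x).comp hs
  set Q : ℕ → FinProj B := fun n =>
    ⟨(S n).1 ⊔ Submodule.span ℂ ((fun i => (inL (e i) B)† ψ) '' s n),
      haveI := FiniteDimensional.span_of_finite ℂ
        ((s n).finite_toSet.image fun i => (inL (e i) B)† ψ)
      inferInstance⟩ with hQdef
  have hQ : TendstoId Q := hS.of_le fun n => le_sup_left
  have hmem : ∀ n, ∀ x ∈ (P n).1, (inL x B)† ψ ∈ (Q n).1 := fun n x hx => by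
    refine sliceA_mem ψ (Q n) ?_ hx
    rintro _ ⟨i, hi, rfl⟩
    exact Submodule.mem_sup_right (Submodule.subset_span ⟨i, hi, rfl⟩)
  have hlim := hE.tendsto_truncVal hc hst.1 hP hQ
  refine he.tendsto_entropy hρ hs (hlim.congr fun n => ?_)
  rw [truncVal_eq, ← margA_cj_rankOne htr (P n) (Q n) (hmem n), cj_rankOne]
  exact homExt_eq_entropyA (h _ _ (P n).finDim (Q n).finDim)
    (@etr_ne_top _ (FinDim.tensor (P n).finDim (Q n).finDim) _)

end PureA

/-! ### Pure states and the entropy of the marginal on `B` -/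

section PureB

variable {A B K L : Hilb.{u}}

theorem hasSum_margB_rankOne (ψ : A ⊠ B) (x y : B) :
    HasSum (fun j => ⟪inL (onb A j) B x, (InnerProductSpace.rankOne ℂ ψ ψ : Op (A ⊠ B))
      (inL (onb A j) B y)⟫_ℂ) ⟪(inR A y)† ψ, (inR A x)† ψ⟫_ℂ := by
  refine ((onb A).hasSum_inner_mul_inner _ _).congr_fun fun j => ?_
  rw [inner_rankOne_right, adjoint_inner_left, adjoint_inner_right]
  rfl

theorem inner_margB_rankOne {ψ : A ⊠ B}
    (htr : etr (InnerProductSpace.rankOne ℂ ψ ψ : Op (A ⊠ B)) ≠ ⊤) (x y : B) :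
    ⟪x, margB (InnerProductSpace.rankOne ℂ ψ ψ : Op (A ⊠ B)) y⟫_ℂ =
      ⟪(inR A y)† ψ, (inR A x)† ψ⟫_ℂ :=
  (hasSum_inner_ptrace tsum_slice_right (InnerProductSpace.isPositive_rankOne_self ψ) htr x y).unique
    (hasSum_margB_rankOne ψ x y)

theorem margB_cj_rankOne {ψ : A ⊠ B}
    (htr : etr (InnerProductSpace.rankOne ℂ ψ ψ : Op (A ⊠ B)) ≠ ⊤) (P : FinProj B) (Q : FinProj A)
    (hQ : ∀ x ∈ P.1, (inR A x)† ψ ∈ Q.1) :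
    margB (cj (tmap Q.incl† P.incl†) (InnerProductSpace.rankOne ℂ ψ ψ : Op (A ⊠ B))) =
      cj P.incl† (margB (InnerProductSpace.rankOne ℂ ψ ψ : Op (A ⊠ B))) := by
  have hadj : ∀ x : P.space, (inR Q.space x)† (tmap Q.incl† P.incl† ψ) =
      Q.incl† ((inR A (P.incl x))† ψ) := fun x => by
    have h1 := congrArg adjoint (tmap_comp_inR Q.incl P.incl x)
    rw [adjoint_comp, adjoint_comp, tmap_adjoint] at h1
    exact congrArg (fun f => f ψ) h1
  refine ContinuousLinearMap.ext fun y => ext_inner_left ℂ fun x => ?_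
  rw [inner_cj, adjoint_adjoint, inner_margB_rankOne htr, cj_rankOne,
    inner_margB_rankOne (etr_ne_top _), hadj, hadj, adjoint_inner_right]
  have h2 : Q.incl (Q.incl† ((inR A (P.incl y))† ψ)) = (inR A (P.incl y))† ψ :=
    (congrArg (fun f => f ((inR A (P.incl y))† ψ)) Q.incl_comp_adjoint).trans
      (Q.op_apply_of_mem (hQ _ y.2))
  rw [h2]

theorem sliceB_mem (ψ : A ⊠ B) (Q : FinProj A) {s : Set B} (h : ∀ x ∈ s, (inR A x)† ψ ∈ Q.1) {x : B}
    (hx : x ∈ Submodule.span ℂ s) : (inR A x)† ψ ∈ Q.1 := by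
  induction hx using Submodule.span_induction with
  | mem x hx => exact h x hx
  | zero =>
    have : inR A (0 : B) = 0 := by
      ext b
      rw [inR_apply, ← zero_smul ℂ (0 : B), tmk_smul_right, zero_smul]
      rfl
    rw [this, map_zero]
    exact Q.1.zero_mem
  | add x y _ _ hx hy =>
    have : inR A (x + y) = inR A x + inR A y := by
      ext b
      exact tmk_add_right b x y
    rw [this, map_add]
    exact Q.1.add_mem hx hy
  | smul c x _ hx =>
    have : inR A (c • x) = c • inR A x := by
      ext b
      exact tmk_smul_right c b x
    rw [this, map_smulₛₗ]
    exact Q.1.smul_mem _ hx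

theorem homExt_eq_entropyB {F : Op (A ⊠ B) → ℝ≥0∞}
    (hF : ∀ ω ∈ pureStates (A ⊠ B), F ω = entropy (margB ω)) {φ : A ⊠ B}
    (htr : etr (InnerProductSpace.rankOne ℂ φ φ : Op (A ⊠ B)) ≠ ⊤) :
    homExt F (InnerProductSpace.rankOne ℂ φ φ) =
      homExt entropy (margB (InnerProductSpace.rankOne ℂ φ φ : Op (A ⊠ B))) := by
  have hpos : (InnerProductSpace.rankOne ℂ φ φ : Op (A ⊠ B)).IsPositive :=
    InnerProductSpace.isPositive_rankOne_self φ
  have het : etr (margB (InnerProductSpace.rankOne ℂ φ φ : Op (A ⊠ B))) =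
      etr (InnerProductSpace.rankOne ℂ φ φ : Op (A ⊠ B)) := etr_ptrace tsum_slice_right hpos htr
  by_cases h0 : etr (InnerProductSpace.rankOne ℂ φ φ : Op (A ⊠ B)) = 0
  · rw [homExt_of_etr_eq_zero _ h0, homExt_of_etr_eq_zero _ (het.trans h0)]
  · have hst := normalize_mem_states hpos h0 htr
    have hpure : ((etr (InnerProductSpace.rankOne ℂ φ φ : Op (A ⊠ B))).toReal)⁻¹ •
        (InnerProductSpace.rankOne ℂ φ φ : Op (A ⊠ B)) ∈ pureStates (A ⊠ B) := by
      rw [real_smul_rankOne (by positivity)] at hst ⊢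
      exact rankOne_mem_pureStates hst
    rw [homExt, homExt, het, hF _ hpure, margB, margB, ptrace_real_smul]

theorem IsMonotone.univExt_eq_entropyB {E : EntFun.{u}} (hE : IsMonotone FinDim E)
    (hc : ContFin E) (h : ∀ A B, FinDim A → FinDim B → ∀ ω ∈ pureStates (A ⊠ B),
      E A B ω = entropy (margB ω)) (hA : Sep B) (hB : Sep A) {ω : Op (A ⊠ B)}
    (hω : ω ∈ pureStates (A ⊠ B)) : univExt E A B ω = entropy (margB ω) := by
  have hst : ω ∈ states (A ⊠ B) := extremePoints_subset hω
  have htr : etr ω ≠ ⊤ := by rw [hst.2]; simp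
  have hρ : margB ω ∈ states B :=
    ⟨margB_isPositive hst.1 htr, (etr_ptrace tsum_slice_right hst.1 htr).trans hst.2⟩
  obtain ⟨ψ, rfl⟩ := exists_eq_rankOne hω
  obtain ⟨ι, e, l, he⟩ := exists_isEigenbasis hA hρ.1 (by rw [hρ.2]; simp)
  obtain ⟨s, hs⟩ := exists_seq_finset hA e
  obtain ⟨S, hS⟩ := exists_tendstoId hB
  set P : ℕ → FinProj B := fun n => spanProj e (s n) with hPdef
  have hP : TendstoId P := fun x => (tendsto_spanProj e x).comp hs
  set Q : ℕ → FinProj A := fun n =>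
    ⟨(S n).1 ⊔ Submodule.span ℂ ((fun i => (inR A (e i))† ψ) '' s n),
      haveI := FiniteDimensional.span_of_finite ℂ
        ((s n).finite_toSet.image fun i => (inR A (e i))† ψ)
      inferInstance⟩ with hQdef
  have hQ : TendstoId Q := hS.of_le fun n => le_sup_left
  have hmem : ∀ n, ∀ x ∈ (P n).1, (inR A x)† ψ ∈ (Q n).1 := fun n x hx => by
    refine sliceB_mem ψ (Q n) ?_ hx
    rintro _ ⟨i, hi, rfl⟩
    exact Submodule.mem_sup_right (Submodule.subset_span ⟨i, hi, rfl⟩)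
  have hlim := hE.tendsto_truncVal hc hst.1 hQ hP
  refine he.tendsto_entropy hρ hs (hlim.congr fun n => ?_)
  rw [truncVal_eq, ← margB_cj_rankOne htr (P n) (Q n) (hmem n), cj_rankOne]
  exact homExt_eq_entropyB (h _ _ (Q n).finDim (P n).finDim)
    (@etr_ne_top _ (FinDim.tensor (Q n).finDim (P n).finDim) _)

end PureB

theorem IsMonotone.univExt_em4 {E : EntFun.{u}} (hE : IsMonotone FinDim E) (hc : ContFin E)
    (h : EM4 FinDim E) : EM4 Sep (univExt E) := fun _ _ hA hB _ hω =>
  ⟨hE.univExt_eq_entropyA hc (fun A B hA hB ω hω => (h A B hA hB ω hω).1) hA hB hω,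
    hE.univExt_eq_entropyB hc (fun A B hA hB ω hω => (h A B hA hB ω hω).2) hB hA hω⟩

end Entanglement

end

/-! ### The proposition -/

theorem proposition1 (E : Entanglement.EntFun.{u})
    (hE : Entanglement.IsMonotone Entanglement.FinDim E)
    (hcont : ∀ A B, Entanglement.FinDim A → Entanglement.FinDim B →
      Entanglement.ContOnStates (E A B)) :
    -- A) existence
    (Entanglement.IsMonotone Entanglement.Sep (Entanglement.univExt E) ∧
      ∀ A B, Entanglement.Sep A → Entanglement.Sep B →
        Entanglement.IsMonotoneOn A B (Entanglement.univExt E A B) ∧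
        Entanglement.LscOnStates (Entanglement.univExt E A B) ∧
        Entanglement.AgreesOnFiniteRank E (Entanglement.univExt E A B)) ∧
    -- A) uniqueness, on each bipartite system separately
    (∀ A B, Entanglement.Sep A → Entanglement.Sep B →
      ∀ F : Entanglement.Op (A.tensor B) → ENNReal,
        Entanglement.IsMonotoneOn A B F → Entanglement.LscOnStates F →
        Entanglement.AgreesOnFiniteRank E F →
          ∀ ω ∈ Entanglement.states (A.tensor B), F ω = Entanglement.univExt E A B ω) ∧
    -- B) the limit formula
    (∀ A B, Entanglement.Sep A → Entanglement.Sep B →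
      ∀ ω ∈ Entanglement.states (A.tensor B),
        ∀ (P : ℕ → Entanglement.FinProj A) (Q : ℕ → Entanglement.FinProj B),
          Entanglement.TendstoId P → Entanglement.TendstoId Q →
            Filter.Tendsto (fun n => Entanglement.truncVal E (P n) (Q n) ω) Filter.atTop
              (nhds (Entanglement.univExt E A B ω))) ∧
    -- C) each of the properties EM4-EM8 is inherited
    (Entanglement.EM4 Entanglement.FinDim E →
      Entanglement.EM4 Entanglement.Sep (Entanglement.univExt E)) ∧
    (Entanglement.EM5 Entanglement.FinDim E →
      Entanglement.EM5 Entanglement.Sep (Entanglement.univExt E)) ∧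
    (Entanglement.EM6 Entanglement.FinDim E →
      Entanglement.EM6 Entanglement.Sep (Entanglement.univExt E)) ∧
    (Entanglement.EM7 Entanglement.FinDim E →
      Entanglement.EM7 Entanglement.Sep (Entanglement.univExt E)) ∧
    (Entanglement.EM8 Entanglement.FinDim E →
      Entanglement.EM8 Entanglement.Sep (Entanglement.univExt E)) := by
  have hmono : Entanglement.IsMonotone Entanglement.Sep (Entanglement.univExt E) :=
    { em1 := fun _ _ hA hB => hE.univExt_em1 hA hB
      em2A := fun _ _ _ hA hA' hB => hE.univExt_em2A hcont hA hA' hB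
      em2B := fun _ _ _ hA hB hB' => hE.univExt_em2B hcont hB hB' hA
      em3 := fun _ _ _ _ => hE.univExt_em3 }
  refine ⟨⟨hmono, fun A B hA hB => ⟨⟨hmono.em1 A B hA hB, hmono.em2A A A B hA hA hB,
    hmono.em2B A B B hA hB hB, hmono.em3 A B hA hB⟩, Entanglement.univExt_lsc hcont,
    hE.univExt_agrees⟩⟩, fun A B hA hB F hF hlsc hag ω hω =>
      hE.univExt_unique hA hB hF hlsc hag hω, fun A B _ _ ω hω P Q hP hQ =>
      hE.tendsto_truncVal hcont hω.1 hP hQ, hE.univExt_em4 hcont, hE.univExt_em5 hcont, hE.univExt_em6 hcont,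
    hE.univExt_em7 hcont, hE.univExt_em8 hcont⟩
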